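/- Work over $\mathbb{C}$. Let $Q$ be a finite quiver without oriented cycles, with vertex set $Q_0$, arrow set $Q_1$ and Euler product $\langle\gamma,\delta\rangle=\sum_{x\in Q_0}\gamma_x\delta_x-\sum_{a\in Q_1}\gamma_{ta}\delta_{ha}$ on $\mathbb{Z}^{Q_0}$. For $\beta\in\mathbb{N}^{Q_0}$, the group $\mathrm{GL}(\beta)=\prod_x\mathrm{GL}(\beta_x)$ acts on $\mathrm{Rep}(Q,\beta)=\bigoplus_{a}\mathrm{Hom}(\mathbb{C}^{\beta_{ta}},\mathbb{C}^{\beta_{ha}})$. A polynomial $f$ on $\mathrm{Rep}(Q,\beta)$ is a semi-invariant of weight $\sigma\in\mathbb{Z}^{Q_0}$ if $f(g\cdot W)=\prod_x\det(g_x)^{-\sigma(x)}f(W)$; a linear form on $\mathbb{Z}^{Q_0}$ is regarded as a weight through its values on the standard basis. For $V\in\mathrm{Rep}(Q,\alpha)$ and $W\in \mathrm{Rep}(Q,\beta)$ let $$d^V_W:\bigoplus_x\mathrm{Hom}(V(x),W(x))\to\bigoplus_a\mathrm{Hom}(V(ta),W(ha)),\qquad \phi\mapsto(\phi(ha)V(a)-W(a)\phi(ta))_a,$$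 with kernel $\mathrm{Hom}_Q(V,W)$ and cokernel $\mathrm{Ext}_Q(V,W)$. If $\langle\alpha,\beta\rangle=0$, then $c^V(W)=\det d^V_W$ (well defined up to sign) is a semi-invariant on $\mathrm{Rep}(Q,\beta)$ of weight $\langle\alpha,\cdot\rangle$. A vector in $\mathbb{Z}^{Q_0}$ is a real Schur root if it is the dimension vector of a representation $V$ with $\mathrm{Ext}_Q(V,V)=0$ and $\mathrm{End}_Q(V)=\mathbb{C}$. Slicing. An arrow $\vec a$ is a 1-source (resp. 1-sink) if its tail (resp. head) is not a vertex of any other arrow; call that vertex $1$ and the other vertex of $\vec a$ $2$. If $\beta_1\le\beta_2$, the slice $(Q_a,\beta_a)$ is obtained by deleting $\vec a$, replacing $\beta_2$ by $\beta_2-\beta_1$, and giving vertex $1$ a copy of each other arrow at vertex $2$ (according to $\mathbb{C}^{\beta_2}=\mathbb{C}^{\beta_1}\oplus\mathbb{C}^{\beta_2-\beta_1}$); vertices of dimension $0$ are dropped. The induced semi-invariant on the slice is $f_a(y)=f(v+y)$, where $v$ is the matrix with entries $\delta_{pq}$ at $\vec a$ and $y\in\mathrm{Rep}(Q_a,\beta_a)$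 is the collection of the matrices at the other arrows. Simplifying. Let $f$ have weight $\langle\alpha,\cdot\rangle=-\langle\cdot,\alpha^*\rangle$. If $\alpha_x=0$, one may delete the arrows out of $x$ and replace $x$ by one copy of itself (of dimension $\beta_x$) for each arrow into $x$, each of these arrows ending in its own copy. Dually, if $\alpha^*_x=0$, one may delete the arrows into $x$ and replace $x$ by one copy for each arrow out of $x$. In both cases $f$ is viewed as the same polynomial on the new quiver. A semi-invariant is called sliceable if a non-zero constant can be reached from it by finitely many slices (at 1-sources or 1-sinks with $\beta_1\le\beta_2$) and simplifications. **Proposition.** Let $\beta_x\ge 1$ for all $x\in Q_0$, let $V\in \mathrm{Rep}(Q,\alpha)$ with $\langle\alpha,\beta\rangle=0$, let $f=c^V$ on $\mathrm{Rep}(Q,\beta)$, and let $\alpha^*\in\mathbb{Z}^{Q_0}$ be the vector with $\langle\alpha,\cdot\rangle=-\langle\cdot,\alpha^*\rangle$. Assume that $f$ is irreducible and depends on all arrows of $Q$. 1. If $\alpha$ is not a real Schur root, then $f$ is not sliceable. If $\alpha^*$ is not a real Schur root, then $f$ is not sliceable. 2. Assume that $\alpha$ is a real Schur root, and let $\vec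 a$ be a 1-source or 1-sink with vertices $1,2$ as above, $\beta_1\le\beta_2$, such that $f_a$ is not constant. Let $\langle\alpha_a,\cdot\rangle$ be the weight of $f_a$ on $(Q_a,\beta_a)$, and let $\langle\alpha_a',\cdot\rangle$ be the weight of the function on $(Q_a',\beta_a')$ obtained from $f_a$ by any finite (possibly empty) sequence of simplifications. Then the following are equivalent: (a) $\alpha_a$ is a real Schur root; (b) $\alpha_a'$ is a real Schur root; (c) $\vec a$ is a 1-source with $\alpha_1=\alpha_2$ or $\alpha^*_1=0$, or $\vec a$ is a 1-sink with $\alpha_1=0$ or $\alpha_1^*=\alpha_2^*$. -/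

import Mathlib

open MvPolynomial

noncomputable section

namespace QuiverSlice

section Basic

variable {Q : Type} [Fintype Q] [DecidableEq Q] [Quiver.{0} Q] [∀ x y : Q, Finite (x ⟶ y)]

/-- A quiver without oriented cycles. -/
def Acyclic (Q : Type) [Quiver.{0} Q] : Prop :=
  ∀ (x : Q) (p : Quiver.Path x x), p.length = 0

/-- The Euler product `∑ₓ γₓ δₓ - ∑ₐ γ_{ta} δ_{ha}`. -/
def euler (γ δ : Q → ℤ) : ℤ :=
  ∑ x, γ x * δ x - ∑ x, ∑ y, (Nat.card (x ⟶ y) : ℤ) * (γ x * δ y)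

/-- The weight `⟨γ, ·⟩`, as a function on vertices. -/
def leftWeight (γ : Q → ℤ) : Q → ℤ := fun x => euler γ (Pi.single x 1)

/-- The weight `-⟨·, γ⟩`, as a function on vertices. -/
def rightWeight (γ : Q → ℤ) : Q → ℤ := fun x => -euler (Pi.single x 1) γ

/-- A dimension vector, viewed as an integer vector. -/
def toInt (α : Q → ℕ) : Q → ℤ := fun x => (α x : ℤ)

/-- The representation space `Rep(Q, α)` with coefficients in `R`. -/
abbrev Rep (R : Type) (α : Q → ℕ) : Type :=
  ∀ x y : Q, (x ⟶ y) → Matrix (Fin (α y)) (Fin (α x)) R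

/-- The coordinates on `Rep(Q, β)`: an arrow together with a matrix position. -/
abbrev Coord (β : Q → ℕ) : Type :=
  Σ (x : Q) (y : Q) (_ : x ⟶ y), Fin (β y) × Fin (β x)

/-- The map `d^V_W : ⨁ₓ Hom(V(x), W(x)) → ⨁ₐ Hom(V(ta), W(ha))`,
`φ ↦ (φ(ha) V(a) - W(a) φ(ta))ₐ`. -/
def dMap {R : Type} [CommRing R] {α β : Q → ℕ} (V : Rep R α) (W : Rep R β) :
    (∀ x : Q, Matrix (Fin (β x)) (Fin (α x)) R) →ₗ[R]
      (∀ x y : Q, (x ⟶ y) → Matrix (Fin (β y)) (Fin (α x)) R) where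
  toFun φ := fun x y a => φ y * V x y a - W x y a * φ x
  map_add' φ ψ := by
    funext x y a
    simp only [Pi.add_apply, Matrix.add_mul, Matrix.mul_add]
    abel
  map_smul' c φ := by
    funext x y a
    simp [smul_sub]

/-- `Hom_Q(V, W)`. -/
def homSpace {α β : Q → ℕ} (V : Rep ℂ α) (W : Rep ℂ β) :
    Submodule ℂ (∀ x : Q, Matrix (Fin (β x)) (Fin (α x)) ℂ) :=
  LinearMap.ker (dMap V W)

/-- `Ext_Q(V, W)`. -/
abbrev ExtSpace {α β : Q → ℕ} (V : Rep ℂ α) (W : Rep ℂ β) : Type :=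
  (∀ x y : Q, (x ⟶ y) → Matrix (Fin (β y)) (Fin (α x)) ℂ) ⧸ LinearMap.range (dMap V W)

/-- An integer vector is a real Schur root if it is the dimension vector of a representation `V`
with `Ext(V, V) = 0` (so `V` is the generic representation) and `End(V) = ℂ`. -/
def IsRealSchurRoot (γ : Q → ℤ) : Prop :=
  ∃ (α : Q → ℕ) (V : Rep ℂ α), γ = toInt α ∧
    Subsingleton (ExtSpace V V) ∧ Module.finrank ℂ (homSpace V V) = 1

/-- The generic representation with variable entries. -/
def genericRep (β : Q → ℕ) : Rep (MvPolynomial (Coord β) ℂ) β :=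
  fun x y a => Matrix.of fun i j => X ⟨x, y, a, i, j⟩

/-- Index set of the standard basis of `⨁ₓ Hom(ℂ^{αₓ}, ℂ^{βₓ})`. -/
abbrev DomIdx (α β : Q → ℕ) : Type := Σ x : Q, Fin (β x) × Fin (α x)

/-- Index set of the standard basis of `⨁ₐ Hom(ℂ^{α_{ta}}, ℂ^{β_{ha}})`. -/
abbrev CodIdx (α β : Q → ℕ) : Type :=
  Σ (x : Q) (y : Q) (_ : x ⟶ y), Fin (β y) × Fin (α x)

/-- The Schofield semi-invariant `c^V(W) = det d^V_W`, a polynomial in the entries of `W`.  The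
bijection `e` orders the two standard bases compatibly; it exists exactly when `⟨α, β⟩ = 0`, and
changing it changes `c^V` by a sign only. -/
def schofield {α β : Q → ℕ} (V : Rep ℂ α) (e : DomIdx α β ≃ CodIdx α β) :
    MvPolynomial (Coord β) ℂ :=
  Matrix.det (Matrix.of fun r c : DomIdx α β =>
    dMap (R := MvPolynomial (Coord β) ℂ) (fun x y a => (V x y a).map C) (genericRep β)
      (Pi.single c.1 (Matrix.single c.2.1 c.2.2 1))
      (e r).1 (e r).2.1 (e r).2.2.1 (e r).2.2.2.1 (e r).2.2.2.2)

/-- The value of a polynomial function on `Rep(Q, β)`. -/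
def evalAt {β : Q → ℕ} (f : MvPolynomial (Coord β) ℂ) (W : Rep ℂ β) : ℂ :=
  eval (fun c => W c.1 c.2.1 c.2.2.1 c.2.2.2.1 c.2.2.2.2) f

/-- The action of `GL(β)` on `Rep(Q, β)` by base change. -/
def act {β : Q → ℕ} (g : ∀ x : Q, GL (Fin (β x)) ℂ) (W : Rep ℂ β) : Rep ℂ β :=
  fun x y a => (g y : Matrix (Fin (β y)) (Fin (β y)) ℂ) * W x y a *
    ((g x)⁻¹ : GL (Fin (β x)) ℂ).val

/-- `f` is a semi-invariant of weight `∏ₓ detₓ^{σ(x)}`: `f(g W) = σ(g)⁻¹ f(W)`. -/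
def IsSemiInvariant {β : Q → ℕ} (f : MvPolynomial (Coord β) ℂ) (σ : Q → ℤ) : Prop :=
  ∀ (g : ∀ x : Q, GL (Fin (β x)) ℂ) (W : Rep ℂ β),
    evalAt f (act g W) =
      (∏ x, (g x : Matrix (Fin (β x)) (Fin (β x)) ℂ).det ^ σ x)⁻¹ * evalAt f W

end Basic

section Slice

variable {Q : Type} [Quiver.{0} Q]

/-- The arrow `a` is a 1-source: its tail is not a vertex of any other arrow. -/
def IsOneSource {x y : Q} (a : x ⟶ y) : Prop :=
  ∀ (u v : Q) (b : u ⟶ v), u = x ∨ v = x → (⟨u, v, b⟩ : Quiver.Total Q) = ⟨x, y, a⟩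

/-- The arrow `a` is a 1-sink: its head is not a vertex of any other arrow. -/
def IsOneSink {x y : Q} (a : x ⟶ y) : Prop :=
  ∀ (u v : Q) (b : u ⟶ v), u = y ∨ v = y → (⟨u, v, b⟩ : Quiver.Total Q) = ⟨x, y, a⟩

variable [DecidableEq Q]

/-- The dimension vector of the slice at the arrow between the vertex `l` (a 1-source or 1-sink,
numbered `1` in the usual picture) and the vertex `j` (numbered `2`): `β_j` becomes `β_j - β_l`.
It is only used when `β_l ≤ β_j`. -/
def sliceDim (β : Q → ℕ) (l j : Q) : Q → ℕ := fun x => if x = j then β j - β l else β x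

/-- The vertices of the sliced quiver: those of `Q` whose new dimension is not zero (a vertex of
dimension zero carries nothing).  If no `β_x` is zero, this only drops `j` when `β_l = β_j`. -/
def SliceVertex (β : Q → ℕ) (l j : Q) : Type := {x : Q // sliceDim β l j x ≠ 0}

/-- The map `l ↦ j`, `x ↦ x` for `x ≠ l`. -/
def fold (l j x : Q) : Q := if x = l then j else x

/-- The sliced quiver: the arrow between `l` and `j` is removed, and `l` receives a copy of every
other arrow at `j`.  (No other arrow of `Q` touches `l`.) -/
instance sliceQuiver (β : Q → ℕ) (l j : Q) : Quiver.{0} (SliceVertex β l j) :=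
  ⟨fun x y => (fold l j x.1 ⟶ fold l j y.1)⟩

instance (β : Q → ℕ) (l j : Q) : DecidableEq (SliceVertex β l j) :=
  inferInstanceAs (DecidableEq {x : Q // sliceDim β l j x ≠ 0})

instance [Fintype Q] (β : Q → ℕ) (l j : Q) : Fintype (SliceVertex β l j) :=
  inferInstanceAs (Fintype {x : Q // sliceDim β l j x ≠ 0})

instance [h : ∀ x y : Q, Finite (x ⟶ y)] (β : Q → ℕ) (l j : Q) (x y : SliceVertex β l j) :
    Finite (x ⟶ y) :=
  h (fold l j x.1) (fold l j y.1)

/-- The dimension vector on the sliced quiver. -/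
def sliceBeta (β : Q → ℕ) (l j : Q) : SliceVertex β l j → ℕ := fun x => sliceDim β l j x.1

/-- The decomposition `ℂ^{β_j} = ℂ^{β_l} ⊕ ℂ^{β_j - β_l}` on indices: the vertex `l` of the sliced
quiver carries the first `β_l` coordinates at `j`, the vertex `j` the remaining ones. -/
def sliceIdx {β : Q → ℕ} {l j : Q} (hle : β l ≤ β j) (x : SliceVertex β l j)
    (i : Fin (sliceBeta β l j x)) : Fin (β (fold l j x.1)) :=
  ⟨if x.1 = j then β l + i else i, by
    obtain ⟨x, hx⟩ := x
    obtain ⟨i, hi⟩ := i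
    simp only [sliceBeta, sliceDim] at hi
    simp only [fold]
    split_ifs at hi ⊢ with h1 h2 h2
    · omega
    · subst h1; omega
    · subst h2; omega
    · exact hi⟩

/-- The coordinates on the slice, as coordinates on `Rep(Q, β)`. -/
def sliceCoord {β : Q → ℕ} {l j : Q} (hle : β l ≤ β j) :
    Coord (sliceBeta β l j) → Coord β :=
  fun c => ⟨fold l j c.1.1, fold l j c.2.1.1, c.2.2.1,
    sliceIdx hle c.2.1 c.2.2.2.1, sliceIdx hle c.1 c.2.2.2.2⟩

/-- The restriction of `f` to the representations whose matrix at the arrow touching `l` has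
entries `δ_{pq}`, that is, the polynomial `y ↦ f(v + y)` with `v` that fixed matrix. -/
def restrictAt {β : Q → ℕ} (l : Q) (f : MvPolynomial (Coord β) ℂ) : MvPolynomial (Coord β) ℂ :=
  bind₁ (fun c : Coord β =>
    if c.1 = l ∨ c.2.1 = l then
      C (if (c.2.2.2.1 : ℕ) = (c.2.2.2.2 : ℕ) then 1 else 0)
    else X c) f

/-- `fa` is the semi-invariant induced by `f` on the slice: `fa(y) = f(v + y)`. -/
def IsInduced {β : Q → ℕ} {l j : Q} (hle : β l ≤ β j) (f : MvPolynomial (Coord β) ℂ)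
    (fa : MvPolynomial (Coord (sliceBeta β l j)) ℂ) : Prop :=
  rename (sliceCoord hle) fa = restrictAt l f

theorem sliceCoord_injective {β : Q → ℕ} {l j : Q}
    (hlj : l ≠ j) (hle : β l ≤ β j) : Function.Injective (sliceCoord (β := β) hle) := by
  have key : ∀ (x y : SliceVertex β l j) (p : Fin (sliceBeta β l j x)) (q : Fin (sliceBeta β l j y)),
      fold l j x.1 = fold l j y.1 → (sliceIdx hle x p : ℕ) = sliceIdx hle y q → x = y := by
    rintro ⟨x, hx⟩ ⟨y, hy⟩ ⟨p, hp⟩ ⟨q, hq⟩ h1 h2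
    have hp' : p < sliceDim β l j x := hp
    have hq' : q < sliceDim β l j y := hq
    simp only [sliceDim, sliceIdx, fold] at h1 h2 hp' hq'
    apply Subtype.ext
    simp only
    grind
  rintro ⟨x, y, a, p, q⟩ ⟨x', y', a', p', q'⟩ h
  simp only [sliceCoord] at h
  have e1 := congrArg (fun c : Coord β => c.1) h
  have e2 := congrArg (fun c : Coord β => c.2.1) h
  have e3 := congrArg (fun c : Coord β => (c.2.2.2.1 : ℕ)) h
  have e4 := congrArg (fun c : Coord β => (c.2.2.2.2 : ℕ)) h
  simp only at e1 e2 e3 e4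
  obtain rfl := key _ _ _ _ e1 e4
  obtain rfl := key _ _ _ _ e2 e3
  simp only [Sigma.mk.injEq, heq_eq_eq, true_and, Prod.mk.injEq] at h
  obtain ⟨rfl, h5, h6⟩ := h
  congr 4
  · apply Fin.ext
    simp only [sliceIdx] at e3
    grind
  · apply Fin.ext
    simp only [sliceIdx] at e4
    grind

theorem exists_sliceIdx {β : Q → ℕ} {l j : Q}
    (hle : β l ≤ β j) (x : Q) (hx : x ≠ l) (p : Fin (β x)) (hlj : l ≠ j) :
    ∃ (u : SliceVertex β l j) (i : Fin (sliceBeta β l j u)),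
      fold l j u.1 = x ∧ (sliceIdx hle u i : ℕ) = p := by
  have hp := p.2
  by_cases h : x = j
  · subst h
    by_cases h2 : (p : ℕ) < β l
    · refine ⟨⟨l, ?_⟩, ⟨p, ?_⟩, ?_, ?_⟩ <;> simp [sliceDim, sliceBeta, fold, sliceIdx, hlj] <;> omega
    · refine ⟨⟨x, ?_⟩, ⟨p - β l, ?_⟩, ?_, ?_⟩ <;>
        simp [sliceDim, sliceBeta, fold, sliceIdx, hx] <;> omega
  · refine ⟨⟨x, ?_⟩, ⟨p, ?_⟩, ?_, ?_⟩ <;> simp [sliceDim, sliceBeta, fold, sliceIdx, hx, h] <;> omega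

/-- The induced semi-invariant exists and is unique. -/
theorem existsUnique_isInduced {β : Q → ℕ} {l j : Q}
    (hlj : l ≠ j) (hle : β l ≤ β j) (f : MvPolynomial (Coord β) ℂ) :
    ∃! fa, IsInduced hle f fa := by
  have hinj := rename_injective (R := ℂ) _ (sliceCoord_injective (β := β) hlj hle)
  suffices h : ∃ fa, IsInduced hle f fa by
    obtain ⟨fa, h⟩ := h
    exact ⟨fa, h, fun g hg => hinj (hg.trans h.symm)⟩
  suffices h : restrictAt l f ∈ (rename (R := ℂ) (sliceCoord (β := β) (l := l) (j := j) hle) : _ →ₐ[ℂ] MvPolynomial (Coord β) ℂ).range by exact h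
  unfold restrictAt
  induction f using MvPolynomial.induction_on with
  | C a => exact ⟨C a, by simp⟩
  | add p q hp hq => rw [map_add]; exact add_mem hp hq
  | mul_X p c hp =>
    rw [map_mul]
    refine mul_mem hp ?_
    rw [bind₁_X_right]
    split_ifs with h1 h2
    · exact Subalgebra.algebraMap_mem _ _
    · exact Subalgebra.algebraMap_mem _ _
    · obtain ⟨x, y, a, p, q⟩ := c
      push Not at h1
      obtain ⟨u, i, rfl, hi⟩ := exists_sliceIdx hle x h1.1 q hlj
      obtain ⟨v, k, rfl, hk⟩ := exists_sliceIdx hle y h1.2 p hlj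
      refine ⟨X ⟨u, v, a, k, i⟩, ?_⟩
      simp only [AlgHom.toRingHom_eq_coe, RingHom.coe_coe, rename_X, sliceCoord]
      obtain rfl := Fin.ext hi
      obtain rfl := Fin.ext hk
      rfl

end Slice

section Simplification

variable {Q : Type} [Quiver.{0} Q]

/-- The vertices after the simplification rule at a vertex `x` with `α_x = 0`: `x` is replaced by
one copy for each arrow into `x`. -/
def SplitIn (x : Q) : Type := {y : Q // y ≠ x} ⊕ (Σ y : Q, (y ⟶ x))

/-- The outgoing arrows of `x` are deleted, and each arrow into `x` ends in its own copy of `x`. -/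
def SplitIn.Hom {x : Q} : SplitIn x → SplitIn x → Type
  | Sum.inl y, Sum.inl z => (y.1 ⟶ z.1)
  | Sum.inl y, Sum.inr b => {a : y.1 ⟶ x // (⟨y.1, a⟩ : Σ y : Q, (y ⟶ x)) = b}
  | Sum.inr _, _ => Empty

instance (x : Q) : Quiver.{0} (SplitIn x) := ⟨SplitIn.Hom⟩

/-- The vertex of `Q` that a vertex comes from. -/
def SplitIn.vert {x : Q} : SplitIn x → Q
  | Sum.inl y => y.1
  | Sum.inr _ => x

/-- The arrow of `Q` that an arrow comes from. -/
def SplitIn.arrow {x : Q} : ∀ {u v : SplitIn x}, (u ⟶ v) → (u.vert ⟶ v.vert)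
  | Sum.inl _, Sum.inl _, a => a
  | Sum.inl _, Sum.inr _, a => a.1
  | Sum.inr _, _, a => a.elim

/-- The vertices after the simplification rule at a vertex `x` with `α*_x = 0`: `x` is replaced by
one copy for each arrow out of `x`. -/
def SplitOut (x : Q) : Type := {y : Q // y ≠ x} ⊕ (Σ y : Q, (x ⟶ y))

/-- The arrows into `x` are deleted, and each arrow out of `x` starts in its own copy of `x`. -/
def SplitOut.Hom {x : Q} : SplitOut x → SplitOut x → Type
  | Sum.inl y, Sum.inl z => (y.1 ⟶ z.1)
  | Sum.inr b, Sum.inl y => {a : x ⟶ y.1 // (⟨y.1, a⟩ : Σ y : Q, (x ⟶ y)) = b}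
  | _, Sum.inr _ => Empty

instance (x : Q) : Quiver.{0} (SplitOut x) := ⟨SplitOut.Hom⟩

/-- The vertex of `Q` that a vertex comes from. -/
def SplitOut.vert {x : Q} : SplitOut x → Q
  | Sum.inl y => y.1
  | Sum.inr _ => x

/-- The arrow of `Q` that an arrow comes from. -/
def SplitOut.arrow {x : Q} : ∀ {u v : SplitOut x}, (u ⟶ v) → (u.vert ⟶ v.vert)
  | Sum.inl _, Sum.inl _, a => a
  | Sum.inr _, Sum.inl _, a => a.1
  | Sum.inl _, Sum.inr _, a => a.elim
  | Sum.inr _, Sum.inr _, a => a.elim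

instance (x : Q) : DecidableEq (SplitIn x) := Classical.decEq _

instance (x : Q) : DecidableEq (SplitOut x) := Classical.decEq _

instance [Fintype Q] [∀ x y : Q, Finite (x ⟶ y)] (x : Q) : Fintype (SplitIn x) :=
  haveI : Finite (SplitIn x) :=
    inferInstanceAs (Finite ({y : Q // y ≠ x} ⊕ (Σ y : Q, (y ⟶ x))))
  Fintype.ofFinite _

instance [Fintype Q] [∀ x y : Q, Finite (x ⟶ y)] (x : Q) : Fintype (SplitOut x) :=
  haveI : Finite (SplitOut x) :=
    inferInstanceAs (Finite ({y : Q // y ≠ x} ⊕ (Σ y : Q, (x ⟶ y))))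
  Fintype.ofFinite _

instance [h : ∀ x y : Q, Finite (x ⟶ y)] (x : Q) : ∀ u v : SplitIn x, Finite (u ⟶ v)
  | Sum.inl y, Sum.inl z => h y.1 z.1
  | Sum.inl y, Sum.inr b =>
    inferInstanceAs (Finite {a : y.1 ⟶ x // (⟨y.1, a⟩ : Σ y : Q, (y ⟶ x)) = b})
  | Sum.inr _, _ => inferInstanceAs (Finite Empty)

instance [h : ∀ x y : Q, Finite (x ⟶ y)] (x : Q) : ∀ u v : SplitOut x, Finite (u ⟶ v)
  | Sum.inl y, Sum.inl z => h y.1 z.1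
  | Sum.inr b, Sum.inl y =>
    inferInstanceAs (Finite {a : x ⟶ y.1 // (⟨y.1, a⟩ : Σ y : Q, (x ⟶ y)) = b})
  | Sum.inl _, Sum.inr _ => inferInstanceAs (Finite Empty)
  | Sum.inr _, Sum.inr _ => inferInstanceAs (Finite Empty)

/-- The dimension vector after the simplification: every copy of `x` has dimension `β_x`. -/
def splitInBeta (β : Q → ℕ) (x : Q) : SplitIn x → ℕ := fun u => β u.vert

/-- The dimension vector after the simplification: every copy of `x` has dimension `β_x`. -/
def splitOutBeta (β : Q → ℕ) (x : Q) : SplitOut x → ℕ := fun u => β u.vert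

/-- The coordinates after the simplification, as coordinates on `Rep(Q, β)`. -/
def splitInCoord (β : Q → ℕ) (x : Q) : Coord (splitInBeta β x) → Coord β :=
  fun c => ⟨c.1.vert, c.2.1.vert, SplitIn.arrow c.2.2.1, c.2.2.2⟩

/-- The coordinates after the simplification, as coordinates on `Rep(Q, β)`. -/
def splitOutCoord (β : Q → ℕ) (x : Q) : Coord (splitOutBeta β x) → Coord β :=
  fun c => ⟨c.1.vert, c.2.1.vert, SplitOut.arrow c.2.2.1, c.2.2.2⟩

end Simplification

/-- A polynomial function on a representation space: a finite quiver with a dimension vector and a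
polynomial in the coordinates. -/
structure QuiverFunction where
  Vertex : Type
  [fintypeVertex : Fintype Vertex]
  [decEqVertex : DecidableEq Vertex]
  [quiver : Quiver.{0} Vertex]
  [finiteHom : ∀ x y : Vertex, Finite (x ⟶ y)]
  dim : Vertex → ℕ
  poly : MvPolynomial (Coord dim) ℂ

attribute [instance] QuiverFunction.fintypeVertex QuiverFunction.decEqVertex
  QuiverFunction.quiver QuiverFunction.finiteHom

/-- One slice, at a 1-source or a 1-sink. -/
inductive SliceStep : QuiverFunction → QuiverFunction → Prop
  | source {Q : Type} [Fintype Q] [DecidableEq Q] [Quiver.{0} Q] [∀ x y : Q, Finite (x ⟶ y)]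
      (β : Q → ℕ) (f : MvPolynomial (Coord β) ℂ) {l j : Q} (a : l ⟶ j) (ha : IsOneSource a)
      (hle : β l ≤ β j) (fa : MvPolynomial (Coord (sliceBeta β l j)) ℂ)
      (hfa : IsInduced hle f fa) :
      SliceStep ⟨Q, β, f⟩ ⟨SliceVertex β l j, sliceBeta β l j, fa⟩
  | sink {Q : Type} [Fintype Q] [DecidableEq Q] [Quiver.{0} Q] [∀ x y : Q, Finite (x ⟶ y)]
      (β : Q → ℕ) (f : MvPolynomial (Coord β) ℂ) {l j : Q} (a : j ⟶ l) (ha : IsOneSink a)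
      (hle : β l ≤ β j) (fa : MvPolynomial (Coord (sliceBeta β l j)) ℂ)
      (hfa : IsInduced hle f fa) :
      SliceStep ⟨Q, β, f⟩ ⟨SliceVertex β l j, sliceBeta β l j, fa⟩

/-- One simplification, at a vertex `x` with `α_x = 0` or `α*_x = 0`, where the weight of `f` is
`⟨α, ·⟩ = -⟨·, α*⟩`: the function `f` is viewed as a function `f'` on the simpler quiver. -/
inductive SimplifyStep : QuiverFunction → QuiverFunction → Prop
  | left {Q : Type} [Fintype Q] [DecidableEq Q] [Quiver.{0} Q] [∀ x y : Q, Finite (x ⟶ y)]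
      (β : Q → ℕ) (f : MvPolynomial (Coord β) ℂ) (γ : Q → ℤ)
      (hγ : IsSemiInvariant f (leftWeight γ)) (x : Q) (hx : γ x = 0)
      (f' : MvPolynomial (Coord (splitInBeta β x)) ℂ) (hf' : rename (splitInCoord β x) f' = f) :
      SimplifyStep ⟨Q, β, f⟩ ⟨SplitIn x, splitInBeta β x, f'⟩
  | right {Q : Type} [Fintype Q] [DecidableEq Q] [Quiver.{0} Q] [∀ x y : Q, Finite (x ⟶ y)]
      (β : Q → ℕ) (f : MvPolynomial (Coord β) ℂ) (γ : Q → ℤ)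
      (hγ : IsSemiInvariant f (rightWeight γ)) (x : Q) (hx : γ x = 0)
      (f' : MvPolynomial (Coord (splitOutBeta β x)) ℂ)
      (hf' : rename (splitOutCoord β x) f' = f) :
      SimplifyStep ⟨Q, β, f⟩ ⟨SplitOut x, splitOutBeta β x, f'⟩

/-- `T` is obtained from `S` by finitely many (possibly no) simplifications. -/
def Simplifies (S T : QuiverFunction) : Prop := Relation.ReflTransGen SimplifyStep S T

/-- `S` is sliceable: slicing repeatedly, with possible simplifications, one can reach a non-zero
constant function. -/
def Sliceable (S : QuiverFunction) : Prop :=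
  ∃ T : QuiverFunction,
    Relation.ReflTransGen (fun A B => SliceStep A B ∨ SimplifyStep A B) S T ∧
      ∃ c : ℂ, c ≠ 0 ∧ T.poly = C c

end QuiverSlice

end

set_option linter.unusedSectionVars false

noncomputable section

namespace QuiverSlice

/-! ### The Euler form and the two ways of writing a weight. -/

section Numerics

variable {Q : Type} [Fintype Q] [DecidableEq Q] [Quiver.{0} Q]

/-! Everything is read off from one integer, the Tits form q(α) = ⟨α,α⟩, which is followed through
slices and simplifications.

The value c^V(W) is non-zero exactly when Hom(V,W) = 0. By the Nullstellensatz, a semi-invariant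
with the zeros of an irreducible f and the same non-zero weight is a scalar multiple of f
(`eq_C_mul_of_evalAt_iff`). So a function is recognised as c^V from its weight and from the
vanishing of Hom alone (`represents_of_ne_zero_iff`).

If f = c^V is irreducible, then End(V) = ℂ: an endomorphism with kernel K and image I factors f as
c^K c^I up to a scalar, so K or I is zero (`Represents.endomorphism_eq_zero`). As q(α) = dim End(V)
- dim Ext(V,V), it follows that q(α) ≤ 1, with equality exactly when α is a real Schur root. On an
acyclic quiver the weight determines α, so the question depends only on q
(`IsSchofield.isRealSchurRoot_iff`). The Auslander–Reiten translate N of V has dimension vector α*,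
satisfies q(α*) = q(α), and f is also the determinant of d^W_N up to a scalar
(`Represents.exists_coRepresents`). This makes the right-hand simplifications accessible and settles
the claim about α*.

A simplification leaves the map d unchanged up to isomorphism, on the side of V or on the side of N,
hence preserves q (`IsSchofield.simplifyStep`). For a slice with β_1 < β_2, the induced function is
again irreducible or constant (`SlicePair.irreducible`). In the irreducible case it is represented
by an explicit representation of the sliced quiver, built from V and copies of the projective at
vertex 2 (`hom_eq_bot_iff_of_compat`). Its Tits form is q(α) - (α_2 - α_1)α*_1 at a 1-source and
q(α) - α_1(α*_2 - α*_1) at a 1-sink. If β_1 = β_2 and the slice is not constant, f does not involve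
the arrow and q is unchanged. If the slice is constant, q(α) is a non-zero square.

The subtracted products are non-negative, because Ext-vanishing makes V injective along a 1-source
and N surjective along a 1-sink. So q never grows along slices and is positive just before a
constant is reached. A sliceable f therefore has 0 < q(α) ≤ 1, which is the first part. For the
second part q(α) = 1, and the slice has q = 1 exactly when the subtracted product vanishes, which is
condition (c). -/

theorem leftWeight_apply (γ : Q → ℤ) (x : Q) :
    leftWeight γ x = γ x - ∑ z, (Nat.card (z ⟶ x) : ℤ) * γ z := by
  simp [leftWeight, euler, Pi.single_apply]

theorem rightWeight_apply (γ : Q → ℤ) (x : Q) :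
    rightWeight γ x = ∑ y, (Nat.card (x ⟶ y) : ℤ) * γ y - γ x := by
  have h : ∀ z y : Q, (Nat.card (z ⟶ y) : ℤ) * ((Pi.single x 1 : Q → ℤ) z * γ y) =
      if z = x then (Nat.card (x ⟶ y) : ℤ) * γ y else 0 := by
    intro z y
    by_cases h : z = x
    · subst h; simp
    · simp [h]
  simp only [rightWeight, euler, h]
  rw [Finset.sum_comm (f := fun z y => if z = x then (Nat.card (x ⟶ y) : ℤ) * γ y else 0)]
  simp [Pi.single_apply]

theorem euler_eq_sum_leftWeight (γ δ : Q → ℤ) : euler γ δ = ∑ x, leftWeight γ x * δ x := by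
  simp only [leftWeight_apply, euler, sub_mul, Finset.sum_sub_distrib, Finset.sum_mul]
  rw [Finset.sum_comm]
  simp only [mul_assoc]

theorem euler_eq_sum_rightWeight (γ δ : Q → ℤ) : euler γ δ = -∑ x, γ x * rightWeight δ x := by
  simp only [rightWeight_apply, euler, mul_sub, Finset.sum_sub_distrib, Finset.mul_sum]
  rw [neg_sub]
  congr 1
  exact Finset.sum_congr rfl fun x _ => Finset.sum_congr rfl fun y _ => by ring

theorem euler_add_left (γ γ' δ : Q → ℤ) : euler (γ + γ') δ = euler γ δ + euler γ' δ := by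
  simp [euler_eq_sum_rightWeight, add_mul, Finset.sum_add_distrib]; ring

theorem euler_add_right (γ δ δ' : Q → ℤ) : euler γ (δ + δ') = euler γ δ + euler γ δ' := by
  simp [euler_eq_sum_leftWeight, mul_add, Finset.sum_add_distrib]

theorem euler_smul_left (c : ℤ) (γ δ : Q → ℤ) : euler (c • γ) δ = c * euler γ δ := by
  simp [euler_eq_sum_rightWeight, Finset.mul_sum, mul_assoc]

theorem euler_smul_right (c : ℤ) (γ δ : Q → ℤ) : euler γ (c • δ) = c * euler γ δ := by
  simp only [euler_eq_sum_leftWeight, Finset.mul_sum, Pi.smul_apply, smul_eq_mul]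
  exact Finset.sum_congr rfl fun x _ => by ring

theorem euler_single_right (γ : Q → ℤ) (x : Q) : euler γ (Pi.single x 1) = leftWeight γ x := rfl

theorem leftWeight_eq_rightWeight_iff (γ δ : Q → ℤ) :
    leftWeight γ = rightWeight δ ↔ ∀ η, euler γ η = -euler η δ := by
  constructor
  · intro h η
    rw [euler_eq_sum_leftWeight, euler_eq_sum_rightWeight, h, neg_neg]
    exact Finset.sum_congr rfl fun x _ => mul_comm _ _
  · intro h
    funext x
    rw [← euler_single_right, h, rightWeight]

/-- The Euler form takes the same value on a vector and on its Coxeter transform. -/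
theorem euler_self_eq_of_dual {γ δ : Q → ℤ} (h : ∀ η, euler γ η = -euler η δ) :
    euler δ δ = euler γ γ := by
  -- Testing on γ and on δ gives ⟨γ,γ⟩ = -⟨γ,δ⟩ = ⟨δ,δ⟩.
  have h1 := h γ
  have h2 := h δ
  omega

end Numerics

/-! ### Consequences of the absence of oriented cycles. -/

section Acyclic

variable {Q : Type} [Quiver.{0} Q]

theorem exists_path_of_transGen {x y : Q}
    (h : Relation.TransGen (fun u v : Q => Nonempty (u ⟶ v)) x y) :
    ∃ p : Quiver.Path x y, 0 < p.length := by
  induction h with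
  | single h => obtain ⟨a⟩ := h; exact ⟨a.toPath, by simp⟩
  | tail _ h ih =>
    obtain ⟨a⟩ := h
    obtain ⟨p, _⟩ := ih
    exact ⟨p.cons a, by simp⟩

/-- Acyclicity is irreflexivity of the transitive closure of "there is an arrow", and on a finite
set a transitive irreflexive relation is well-founded. This is the induction that makes the Euler
form unitriangular. -/
theorem Acyclic.wellFounded [Finite Q] (hQ : Acyclic Q) :
    WellFounded (fun u v : Q => Nonempty (u ⟶ v)) := by
  have : Std.Irrefl (Relation.TransGen (fun u v : Q => Nonempty (u ⟶ v))) :=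
    ⟨fun x h => by
      obtain ⟨p, hp⟩ := exists_path_of_transGen h
      have := hQ x p
      omega⟩
  exact (Finite.wellFounded_of_trans_of_irrefl
    (Relation.TransGen (fun u v : Q => Nonempty (u ⟶ v)))).mono fun _ _ h => .single h

theorem Acyclic.wellFounded_swap [Finite Q] (hQ : Acyclic Q) :
    WellFounded (fun u v : Q => Nonempty (v ⟶ u)) := by
  have : Std.Irrefl (Function.swap (Relation.TransGen (fun u v : Q => Nonempty (u ⟶ v)))) :=
    ⟨fun x h => by
      obtain ⟨p, hp⟩ := exists_path_of_transGen h
      have := hQ x p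
      omega⟩
  have : IsTrans Q (Function.swap (Relation.TransGen (fun u v : Q => Nonempty (u ⟶ v)))) :=
    ⟨fun _ _ _ h1 h2 => h2.trans h1⟩
  exact (Finite.wellFounded_of_trans_of_irrefl
    (Function.swap (Relation.TransGen (fun u v : Q => Nonempty (u ⟶ v))))).mono
      fun _ _ h => .single h

theorem Acyclic.path_eq_nil (hQ : Acyclic Q) {x : Q} (p : Quiver.Path x x) : p = .nil :=
  p.eq_nil_of_length_zero (hQ x p)

theorem Acyclic.ne_of_hom (hQ : Acyclic Q) {x y : Q} (a : x ⟶ y) : x ≠ y := by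
  rintro rfl
  simpa using hQ x a.toPath

/-- Sliced and simplified quivers both project to the original quiver, and projections preserve path
lengths. So acyclicity survives every step. -/
theorem Acyclic.of_prefunctor {R : Type} [Quiver.{0} R] (hQ : Acyclic Q) (F : R ⥤q Q) :
    Acyclic R := by
  intro x p
  have h : ∀ {y : R} (p : Quiver.Path x y), (F.mapPath p).length = p.length := by
    intro y p
    induction p with
    | nil => rfl
    | cons p a ih => simp [ih]
  rw [← h]
  exact hQ _ _

/-- Paths with a given target, decomposed by their last arrow. -/
def pathEquiv (x y : Q) : Quiver.Path x y ≃ PLift (x = y) ⊕ Σ z : Q, Quiver.Path x z × (z ⟶ y) where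
  toFun p := match y, p with
    | _, .nil => Sum.inl ⟨rfl⟩
    | _, .cons (b := z) p a => Sum.inr ⟨z, p, a⟩
  invFun s := match s with
    | Sum.inl h => h.down ▸ .nil
    | Sum.inr s => s.2.1.cons s.2.2
  left_inv p := by cases p <;> rfl
  right_inv s := by
    rcases s with ⟨h⟩ | s
    · obtain ⟨h⟩ := h; subst h; rfl
    · rfl

theorem Acyclic.finite_path [Finite Q] [∀ x y : Q, Finite (x ⟶ y)] (hQ : Acyclic Q) (x y : Q) :
    Finite (Quiver.Path x y) := by
  induction y using hQ.wellFounded.induction with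
  | _ y ih =>
    have : ∀ z : Q, Finite (Quiver.Path x z × (z ⟶ y)) := by
      intro z
      by_cases h : Nonempty (z ⟶ y)
      · have := ih z h
        infer_instance
      · have := not_nonempty_iff.1 h
        infer_instance
    exact Finite.of_equiv _ (pathEquiv x y).symm

end Acyclic

/-! ### Dimension vectors of projectives, and injectivity of the weight maps. -/

section Paths

variable {Q : Type} [Fintype Q] [DecidableEq Q] [Quiver.{0} Q] [∀ x y : Q, Finite (x ⟶ y)]

/-- The number of paths from `x`, the dimension vector of an indecomposable projective. -/
def pathCount (x : Q) : Q → ℤ := fun y => Nat.card (Quiver.Path x y)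

theorem pathCount_self (hQ : Acyclic Q) (x : Q) : pathCount x x = 1 := by
  have : Unique (Quiver.Path x x) := ⟨⟨.nil⟩, hQ.path_eq_nil⟩
  simp [pathCount]

theorem pathCount_rec (hQ : Acyclic Q) (x y : Q) :
    pathCount x y = (if x = y then 1 else 0) + ∑ z, (Nat.card (z ⟶ y) : ℤ) * pathCount x z := by
  have := hQ.finite_path
  unfold pathCount
  rw [Nat.card_congr (pathEquiv x y), Nat.card_sum, Nat.card_sigma]
  push_cast
  congr 1
  · by_cases h : x = y <;> simp [h]
  · refine Finset.sum_congr rfl fun z _ => ?_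
    rw [Nat.card_prod]
    push_cast
    ring

/-- Pairing with the projective at `x` is evaluation at `x`: these vectors form the basis dual to
the standard one for the Euler form. -/
theorem leftWeight_pathCount (hQ : Acyclic Q) (x : Q) :
    leftWeight (pathCount x) = Pi.single x 1 := by
  funext y
  rw [leftWeight_apply, pathCount_rec hQ x y, Pi.single_apply]
  simp [eq_comm]

theorem euler_pathCount (hQ : Acyclic Q) (x : Q) (δ : Q → ℤ) : euler (pathCount x) δ = δ x := by
  rw [euler_eq_sum_leftWeight, leftWeight_pathCount hQ]
  simp [Pi.single_apply]

/-- The weight at `x` is `γ x` plus a combination of values at tails of arrows into `x`, so `γ` is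
recovered by induction along arrows. -/
theorem leftWeight_injective (hQ : Acyclic Q) :
    Function.Injective (leftWeight : (Q → ℤ) → Q → ℤ) := by
  intro γ δ h
  funext x
  induction x using hQ.wellFounded.induction with
  | _ x ih =>
    have hx := congrFun h x
    rw [leftWeight_apply, leftWeight_apply] at hx
    have : ∑ z, (Nat.card (z ⟶ x) : ℤ) * γ z = ∑ z, (Nat.card (z ⟶ x) : ℤ) * δ z := by
      refine Finset.sum_congr rfl fun z _ => ?_
      by_cases hz : Nonempty (z ⟶ x)
      · rw [ih z hz]
      · have := not_nonempty_iff.1 hz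
        simp
    omega

theorem rightWeight_injective (hQ : Acyclic Q) :
    Function.Injective (rightWeight : (Q → ℤ) → Q → ℤ) := by
  intro γ δ h
  funext x
  induction x using hQ.wellFounded_swap.induction with
  | _ x ih =>
    have hx := congrFun h x
    rw [rightWeight_apply, rightWeight_apply] at hx
    have : ∑ z, (Nat.card (x ⟶ z) : ℤ) * γ z = ∑ z, (Nat.card (x ⟶ z) : ℤ) * δ z := by
      refine Finset.sum_congr rfl fun z _ => ?_
      by_cases hz : Nonempty (x ⟶ z)
      · rw [ih z hz]
      · have := not_nonempty_iff.1 hz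
        simp
    omega

end Paths

end QuiverSlice

namespace QuiverSlice

/-! ### Polynomials determined by their zero loci. -/

section Nullstellensatz

variable {τ : Type} [Finite τ]

theorem isUnit_of_eval_ne_zero {f : MvPolynomial τ ℂ} (h : ∀ z, eval z f ≠ 0) : IsUnit f := by
  have h0 : zeroLocus ℂ (Ideal.span {f}) = ∅ := by
    rw [zeroLocus_span]
    ext z
    simpa [aeval_eq_eval] using h z
  have h1 := vanishingIdeal_zeroLocus_eq_radical (K := ℂ) (Ideal.span {f})
  rw [h0, vanishingIdeal_empty] at h1
  rw [← Ideal.span_singleton_eq_top, ← Ideal.radical_eq_top, ← h1]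

theorem Irreducible.dvd_of_eval_eq_zero {f g : MvPolynomial τ ℂ} (hf : Irreducible f)
    (h : ∀ z, eval z f = 0 → eval z g = 0) : f ∣ g := by
  have h1 : g ∈ (Ideal.span {f}).radical := by
    rw [← vanishingIdeal_zeroLocus_eq_radical (K := ℂ), mem_vanishingIdeal_iff]
    intro z hz
    rw [zeroLocus_span] at hz
    simp only [Set.mem_singleton_iff, forall_eq, Set.mem_ofPred_eq, aeval_eq_eval] at hz ⊢
    exact h z hz
  obtain ⟨n, hn⟩ := h1
  exact hf.prime.dvd_of_dvd_pow (Ideal.mem_span_singleton.1 hn)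

theorem isUnit_iff_exists_C {f : MvPolynomial τ ℂ} : IsUnit f ↔ ∃ c : ℂ, c ≠ 0 ∧ f = C c := by
  rw [MvPolynomial.isUnit_iff_eq_C_of_isReduced]
  simp

/-- A polynomial with the zero locus of an irreducible polynomial `f` is a power of `f`. -/
theorem Irreducible.eq_C_mul_pow {f g : MvPolynomial τ ℂ} (hf : Irreducible f)
    (h : ∀ z, eval z g = 0 ↔ eval z f = 0) : ∃ (k : ℕ) (c : ℂ), c ≠ 0 ∧ g = C c * f ^ k := by
  have hg : g ≠ 0 := by
    rintro rfl
    refine hf.ne_zero (MvPolynomial.funext fun z => ?_)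
    rw [(h z).1 (map_zero _), map_zero]
  have hfin : FiniteMultiplicity f g := FiniteMultiplicity.of_prime_left hf.prime hg
  obtain ⟨u, hu, hfu⟩ := hfin.exists_eq_pow_mul_and_not_dvd
  -- An irreducible factor `p` of `u` vanishes only where `g`, hence `f`, vanishes. Thus `p` divides
  -- `f` and is associated to it, so `f` would divide `u` again.
  have hunit : IsUnit u := by
    by_contra hnu
    have hu0 : u ≠ 0 := by rintro rfl; exact hfu (dvd_zero f)
    obtain ⟨p, hp, hpu⟩ := WfDvdMonoid.exists_irreducible_factor hnu hu0
    have hpf : p ∣ f := by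
      refine Irreducible.dvd_of_eval_eq_zero hp fun z hz => (h z).1 ?_
      obtain ⟨v, rfl⟩ := hpu
      rw [hu]; simp [hz]
    exact hfu ((hp.associated_of_dvd hf hpf).symm.dvd.trans hpu)
  obtain ⟨c, hc, rfl⟩ := isUnit_iff_exists_C.1 hunit
  exact ⟨_, c, hc, by rw [mul_comm]; exact hu⟩

/-- Adjoining variables keeps a prime prime. It lets `f` be divided inside a polynomial ring that
also contains the entries of a base change matrix. -/
theorem prime_rename {ι : Type} {τ : Type} {φ : ι → τ} (hφ : Function.Injective φ)
    {f : MvPolynomial ι ℂ} (hf : Prime f) : Prime (rename φ f) := by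
  have h1 : Prime (rename (Equiv.ofInjective φ hφ) f) :=
    (MulEquiv.prime_iff (renameEquiv ℂ (Equiv.ofInjective φ hφ))).2 hf
  have h2 := (prime_rename_iff (Set.range φ)).2 h1
  rw [rename_rename] at h2
  exact h2

end Nullstellensatz

/-! ### Evaluation on representations, and weights tested on scalar matrices. -/

section Evaluation

variable {Q : Type} [Fintype Q] [DecidableEq Q] [Quiver.{0} Q] [∀ x y : Q, Finite (x ⟶ y)]
  {β : Q → ℕ}

/-- The representation with given coordinates. -/
def repOf (c : Coord β → ℂ) : Rep ℂ β := fun x y a => Matrix.of fun i k => c ⟨x, y, a, i, k⟩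

/-- The coordinates of a representation. -/
def coordOf (W : Rep ℂ β) : Coord β → ℂ := fun c => W c.1 c.2.1 c.2.2.1 c.2.2.2.1 c.2.2.2.2

theorem evalAt_eq (f : MvPolynomial (Coord β) ℂ) (W : Rep ℂ β) :
    evalAt f W = eval (coordOf W) f := rfl

@[simp] theorem coordOf_repOf (c : Coord β → ℂ) : coordOf (repOf c) = c := rfl

@[simp] theorem repOf_coordOf (W : Rep ℂ β) : repOf (coordOf W) = W := rfl

@[simp] theorem evalAt_repOf (f : MvPolynomial (Coord β) ℂ) (c : Coord β → ℂ) :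
    evalAt f (repOf c) = eval c f := rfl

theorem evalAt_ext {f g : MvPolynomial (Coord β) ℂ} (h : ∀ W, evalAt f W = evalAt g W) : f = g :=
  MvPolynomial.funext fun c => h (repOf c)

theorem exists_evalAt_ne_zero {f : MvPolynomial (Coord β) ℂ} (hf : f ≠ 0) :
    ∃ W, evalAt f W ≠ 0 := by
  by_contra! h
  exact hf (evalAt_ext fun W => by rw [h W]; simp [evalAt])

theorem evalAt_rename {R : Type} [Fintype R] [DecidableEq R] [Quiver.{0} R]
    [∀ x y : R, Finite (x ⟶ y)] {δ : R → ℕ} (φ : Coord β → Coord δ)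
    (f : MvPolynomial (Coord β) ℂ) (W : Rep ℂ δ) :
    evalAt (rename φ f) W = evalAt f (repOf (coordOf W ∘ φ)) := by
  rw [evalAt_eq, eval_rename, evalAt_repOf]

/-- Scaling of a representation by a scalar at each vertex. -/
def scaleRep (t : Q → ℂˣ) (W : Rep ℂ β) : Rep ℂ β :=
  fun x y a => ((t y : ℂ) * (t x : ℂ)⁻¹) • W x y a

/-- The semi-invariance of weight `σ` with respect to the scalar matrices in `GL(β)`. -/
def ScalarWeight (f : MvPolynomial (Coord β) ℂ) (σ : Q → ℤ) : Prop :=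
  ∀ (t : Q → ℂˣ) (W : Rep ℂ β),
    evalAt f (scaleRep t W) = (∏ x, (t x : ℂ) ^ (β x * σ x))⁻¹ * evalAt f W

theorem IsSemiInvariant.scalarWeight {f : MvPolynomial (Coord β) ℂ} {σ : Q → ℤ}
    (h : IsSemiInvariant f σ) : ScalarWeight f σ := by
  intro t W
  have h1 := h (fun x => Units.map (Matrix.scalar (Fin (β x))).toMonoidHom (t x)) W
  have h2 : act (fun x => Units.map (Matrix.scalar (Fin (β x))).toMonoidHom (t x)) W =
      scaleRep t W := by
    funext x y a
    simp only [act, scaleRep]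
    rw [← map_inv]
    ext i k
    simp
    ring
  rw [h2] at h1
  rw [h1]
  simp [zpow_mul]

theorem prod_update_zpow (x : Q) (t : ℂˣ) (τ : Q → ℤ) :
    ∏ y, ((Function.update (fun _ => 1) x t : Q → ℂˣ) y : ℂ) ^ (β y * τ y) =
      (t : ℂ) ^ (β x * τ x) := by
  rw [Finset.prod_eq_single x]
  · simp
  · intro y _ hy
    simp [hy]
  · simp

theorem zpow_two_injective {m n : ℤ} (h : (2 : ℂ) ^ m = 2 ^ n) : m = n := by
  have h1 : (2 : ℝ) ^ m = 2 ^ n := by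
    have h2 := congrArg norm h
    simpa using h2
  exact zpow_right_injective₀ (by norm_num) (by norm_num) h1

/-- Acting by the scalar 2 at the single vertex `x` determines β_x σ(x), hence σ(x) because β_x ≠ 0.
-/
theorem ScalarWeight.unique {f : MvPolynomial (Coord β) ℂ} {σ τ : Q → ℤ} (hβ : ∀ x, β x ≠ 0)
    (hf : f ≠ 0) (hσ : ScalarWeight f σ) (hτ : ScalarWeight f τ) : σ = τ := by
  obtain ⟨W, hW⟩ := exists_evalAt_ne_zero hf
  funext x
  have h2 : (2 : ℂ) ≠ 0 := by norm_num
  have h := (hσ (Function.update (fun _ => 1) x (Units.mk0 2 h2)) W).symm.trans (hτ _ W)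
  have h3 := inv_injective (mul_right_cancel₀ hW h)
  rw [prod_update_zpow, prod_update_zpow] at h3
  have h4 := zpow_two_injective h3
  exact mul_left_cancel₀ (Int.natCast_ne_zero.2 (hβ x)) h4

/-- The same scalar at all vertices acts trivially, so a non-zero semi-invariant has weight
orthogonal to β. -/
theorem ScalarWeight.sum_eq_zero {f : MvPolynomial (Coord β) ℂ} {σ : Q → ℤ} (hf : f ≠ 0)
    (hσ : ScalarWeight f σ) : ∑ x, σ x * β x = 0 := by
  obtain ⟨W, hW⟩ := exists_evalAt_ne_zero hf
  have h2 : (2 : ℂ) ≠ 0 := by norm_num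
  have h := hσ (fun _ => Units.mk0 2 h2) W
  have h1 : scaleRep (fun _ => Units.mk0 2 h2) W = W := by
    funext x y a; simp [scaleRep]
  rw [h1] at h
  have h3 := mul_right_cancel₀ hW ((one_mul _).trans h)
  have h5 : ∀ s : Finset Q, ∏ x ∈ s, (2 : ℂ) ^ (β x * σ x) = 2 ^ (∑ x ∈ s, β x * σ x) := by
    intro s
    induction s using Finset.induction_on with
    | empty => simp
    | insert x s hx ih => rw [Finset.prod_insert hx, Finset.sum_insert hx, ih, zpow_add₀ h2]
  rw [eq_comm, inv_eq_one, Units.val_mk0, h5] at h3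
  have h4 := zpow_two_injective (h3.trans (zpow_zero (2 : ℂ)).symm)
  rw [← h4]
  exact Finset.sum_congr rfl fun x _ => mul_comm _ _

theorem ScalarWeight.C_mul_pow {f : MvPolynomial (Coord β) ℂ} {σ : Q → ℤ} (h : ScalarWeight f σ)
    (c : ℂ) (k : ℕ) : ScalarWeight (C c * f ^ k) (k • σ) := by
  intro t W
  have h1 := h t W
  simp only [evalAt, map_mul, map_pow, eval_C] at h1 ⊢
  rw [h1, mul_pow, ← Finset.prod_inv_distrib, ← Finset.prod_inv_distrib, ← Finset.prod_pow]
  have h2 : ∀ x, ((t x : ℂ) ^ (β x * σ x))⁻¹ ^ k = ((t x : ℂ) ^ (β x * (k • σ) x))⁻¹ := by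
    intro x
    rw [inv_pow, ← zpow_natCast, ← zpow_mul]
    congr 2
    simp; ring
  simp only [h2]
  ring

theorem ScalarWeight.mul {f g : MvPolynomial (Coord β) ℂ} {σ τ : Q → ℤ} (h : ScalarWeight f σ)
    (h' : ScalarWeight g τ) : ScalarWeight (f * g) (σ + τ) := by
  intro t W
  have h1 := h t W
  have h2 := h' t W
  simp only [evalAt, map_mul] at h1 h2 ⊢
  have h3 : ∏ x, (t x : ℂ) ^ (β x * (σ + τ) x) =
      (∏ x, (t x : ℂ) ^ (β x * σ x)) * ∏ x, (t x : ℂ) ^ (β x * τ x) := by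
    rw [← Finset.prod_mul_distrib]
    refine Finset.prod_congr rfl fun x _ => ?_
    rw [← zpow_add₀ (Units.ne_zero _)]
    congr 1
    simp; ring
  rw [h1, h2, h3, mul_inv]
  ring

/-- Two semi-invariants with the same non-trivial weight and the same zero locus are proportional
if one of them is irreducible. -/
theorem eq_C_mul_of_evalAt_iff {f g : MvPolynomial (Coord β) ℂ} {σ : Q → ℤ} (hβ : ∀ x, β x ≠ 0)
    (hf : Irreducible f) (hfσ : ScalarWeight f σ) (hgσ : ScalarWeight g σ) (hσ : σ ≠ 0)
    (h : ∀ W, evalAt g W ≠ 0 ↔ evalAt f W ≠ 0) : ∃ c : ℂ, c ≠ 0 ∧ g = C c * f := by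
  obtain ⟨k, c, hc, rfl⟩ := Irreducible.eq_C_mul_pow hf fun z => not_iff_not.1 (h (repOf z))
  refine ⟨c, hc, ?_⟩
  have h1 : C c * f ^ k ≠ 0 := mul_ne_zero (by simpa using hc) (pow_ne_zero _ hf.ne_zero)
  -- The power `f ^ k` has weight kσ. Since σ ≠ 0, equality of weights forces k = 1.
  have h2 := (hfσ.C_mul_pow c k).unique hβ h1 hgσ
  obtain ⟨x, hx⟩ := Function.ne_iff.1 hσ
  have h3 := congrFun h2 x
  have h4 : ((k : ℤ) - 1) * σ x = 0 := by
    simp at h3; linarith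
  have h5 : k = 1 := by
    rcases mul_eq_zero.1 h4 with h | h
    · omega
    · exact absurd h hx
  rw [h5, pow_one]

end Evaluation

end QuiverSlice

/-! ### Determinants of d and their weights. -/

namespace QuiverSlice

/-- The determinant of a direct sum of endomorphisms. -/
theorem det_piMap {ι : Type} [Fintype ι] (M : ι → Type) [∀ i, AddCommGroup (M i)]
    [∀ i, Module ℂ (M i)] [∀ i, FiniteDimensional ℂ (M i)] (f : ∀ i, M i →ₗ[ℂ] M i) :
    LinearMap.det (LinearMap.pi fun i => (f i).comp (LinearMap.proj i)) =
      ∏ i, LinearMap.det (f i) := by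
  suffices h : ∀ (M : ι → Type) [∀ i, AddCommGroup (M i)] [∀ i, Module ℂ (M i)]
      [∀ i, FiniteDimensional ℂ (M i)] (f : ∀ i, M i →ₗ[ℂ] M i),
      LinearMap.det (LinearMap.pi fun i => (f i).comp (LinearMap.proj i)) =
        ∏ i, LinearMap.det (f i) from h M f
  refine Fintype.induction_empty_option (P := fun ι _ => ∀ (M : ι → Type)
      [∀ i, AddCommGroup (M i)] [∀ i, Module ℂ (M i)] [∀ i, FiniteDimensional ℂ (M i)]
      (f : ∀ i, M i →ₗ[ℂ] M i),
      LinearMap.det (LinearMap.pi fun i => (f i).comp (LinearMap.proj i)) =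
        ∏ i, LinearMap.det (f i)) ?_ ?_ ?_ ι
  · intro α β _ e ih M _ _ _ f
    let _ := Fintype.ofEquiv β e.symm
    rw [← Fintype.prod_equiv e (fun a => LinearMap.det (f (e a))) _ fun _ => rfl,
      ← ih (fun a => M (e a)) fun a => f (e a)]
    let E : (∀ b, M b) ≃ₗ[ℂ] ∀ a, M (e a) := (LinearEquiv.piCongrLeft ℂ M e).symm
    rw [← LinearMap.det_conj _ E]
    congr 1
    refine LinearMap.ext fun v => funext fun a => ?_
    have h : ∀ (w : ∀ b, M b) (a : α), E w a = w (e a) := fun w a => rfl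
    have h2 : E.symm v (e a) = v a := (h (E.symm v) a).symm.trans (by rw [LinearEquiv.apply_symm_apply])
    simp [h, h2]
  · intro M _ _ _ f
    simp [LinearMap.det_eq_one_of_subsingleton]
  · intro α _ ih M _ _ _ f
    rw [Fintype.prod_option, ← ih (fun a => M (some a)) fun a => f (some a),
      ← LinearMap.det_prodMap, ← LinearMap.det_conj _ (LinearEquiv.piOptionEquivProd ℂ)]
    congr 1

/-- Left multiplication acts separately on each of the `n` columns. -/
theorem det_mulLeftMatrix {m n : ℕ} (g : Matrix (Fin m) (Fin m) ℂ) :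
    LinearMap.det (mulLeftLinearMap (Fin n) ℂ g) = g.det ^ n := by
  let E : Matrix (Fin m) (Fin n) ℂ ≃ₗ[ℂ] (Fin n → Fin m → ℂ) :=
    { toFun := fun A k i => A i k
      map_add' := fun _ _ => rfl
      map_smul' := fun _ _ => rfl
      invFun := fun A => Matrix.of fun i k => A k i
      left_inv := fun _ => rfl
      right_inv := fun _ => rfl }
  rw [← LinearMap.det_conj _ E]
  have h : E.toLinearMap ∘ₗ mulLeftLinearMap (Fin n) ℂ g ∘ₗ E.symm.toLinearMap =
      LinearMap.pi fun k => (Matrix.toLin' g).comp (LinearMap.proj k) := by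
    ext v k
    rfl
  rw [h, LinearMap.det_pi]
  simp

section Determinant

variable {Q : Type} [Fintype Q] [DecidableEq Q] [Quiver.{0} Q] [∀ x y : Q, Finite (x ⟶ y)]

/-- The space `⨁ₓ Hom(ℂ^{αₓ}, ℂ^{βₓ})`. -/
abbrev Dom (α β : Q → ℕ) : Type := ∀ x : Q, Matrix (Fin (β x)) (Fin (α x)) ℂ

/-- The space `⨁ₐ Hom(ℂ^{α_{ta}}, ℂ^{β_{ha}})`. -/
abbrev Cod (α β : Q → ℕ) : Type := ∀ x y : Q, (x ⟶ y) → Matrix (Fin (β y)) (Fin (α x)) ℂ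

/-- Coordinates on `Dom α β`. -/
def domEquiv (α β : Q → ℕ) : Dom α β ≃ₗ[ℂ] (DomIdx α β → ℂ) where
  toFun φ r := φ r.1 r.2.1 r.2.2
  map_add' _ _ := rfl
  map_smul' _ _ := rfl
  invFun v x := Matrix.of fun i k => v ⟨x, i, k⟩
  left_inv _ := rfl
  right_inv _ := rfl

/-- Coordinates on `Cod α β`. -/
def codEquiv (α β : Q → ℕ) : Cod α β ≃ₗ[ℂ] (CodIdx α β → ℂ) where
  toFun ψ r := ψ r.1 r.2.1 r.2.2.1 r.2.2.2.1 r.2.2.2.2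
  map_add' _ _ := rfl
  map_smul' _ _ := rfl
  invFun v x y a := Matrix.of fun i k => v ⟨x, y, a, i, k⟩
  left_inv _ := rfl
  right_inv _ := rfl

theorem domEquiv_symm_single {α β : Q → ℕ} (c : DomIdx α β) :
    (domEquiv α β).symm (Pi.single c 1) = Pi.single c.1 (Matrix.single c.2.1 c.2.2 1) := by
  obtain ⟨x, i, k⟩ := c
  funext y
  ext i' k'
  change (Pi.single (⟨x, i, k⟩ : DomIdx α β) (1 : ℂ) : DomIdx α β → ℂ) ⟨y, i', k'⟩ = _
  by_cases h : y = x
  · subst h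
    by_cases h2 : i' = i ∧ k' = k
    · obtain ⟨rfl, rfl⟩ := h2
      simp
    · rw [Pi.single_eq_of_ne, Pi.single_eq_same, Matrix.single_apply_of_ne]
      · tauto
      · intro h3
        simp only [Sigma.mk.injEq, heq_eq_eq, true_and, Prod.mk.injEq] at h3
        exact h2 h3
  · rw [Pi.single_eq_of_ne, Pi.single_eq_of_ne h]
    · rfl
    · intro h3
      exact h (congrArg Sigma.fst h3)

theorem finrank_dom (α β : Q → ℕ) : Module.finrank ℂ (Dom α β) = ∑ x, β x * α x := by
  rw [Module.finrank_pi_fintype]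
  simp [Module.finrank_matrix]

theorem finrank_cod (α β : Q → ℕ) :
    Module.finrank ℂ (Cod α β) = ∑ x, ∑ y, Nat.card (x ⟶ y) * (β y * α x) := by
  rw [Module.finrank_pi_fintype]
  refine Finset.sum_congr rfl fun x _ => ?_
  rw [Module.finrank_pi_fintype]
  refine Finset.sum_congr rfl fun y _ => ?_
  have := Fintype.ofFinite (x ⟶ y)
  rw [Module.finrank_pi_fintype]
  simp [Module.finrank_matrix]

theorem euler_toInt (α β : Q → ℕ) : euler (toInt α) (toInt β) =
    (Module.finrank ℂ (Dom α β) : ℤ) - Module.finrank ℂ (Cod α β) := by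
  rw [finrank_dom, finrank_cod]
  simp only [euler, toInt]
  push_cast
  congr 1
  · exact Finset.sum_congr rfl fun x _ => mul_comm _ _
  · refine Finset.sum_congr rfl fun x _ => Finset.sum_congr rfl fun y _ => by ring

/-- An arbitrary linear identification replaces the ordering of bases in `schofield`. Changing it
multiplies the determinant by a non-zero scalar, which is why `Represents` allows one. -/
theorem nonempty_cod_equiv_dom {α β : Q → ℕ} (h : euler (toInt α) (toInt β) = 0) :
    Nonempty (Cod α β ≃ₗ[ℂ] Dom α β) := by
  rw [euler_toInt, sub_eq_zero] at h
  exact ⟨LinearEquiv.ofFinrankEq _ _ (by exact_mod_cast h.symm)⟩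

theorem euler_eq_zero_of_equiv {α β : Q → ℕ} (ε : Cod α β ≃ₗ[ℂ] Dom α β) :
    euler (toInt α) (toInt β) = 0 := by
  rw [euler_toInt, ε.finrank_eq, sub_self]

/-- `f` is, up to a non-zero scalar, the semi-invariant `c^V`. -/
def Represents {α β : Q → ℕ} (f : MvPolynomial (Coord β) ℂ) (V : Rep ℂ α) : Prop :=
  ∃ (ε : Cod α β ≃ₗ[ℂ] Dom α β) (c : ℂ), c ≠ 0 ∧
    ∀ W, evalAt f W = c * LinearMap.det ((ε : Cod α β →ₗ[ℂ] Dom α β) ∘ₗ dMap V W)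

/-- `f` is, up to a non-zero scalar, the semi-invariant `W ↦ det d^W_N`. -/
def CoRepresents {β ν : Q → ℕ} (f : MvPolynomial (Coord β) ℂ) (N : Rep ℂ ν) : Prop :=
  ∃ (ε : Cod β ν ≃ₗ[ℂ] Dom β ν) (c : ℂ), c ≠ 0 ∧
    ∀ W, evalAt f W = c * LinearMap.det ((ε : Cod β ν →ₗ[ℂ] Dom β ν) ∘ₗ dMap W N)

/-- The endomorphism `ε ∘ d` has the kernel of `d`, so its determinant vanishes independently of
`ε`, exactly when Hom is non-zero. -/
theorem det_dMap_ne_zero_iff {α β : Q → ℕ} (ε : Cod α β ≃ₗ[ℂ] Dom α β) (V : Rep ℂ α)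
    (W : Rep ℂ β) :
    LinearMap.det ((ε : Cod α β →ₗ[ℂ] Dom α β) ∘ₗ dMap V W) ≠ 0 ↔ homSpace V W = ⊥ := by
  have h1 : LinearMap.ker ((ε : Cod α β →ₗ[ℂ] Dom α β) ∘ₗ dMap V W) = homSpace V W := by
    rw [LinearEquiv.ker_comp]; rfl
  rw [← h1, ← LinearMap.isUnit_iff_ker_eq_bot, ← isUnit_iff_ne_zero]
  exact (LinearMap.isUnit_iff_isUnit_det _).symm

variable {α β ν : Q → ℕ} {f : MvPolynomial (Coord β) ℂ} {V : Rep ℂ α} {N : Rep ℂ ν}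

theorem Represents.ne_zero_iff (h : Represents f V) (W : Rep ℂ β) :
    evalAt f W ≠ 0 ↔ homSpace V W = ⊥ := by
  obtain ⟨ε, c, hc, h⟩ := h
  rw [h, ← det_dMap_ne_zero_iff ε]
  simp [hc]

theorem CoRepresents.ne_zero_iff (h : CoRepresents f N) (W : Rep ℂ β) :
    evalAt f W ≠ 0 ↔ homSpace W N = ⊥ := by
  obtain ⟨ε, c, hc, h⟩ := h
  rw [h, ← det_dMap_ne_zero_iff ε]
  simp [hc]

theorem Represents.euler_eq_zero (h : Represents f V) : euler (toInt α) (toInt β) = 0 := by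
  obtain ⟨ε, -⟩ := h
  exact euler_eq_zero_of_equiv ε

theorem CoRepresents.euler_eq_zero (h : CoRepresents f N) : euler (toInt β) (toInt ν) = 0 := by
  obtain ⟨ε, -⟩ := h
  exact euler_eq_zero_of_equiv ε

theorem Represents.C_mul (h : Represents f V) {c : ℂ} (hc : c ≠ 0) : Represents (C c * f) V := by
  obtain ⟨ε, c', hc', h⟩ := h
  exact ⟨ε, c * c', mul_ne_zero hc hc', fun W => by
    simp only [evalAt, map_mul, eval_C] at h ⊢; rw [h, mul_assoc]⟩

theorem CoRepresents.C_mul (h : CoRepresents f N) {c : ℂ} (hc : c ≠ 0) :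
    CoRepresents (C c * f) N := by
  obtain ⟨ε, c', hc', h⟩ := h
  exact ⟨ε, c * c', mul_ne_zero hc hc', fun W => by
    simp only [evalAt, map_mul, eval_C] at h ⊢; rw [h, mul_assoc]⟩

/-- Functions on a representation space given by a polynomial. -/
def IsPolynomial (h : Rep ℂ β → ℂ) : Prop := ∃ g, ∀ W, evalAt g W = h W

theorem isPolynomial_const (c : ℂ) : IsPolynomial fun _ : Rep ℂ β => c :=
  ⟨C c, fun W => by simp [evalAt]⟩

theorem isPolynomial_coord (x y : Q) (a : x ⟶ y) (i : Fin (β y)) (k : Fin (β x)) :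
    IsPolynomial fun W : Rep ℂ β => W x y a i k :=
  ⟨X ⟨x, y, a, i, k⟩, fun W => by simp [evalAt]⟩

theorem IsPolynomial.add {g h : Rep ℂ β → ℂ} (hg : IsPolynomial g) (hh : IsPolynomial h) :
    IsPolynomial fun W => g W + h W := by
  obtain ⟨p, hp⟩ := hg
  obtain ⟨q, hq⟩ := hh
  exact ⟨p + q, fun W => by simp only [evalAt, map_add] at *; rw [hp, hq]⟩

theorem IsPolynomial.mul {g h : Rep ℂ β → ℂ} (hg : IsPolynomial g) (hh : IsPolynomial h) :
    IsPolynomial fun W => g W * h W := by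
  obtain ⟨p, hp⟩ := hg
  obtain ⟨q, hq⟩ := hh
  exact ⟨p * q, fun W => by simp only [evalAt, map_mul] at *; rw [hp, hq]⟩

theorem IsPolynomial.sub {g h : Rep ℂ β → ℂ} (hg : IsPolynomial g) (hh : IsPolynomial h) :
    IsPolynomial fun W => g W - h W := by
  simpa [sub_eq_add_neg] using hg.add ((isPolynomial_const (-1)).mul hh)

theorem IsPolynomial.sum {ι : Type} {s : Finset ι} {h : ι → Rep ℂ β → ℂ}
    (hh : ∀ i ∈ s, IsPolynomial (h i)) : IsPolynomial fun W => ∑ i ∈ s, h i W := by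
  classical
  induction s using Finset.induction_on with
  | empty => simpa using isPolynomial_const 0
  | insert i s hi ih =>
    simp only [Finset.sum_insert hi]
    exact (hh i (by simp)).add (ih fun j hj => hh j (by simp [hj]))

theorem IsPolynomial.prod {ι : Type} {s : Finset ι} {h : ι → Rep ℂ β → ℂ}
    (hh : ∀ i ∈ s, IsPolynomial (h i)) : IsPolynomial fun W => ∏ i ∈ s, h i W := by
  classical
  induction s using Finset.induction_on with
  | empty => simpa using isPolynomial_const 1
  | insert i s hi ih =>
    simp only [Finset.prod_insert hi]
    exact (hh i (by simp)).mul (ih fun j hj => hh j (by simp [hj]))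

theorem IsPolynomial.det {n : Type} [Fintype n] [DecidableEq n] {A : Rep ℂ β → Matrix n n ℂ}
    (h : ∀ i k, IsPolynomial fun W => A W i k) : IsPolynomial fun W => (A W).det := by
  simp only [Matrix.det_apply']
  exact IsPolynomial.sum fun σ _ => (isPolynomial_const _).mul (IsPolynomial.prod fun i _ => h _ _)

theorem IsPolynomial.functional {ι : Type} [Finite ι] {h : Rep ℂ β → ι → ℂ}
    (hh : ∀ i, IsPolynomial fun W => h W i) (ℓ : (ι → ℂ) →ₗ[ℂ] ℂ) :
    IsPolynomial fun W => ℓ (h W) := by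
  classical
  have := Fintype.ofFinite ι
  rw [funext fun W => LinearMap.pi_apply_eq_sum_univ ℓ (h W)]
  simp only [smul_eq_mul]
  exact IsPolynomial.sum fun i _ => (hh i).mul (isPolynomial_const _)

/-- Each matrix entry of `ε ∘ d W` is a fixed linear functional of the coordinates of `d W φ` for a
basis vector `φ`. It is therefore polynomial in `W` when those coordinates are. -/
theorem IsPolynomial.det_comp {γ δ : Q → ℕ} (ε : Cod γ δ ≃ₗ[ℂ] Dom γ δ)
    (d : Rep ℂ β → Dom γ δ →ₗ[ℂ] Cod γ δ)
    (hd : ∀ φ x y a i k, IsPolynomial fun W => d W φ x y a i k) :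
    IsPolynomial fun W => LinearMap.det ((ε : Cod γ δ →ₗ[ℂ] Dom γ δ) ∘ₗ d W) := by
  let b := Module.finBasis ℂ (Dom γ δ)
  simp only [← LinearMap.det_toMatrix b]
  refine IsPolynomial.det fun r c => ?_
  simp only [LinearMap.toMatrix_apply]
  exact IsPolynomial.functional (h := fun W => codEquiv γ δ (d W (b c)))
    (fun i => hd _ _ _ _ _ _)
    ((b.coord r) ∘ₗ (ε : Cod γ δ →ₗ[ℂ] Dom γ δ) ∘ₗ ((codEquiv γ δ).symm : _ →ₗ[ℂ] _))

theorem exists_represents (V : Rep ℂ α) (h : euler (toInt α) (toInt β) = 0) :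
    ∃ f : MvPolynomial (Coord β) ℂ, Represents f V := by
  obtain ⟨ε⟩ := nonempty_cod_equiv_dom h
  obtain ⟨f, hf⟩ := IsPolynomial.det_comp ε (fun W : Rep ℂ β => dMap V W) (by
    intro φ x y a i k
    simp only [dMap, LinearMap.coe_mk, AddHom.coe_mk, Matrix.sub_apply, Matrix.mul_apply]
    exact (isPolynomial_const _).sub
      (IsPolynomial.sum fun _ _ => (isPolynomial_coord _ _ _ _ _).mul (isPolynomial_const _)))
  exact ⟨f, ε, 1, one_ne_zero, fun W => by rw [hf, one_mul]⟩

theorem exists_coRepresents (N : Rep ℂ ν) (h : euler (toInt β) (toInt ν) = 0) :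
    ∃ f : MvPolynomial (Coord β) ℂ, CoRepresents f N := by
  obtain ⟨ε⟩ := nonempty_cod_equiv_dom h
  obtain ⟨f, hf⟩ := IsPolynomial.det_comp ε (fun W : Rep ℂ β => dMap W N) (by
    intro φ x y a i k
    simp only [dMap, LinearMap.coe_mk, AddHom.coe_mk, Matrix.sub_apply, Matrix.mul_apply]
    exact (IsPolynomial.sum fun _ _ => (isPolynomial_const _).mul
      (isPolynomial_coord _ _ _ _ _)).sub (isPolynomial_const _))
  exact ⟨f, ε, 1, one_ne_zero, fun W => by rw [hf, one_mul]⟩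

/-- The endomorphism of `Cod γ δ` with given endomorphisms of the summands. -/
def codMap {γ δ : Q → ℕ} (u : ∀ x y : Q, Matrix (Fin (δ y)) (Fin (γ x)) ℂ →ₗ[ℂ]
    Matrix (Fin (δ y)) (Fin (γ x)) ℂ) : Cod γ δ →ₗ[ℂ] Cod γ δ where
  toFun ψ x y a := u x y (ψ x y a)
  map_add' _ _ := by funext x y a; simp
  map_smul' _ _ := by funext x y a; simp

/-- The endomorphism of `Dom γ δ` with given endomorphisms of the summands. -/
def domMap {γ δ : Q → ℕ} (u : ∀ x : Q, Matrix (Fin (δ x)) (Fin (γ x)) ℂ →ₗ[ℂ]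
    Matrix (Fin (δ x)) (Fin (γ x)) ℂ) : Dom γ δ →ₗ[ℂ] Dom γ δ where
  toFun φ x := u x (φ x)
  map_add' _ _ := by funext x; simp
  map_smul' _ _ := by funext x; simp

theorem det_domMap {γ δ : Q → ℕ} (u : ∀ x : Q, Matrix (Fin (δ x)) (Fin (γ x)) ℂ →ₗ[ℂ]
    Matrix (Fin (δ x)) (Fin (γ x)) ℂ) : LinearMap.det (domMap u) = ∏ x, LinearMap.det (u x) :=
  det_piMap _ u

theorem det_codMap {γ δ : Q → ℕ} (u : ∀ x y : Q, Matrix (Fin (δ y)) (Fin (γ x)) ℂ →ₗ[ℂ]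
    Matrix (Fin (δ y)) (Fin (γ x)) ℂ) :
    LinearMap.det (codMap u) = ∏ x, ∏ y, LinearMap.det (u x y) ^ Nat.card (x ⟶ y) := by
  have h1 : ∀ x y, LinearMap.det (u x y) ^ Nat.card (x ⟶ y) = LinearMap.det
      (LinearMap.pi fun a : (x ⟶ y) => (u x y).comp (LinearMap.proj a)) := by
    intro x y
    have := Fintype.ofFinite (x ⟶ y)
    rw [det_piMap]
    simp
  simp only [h1]
  have h2 : ∀ x, ∏ y, LinearMap.det
      (LinearMap.pi fun a : (x ⟶ y) => (u x y).comp (LinearMap.proj a)) =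
      LinearMap.det (LinearMap.pi fun y : Q =>
        (LinearMap.pi fun a : (x ⟶ y) => (u x y).comp (LinearMap.proj a)).comp
          (LinearMap.proj y)) := fun x => (det_piMap _ _).symm
  simp only [h2]
  rw [← det_piMap]
  rfl

/-- Used to compute weights: acting on the representation amounts to composing `d` with
automorphisms of its source and target, whose determinants give the character. -/
theorem det_mul_eq_of_comm {γ δ : Q → ℕ} (ε : Cod γ δ ≃ₗ[ℂ] Dom γ δ)
    {d d' : Dom γ δ →ₗ[ℂ] Cod γ δ} {p : Dom γ δ →ₗ[ℂ] Dom γ δ} {q : Cod γ δ →ₗ[ℂ] Cod γ δ}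
    (h : d' ∘ₗ p = q ∘ₗ d) :
    LinearMap.det ((ε : Cod γ δ →ₗ[ℂ] Dom γ δ) ∘ₗ d') * LinearMap.det p =
      LinearMap.det q * LinearMap.det ((ε : Cod γ δ →ₗ[ℂ] Dom γ δ) ∘ₗ d) := by
  rw [← LinearMap.det_comp, LinearMap.comp_assoc, h, ← LinearMap.det_conj q ε,
    ← LinearMap.det_comp]
  congr 1
  refine LinearMap.ext fun v => ?_
  simp

/-- Left multiplication by `g` intertwines d^V_W and d^V_{gW}. The determinants of `g` on source and
target contribute exponents α_x and the sum of α over tails of arrows into x, whose difference is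
⟨α,·⟩ at x. -/
theorem Represents.isSemiInvariant (h : Represents f V) :
    IsSemiInvariant f (leftWeight (toInt α)) := by
  obtain ⟨ε, c, hc, h⟩ := h
  intro g W
  have hg : ∀ x, (g x : Matrix (Fin (β x)) (Fin (β x)) ℂ).det ≠ 0 := fun x =>
    ((Matrix.isUnit_iff_isUnit_det _).1 (g x).isUnit).ne_zero
  have h1 := det_mul_eq_of_comm ε (d := dMap V W) (d' := dMap V (act g W))
    (p := domMap fun x => mulLeftLinearMap (Fin (α x)) ℂ (g x : Matrix _ _ ℂ))
    (q := codMap fun x y => mulLeftLinearMap (Fin (α x)) ℂ (g y : Matrix _ _ ℂ)) (by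
      refine LinearMap.ext fun φ => ?_
      funext x y a
      simp only [LinearMap.comp_apply, dMap, domMap, codMap, LinearMap.coe_mk, AddHom.coe_mk, act,
        mulLeftLinearMap_apply, Matrix.mul_sub, Matrix.mul_assoc]
      congr 3
      rw [← Matrix.mul_assoc, ← Units.val_mul, inv_mul_cancel]
      simp)
  rw [det_domMap, det_codMap] at h1
  simp only [det_mulLeftMatrix] at h1
  have h2 : (∏ x, (g x : Matrix (Fin (β x)) (Fin (β x)) ℂ).det ^ leftWeight (toInt α) x) *
      ∏ x, ∏ y, ((g y : Matrix (Fin (β y)) (Fin (β y)) ℂ).det ^ α x) ^ Nat.card (x ⟶ y) =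
      ∏ x, (g x : Matrix (Fin (β x)) (Fin (β x)) ℂ).det ^ α x := by
    rw [Finset.prod_comm, ← Finset.prod_mul_distrib]
    refine Finset.prod_congr rfl fun y _ => ?_
    have h3 : ∀ s : Finset Q, ∏ x ∈ s,
        ((g y : Matrix (Fin (β y)) (Fin (β y)) ℂ).det ^ α x) ^ Nat.card (x ⟶ y) =
        (g y : Matrix (Fin (β y)) (Fin (β y)) ℂ).det ^
          (∑ x ∈ s, (Nat.card (x ⟶ y) : ℤ) * toInt α x) := by
      intro s
      induction s using Finset.induction_on with
      | empty => simp
      | insert x s hx ih =>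
        rw [Finset.prod_insert hx, Finset.sum_insert hx, ih, zpow_add₀ (hg y), ← pow_mul, mul_comm,
          mul_comm (α x)]
        simp only [toInt]
        norm_cast
        rw [mul_comm]
    rw [h3, ← zpow_add₀ (hg y), leftWeight_apply, sub_add_cancel]
    simp [toInt]
  have h3 : ∏ x, (g x : Matrix (Fin (β x)) (Fin (β x)) ℂ).det ^ leftWeight (toInt α) x ≠ 0 :=
    Finset.prod_ne_zero_iff.2 fun x _ => zpow_ne_zero _ (hg x)
  have h4 : ∏ x, (g x : Matrix (Fin (β x)) (Fin (β x)) ℂ).det ^ α x ≠ 0 :=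
    Finset.prod_ne_zero_iff.2 fun x _ => pow_ne_zero _ (hg x)
  rw [h, h]
  rw [← h2] at h1 h4
  have h5 := right_ne_zero_of_mul h4
  field_simp
  refine mul_right_cancel₀ h5 ?_
  linear_combination h1

/-- Multiplying φ(x) by t_x turns d^{tW}_N into d^W_N, after scaling the component of each arrow by
the scalar at its tail. Scalar matrices suffice, since weights are compared only through
`ScalarWeight`. -/
theorem CoRepresents.scalarWeight (h : CoRepresents f N) :
    ScalarWeight f (rightWeight (toInt ν)) := by
  obtain ⟨ε, c, hc, h⟩ := h
  intro t W
  have ht : ∀ x, (t x : ℂ) ≠ 0 := fun x => (t x).ne_zero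
  have h1 := det_mul_eq_of_comm ε (d := dMap (scaleRep t W) N) (d' := dMap W N)
    (p := domMap fun x => (t x : ℂ) • LinearMap.id)
    (q := codMap fun x y => (t x : ℂ) • LinearMap.id) (by
      refine LinearMap.ext fun φ => ?_
      funext x y a
      simp only [LinearMap.comp_apply, dMap, domMap, codMap, LinearMap.coe_mk, AddHom.coe_mk,
        scaleRep, LinearMap.smul_apply, LinearMap.id_apply, smul_sub, Matrix.smul_mul,
        Matrix.mul_smul, smul_smul]
      congr 2
      field_simp [ht x])
  rw [det_domMap, det_codMap] at h1
  simp only [LinearMap.det_smul, LinearMap.det_id, mul_one, Module.finrank_matrix,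
    Module.finrank_self, Fintype.card_fin] at h1
  have h2 : (∏ x, (t x : ℂ) ^ (β x * rightWeight (toInt ν) x)) *
      ∏ x, (t x : ℂ) ^ (ν x * β x) =
      ∏ x, ∏ y, ((t x : ℂ) ^ (ν y * β x)) ^ Nat.card (x ⟶ y) := by
    rw [← Finset.prod_mul_distrib]
    refine Finset.prod_congr rfl fun x _ => ?_
    rw [← zpow_natCast, ← zpow_add₀ (ht x)]
    simp only [← pow_mul]
    rw [Finset.prod_pow_eq_pow_sum, ← zpow_natCast, rightWeight_apply]
    congr 1
    push_cast
    simp only [toInt, mul_sub, Finset.mul_sum]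
    rw [mul_comm (ν x : ℤ), sub_add_cancel]
    exact Finset.sum_congr rfl fun y _ => by ring
  have h3 : ∏ x, (t x : ℂ) ^ (ν x * β x) ≠ 0 :=
    Finset.prod_ne_zero_iff.2 fun x _ => pow_ne_zero _ (ht x)
  have h4 : ∏ x, (t x : ℂ) ^ (β x * rightWeight (toInt ν) x) ≠ 0 :=
    Finset.prod_ne_zero_iff.2 fun x _ => zpow_ne_zero _ (ht x)
  rw [h, h]
  rw [← h2] at h1
  field_simp
  refine mul_right_cancel₀ h3 ?_
  linear_combination -h1

theorem evalAt_schofield (V : Rep ℂ α) (e : DomIdx α β ≃ CodIdx α β) (W : Rep ℂ β) :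
    evalAt (schofield V e) W = Matrix.det (Matrix.of fun r c : DomIdx α β =>
      dMap V W (Pi.single c.1 (Matrix.single c.2.1 c.2.2 1))
        (e r).1 (e r).2.1 (e r).2.2.1 (e r).2.2.2.1 (e r).2.2.2.2) := by
  unfold evalAt schofield
  rw [RingHom.map_det]
  congr 1
  ext r c
  have hs : ∀ x : Q, ((Pi.single c.1 (Matrix.single c.2.1 c.2.2 1) :
      ∀ x, Matrix (Fin (β x)) (Fin (α x)) (MvPolynomial (Coord β) ℂ)) x).map
        (eval fun c : Coord β => W c.1 c.2.1 c.2.2.1 c.2.2.2.1 c.2.2.2.2) =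
      (Pi.single c.1 (Matrix.single c.2.1 c.2.2 1) : Dom α β) x := by
    intro x
    obtain ⟨x', i, k⟩ := c
    by_cases h : x = x'
    · subst h
      ext i' k'
      simp [Matrix.single_apply, apply_ite]
    · simp only [Pi.single_eq_of_ne h]
      ext; simp
  simp only [RingHom.mapMatrix_apply, Matrix.map_apply, Matrix.of_apply, dMap, LinearMap.coe_mk,
    AddHom.coe_mk, Matrix.sub_apply, map_sub, Matrix.mul_apply, map_sum, map_mul]
  congr 1
  · refine Finset.sum_congr rfl fun m _ => ?_
    rw [← hs]
    simp
  · refine Finset.sum_congr rfl fun m _ => ?_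
    rw [← hs]
    simp [genericRep]

/-- The bijection `e` induces the identification of target and source, and `schofield` is the
determinant of the resulting endomorphism in the standard basis. -/
theorem schofield_represents (V : Rep ℂ α) (e : DomIdx α β ≃ CodIdx α β) :
    Represents (schofield V e) V := by
  let ε : Cod α β ≃ₗ[ℂ] Dom α β :=
    codEquiv α β ≪≫ₗ LinearEquiv.funCongrLeft ℂ ℂ e ≪≫ₗ (domEquiv α β).symm
  refine ⟨ε, 1, one_ne_zero, fun W => ?_⟩
  rw [one_mul, evalAt_schofield, ← LinearMap.det_toMatrix (Module.Basis.ofEquivFun (domEquiv α β))]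
  congr 1
  ext r c
  rw [LinearMap.toMatrix_apply, Module.Basis.coe_ofEquivFun]
  beta_reduce
  rw [domEquiv_symm_single]
  rfl

end Determinant

end QuiverSlice

namespace QuiverSlice

/-! ### Representations on abstract vector spaces. -/

section LinRep

/-- A finite-dimensional representation of a quiver on abstract vector spaces. -/
structure LinRep (Q : Type) [Quiver.{0} Q] where
  obj : Q → Type
  [addCommGroup : ∀ x, AddCommGroup (obj x)]
  [module : ∀ x, Module ℂ (obj x)]
  [finiteDimensional : ∀ x, FiniteDimensional ℂ (obj x)]
  map : ∀ {x y : Q}, (x ⟶ y) → obj x →ₗ[ℂ] obj y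

attribute [instance] LinRep.addCommGroup LinRep.module LinRep.finiteDimensional

variable {Q : Type} [Quiver.{0} Q]

/-- The dimension vector of a representation. -/
def LinRep.dim (M : LinRep Q) : Q → ℕ := fun x => Module.finrank ℂ (M.obj x)

/-- The map whose kernel and cokernel are `Hom(M, N)` and `Ext(M, N)`. -/
def LinRep.d (M N : LinRep Q) : (∀ x, M.obj x →ₗ[ℂ] N.obj x) →ₗ[ℂ]
    (∀ x y : Q, (x ⟶ y) → M.obj x →ₗ[ℂ] N.obj y) where
  toFun φ x y a := φ y ∘ₗ M.map a - N.map a ∘ₗ φ x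
  map_add' φ ψ := by
    funext x y a
    simp only [Pi.add_apply, LinearMap.add_comp, LinearMap.comp_add]
    abel
  map_smul' c φ := by
    funext x y a
    simp [smul_sub, LinearMap.smul_comp, LinearMap.comp_smul]

/-- The space of homomorphisms between two representations. -/
def LinRep.hom (M N : LinRep Q) : Submodule ℂ (∀ x, M.obj x →ₗ[ℂ] N.obj x) :=
  LinearMap.ker (LinRep.d M N)

theorem LinRep.mem_hom {M N : LinRep Q} {φ : ∀ x, M.obj x →ₗ[ℂ] N.obj x} :
    φ ∈ LinRep.hom M N ↔ ∀ {x y : Q} (a : x ⟶ y) (m : M.obj x),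
      φ y (M.map a m) = N.map a (φ x m) := by
  simp only [hom, LinearMap.mem_ker, d, LinearMap.coe_mk, AddHom.coe_mk, funext_iff,
    Pi.zero_apply, sub_eq_zero, LinearMap.ext_iff, LinearMap.comp_apply]

/-- An isomorphism of representations. -/
structure LinRep.Iso (M N : LinRep Q) where
  equiv : ∀ x, M.obj x ≃ₗ[ℂ] N.obj x
  comm : ∀ {x y : Q} (a : x ⟶ y) (m : M.obj x), equiv y (M.map a m) = N.map a (equiv x m)

/-- The inverse of an isomorphism. -/
def LinRep.Iso.symm {M N : LinRep Q} (θ : LinRep.Iso M N) : LinRep.Iso N M where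
  equiv x := (θ.equiv x).symm
  comm a m := by
    rw [LinearEquiv.symm_apply_eq, θ.comm, LinearEquiv.apply_symm_apply]

/-- The identity isomorphism. -/
def LinRep.Iso.refl (M : LinRep Q) : LinRep.Iso M M := ⟨fun _ => .refl ℂ _, fun _ _ => rfl⟩

/-- Isomorphic representations have isomorphic spaces of homomorphisms. -/
def LinRep.homCongr {M M' N N' : LinRep Q} (θ : LinRep.Iso M M') (η : LinRep.Iso N N') :
    LinRep.hom M N ≃ₗ[ℂ] LinRep.hom M' N' where
  toFun φ := ⟨fun x => (η.equiv x).toLinearMap ∘ₗ φ.1 x ∘ₗ (θ.equiv x).symm.toLinearMap, by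
    rw [LinRep.mem_hom]
    intro x y a m
    have h := LinRep.mem_hom.1 φ.2 a ((θ.equiv x).symm m)
    have h2 := θ.symm.comm a m
    simp only [LinRep.Iso.symm] at h2
    simp [h2, h, η.comm]⟩
  invFun φ := ⟨fun x => (η.equiv x).symm.toLinearMap ∘ₗ φ.1 x ∘ₗ (θ.equiv x).toLinearMap, by
    rw [LinRep.mem_hom]
    intro x y a m
    have h := LinRep.mem_hom.1 φ.2 a (θ.equiv x m)
    have h2 := η.symm.comm a (φ.1 x (θ.equiv x m))
    simp only [LinRep.Iso.symm] at h2
    simp [θ.comm, h, h2]⟩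
  map_add' _ _ := by ext; simp
  map_smul' _ _ := by ext; simp
  left_inv _ := by ext; simp
  right_inv _ := by ext; simp

theorem LinRep.hom_eq_bot_congr {M M' N N' : LinRep Q} (θ : LinRep.Iso M M')
    (η : LinRep.Iso N N') : LinRep.hom M N = ⊥ ↔ LinRep.hom M' N' = ⊥ := by
  rw [← Submodule.subsingleton_iff_eq_bot, ← Submodule.subsingleton_iff_eq_bot]
  exact (LinRep.homCongr θ η).toEquiv.subsingleton_congr

theorem LinRep.hom_eq_bot_iff {M N : LinRep Q} :
    LinRep.hom M N = ⊥ ↔ ∀ φ ∈ LinRep.hom M N, ∀ x m, φ x m = 0 := by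
  rw [Submodule.eq_bot_iff]
  refine forall₂_congr fun φ _ => ?_
  simp [funext_iff, LinearMap.ext_iff]

theorem LinRep.hom_eq_bot_iff_injective {M N : LinRep Q} :
    LinRep.hom M N = ⊥ ↔ Function.Injective (LinRep.d M N) := LinearMap.ker_eq_bot

/-- Surjectivity of `d`, that is, vanishing of `Ext`, passes to subrepresentations. -/
theorem LinRep.d_surjective_of_injective {K M N : LinRep Q} {ι : ∀ x, K.obj x →ₗ[ℂ] M.obj x}
    (hι : ι ∈ LinRep.hom K M) (hinj : ∀ x, Function.Injective (ι x))
    (h : Function.Surjective (LinRep.d M N)) : Function.Surjective (LinRep.d K N) := by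
  intro χ
  have h1 : ∀ x : Q, ∃ r : M.obj x →ₗ[ℂ] K.obj x, r ∘ₗ ι x = LinearMap.id := fun x =>
    LinearMap.exists_leftInverse_of_injective _ (LinearMap.ker_eq_bot.2 (hinj x))
  choose r hr using h1
  -- The retractions `r` need not form a morphism: a family indexed by arrows satisfies no
  -- condition, so extending it to `M` vertex by vertex is enough. This is where Ext² = 0 is hidden.
  obtain ⟨φ, hφ⟩ := h fun x y a => χ x y a ∘ₗ r x
  refine ⟨fun x => φ x ∘ₗ ι x, ?_⟩
  funext x y a
  ext k
  have h2 := LinearMap.congr_fun (congrFun (congrFun (congrFun hφ x) y) a) (ι x k)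
  have h3 := LinearMap.congr_fun (hr x) k
  simp only [LinRep.d, LinearMap.coe_mk, AddHom.coe_mk, LinearMap.sub_apply,
    LinearMap.comp_apply, LinearMap.id_apply] at h2 h3 ⊢
  rw [h3] at h2
  rw [← h2, LinRep.mem_hom.1 hι]

variable [Fintype Q] [DecidableEq Q] [∀ x y : Q, Finite (x ⟶ y)]

theorem LinRep.euler_dim (M N : LinRep Q) : euler (toInt M.dim) (toInt N.dim) =
    (Module.finrank ℂ (∀ x, M.obj x →ₗ[ℂ] N.obj x) : ℤ) -
      Module.finrank ℂ (∀ x y : Q, (x ⟶ y) → M.obj x →ₗ[ℂ] N.obj y) := by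
  rw [Module.finrank_pi_fintype, Module.finrank_pi_fintype]
  simp only [euler, toInt, LinRep.dim, Module.finrank_linearMap]
  push_cast
  congr 1
  refine Finset.sum_congr rfl fun x _ => ?_
  rw [Module.finrank_pi_fintype]
  push_cast
  refine Finset.sum_congr rfl fun y _ => ?_
  have := Fintype.ofFinite (x ⟶ y)
  rw [Module.finrank_pi_fintype]
  simp [Module.finrank_linearMap]

theorem LinRep.euler_nonpos {M N : LinRep Q} (h : LinRep.hom M N = ⊥) :
    euler (toInt M.dim) (toInt N.dim) ≤ 0 := by
  rw [LinRep.euler_dim, sub_nonpos]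
  exact_mod_cast LinearMap.finrank_le_finrank_of_injective
    (LinRep.hom_eq_bot_iff_injective.1 h)

theorem LinRep.euler_nonneg {M N : LinRep Q} (h : Function.Surjective (LinRep.d M N)) :
    0 ≤ euler (toInt M.dim) (toInt N.dim) := by
  rw [LinRep.euler_dim, sub_nonneg]
  exact_mod_cast LinearMap.finrank_le_finrank_of_surjective h

theorem LinRep.hom_eq_bot_iff_surjective {M N : LinRep Q}
    (h : euler (toInt M.dim) (toInt N.dim) = 0) :
    LinRep.hom M N = ⊥ ↔ Function.Surjective (LinRep.d M N) := by
  rw [LinRep.hom_eq_bot_iff_injective]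
  rw [LinRep.euler_dim, sub_eq_zero] at h
  exact LinearMap.injective_iff_surjective_of_finrank_eq_finrank (by exact_mod_cast h)

end LinRep

/-! ### Passing between matrices and abstract representations. -/

section Matrices

variable {Q : Type} [Quiver.{0} Q]

/-- A representation given by matrices. -/
@[reducible] def LinRep.ofRep {α : Q → ℕ} (V : Rep ℂ α) : LinRep Q where
  obj x := Fin (α x) → ℂ
  map a := Matrix.toLin' (V _ _ a)

theorem LinRep.dim_ofRep {α : Q → ℕ} (V : Rep ℂ α) : (LinRep.ofRep V).dim = α := by
  funext x
  exact Module.finrank_fin_fun ℂ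

theorem LinRep.exists_iso_ofRep (M : LinRep Q) :
    ∃ V : Rep ℂ M.dim, Nonempty (LinRep.Iso M (LinRep.ofRep V)) := by
  let θ : ∀ x, M.obj x ≃ₗ[ℂ] (Fin (M.dim x) → ℂ) := fun x =>
    (Module.finBasis ℂ (M.obj x)).equivFun
  refine ⟨fun x y a => LinearMap.toMatrix'
    ((θ y).toLinearMap ∘ₗ M.map a ∘ₗ (θ x).symm.toLinearMap), ⟨θ, ?_⟩⟩
  intro x y a m
  change _ = Matrix.toLin' (LinearMap.toMatrix' _) _
  rw [Matrix.toLin'_toMatrix']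
  simp

variable [Fintype Q] [DecidableEq Q] [∀ x y : Q, Finite (x ⟶ y)]

/-- Homomorphisms in terms of matrices and in terms of linear maps. -/
def homSpaceEquiv {α β : Q → ℕ} (V : Rep ℂ α) (W : Rep ℂ β) :
    homSpace V W ≃ₗ[ℂ] LinRep.hom (LinRep.ofRep V) (LinRep.ofRep W) := by
  let E : Dom α β ≃ₗ[ℂ] (∀ x, (Fin (α x) → ℂ) →ₗ[ℂ] (Fin (β x) → ℂ)) :=
    LinearEquiv.piCongrRight fun x => Matrix.toLin'
  refine E.ofSubmodules _ _ ?_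
  ext φ
  rw [Submodule.mem_map]
  constructor
  · rintro ⟨ψ, hψ, rfl⟩
    rw [LinRep.mem_hom]
    intro x y a m
    have h1 := congrFun (congrFun (congrFun (LinearMap.mem_ker.1 hψ) x) y) a
    simp only [dMap, LinearMap.coe_mk, AddHom.coe_mk, Pi.zero_apply, sub_eq_zero] at h1
    change Matrix.toLin' (ψ y) (Matrix.toLin' (V x y a) m) =
      Matrix.toLin' (W x y a) (Matrix.toLin' (ψ x) m)
    rw [← Matrix.toLin'_mul_apply, h1, Matrix.toLin'_mul_apply]
  · intro hφ
    refine ⟨E.symm φ, ?_, LinearEquiv.apply_symm_apply _ _⟩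
    refine LinearMap.mem_ker.2 ?_
    funext x y a
    simp only [dMap, LinearMap.coe_mk, AddHom.coe_mk, Pi.zero_apply, sub_eq_zero]
    apply Matrix.toLin'.injective
    refine LinearMap.ext fun m => ?_
    have h1 := LinRep.mem_hom.1 hφ a m
    rw [Matrix.toLin'_mul_apply, Matrix.toLin'_mul_apply]
    have h2 : ∀ x, Matrix.toLin' (E.symm φ x) = φ x := fun x => Matrix.toLin'_toMatrix' _
    rw [h2, h2]
    exact h1

theorem homSpace_eq_bot_iff {α β : Q → ℕ} (V : Rep ℂ α) (W : Rep ℂ β) :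
    homSpace V W = ⊥ ↔ LinRep.hom (LinRep.ofRep V) (LinRep.ofRep W) = ⊥ := by
  rw [← Submodule.subsingleton_iff_eq_bot, ← Submodule.subsingleton_iff_eq_bot]
  exact (homSpaceEquiv V W).toEquiv.subsingleton_congr

/-- Provides semi-invariants for representations without a given basis, such as kernels and images.
-/
theorem exists_represents_linRep {β : Q → ℕ} (M : LinRep Q)
    (h : euler (toInt M.dim) (toInt β) = 0) :
    ∃ (V : Rep ℂ M.dim) (f : MvPolynomial (Coord β) ℂ), Represents f V ∧
      ∀ W, evalAt f W ≠ 0 ↔ LinRep.hom M (LinRep.ofRep W) = ⊥ := by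
  obtain ⟨V, ⟨θ⟩⟩ := M.exists_iso_ofRep
  obtain ⟨f, hf⟩ := exists_represents V h
  refine ⟨V, f, hf, fun W => ?_⟩
  rw [hf.ne_zero_iff, homSpace_eq_bot_iff]
  exact LinRep.hom_eq_bot_congr θ.symm (LinRep.Iso.refl _)

end Matrices

/-! ### Real Schur roots through the Tits form. -/

section RealSchurRoot

variable {Q : Type} [Quiver.{0} Q] [Fintype Q] [DecidableEq Q] [∀ x y : Q, Finite (x ⟶ y)]

/-- Rank–nullity for d: the Euler form is dim Hom - dim Ext. -/
theorem euler_self_add_finrank_ext {α β : Q → ℕ} (V : Rep ℂ α) (W : Rep ℂ β) :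
    euler (toInt α) (toInt β) + Module.finrank ℂ (ExtSpace V W) =
      Module.finrank ℂ (homSpace V W) := by
  rw [euler_toInt]
  have h1 : Module.finrank ℂ (LinearMap.range (dMap V W)) + Module.finrank ℂ (homSpace V W) =
      Module.finrank ℂ (Dom α β) := LinearMap.finrank_range_add_finrank_ker (dMap V W)
  have h2 : Module.finrank ℂ (ExtSpace V W) + Module.finrank ℂ (LinearMap.range (dMap V W)) =
      Module.finrank ℂ (Cod α β) :=
    Submodule.finrank_quotient_add_finrank (LinearMap.range (dMap V W))
  rw [← h1, ← h2]
  push_cast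
  ring

theorem IsRealSchurRoot.euler_self {γ : Q → ℤ} (h : IsRealSchurRoot γ) : euler γ γ = 1 := by
  obtain ⟨α, V, rfl, hext, hhom⟩ := h
  have h1 := euler_self_add_finrank_ext V V
  have h2 : Module.finrank ℂ (ExtSpace V V) = 0 := Module.finrank_zero_of_subsingleton
  omega

/-- With dim End(V) = 1 and Tits form 1, no dimension is left for Ext(V,V). -/
theorem isRealSchurRoot_of_brick {α : Q → ℕ} (V : Rep ℂ α)
    (hV : Module.finrank ℂ (homSpace V V) = 1) (hq : euler (toInt α) (toInt α) = 1) :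
    IsRealSchurRoot (toInt α) := by
  refine ⟨α, V, rfl, ?_, hV⟩
  have h1 := euler_self_add_finrank_ext V V
  have h2 : Module.finrank ℂ (ExtSpace V V) = 0 := by omega
  exact Module.finrank_zero_iff.1 h2

theorem euler_self_le_of_brick {α : Q → ℕ} (V : Rep ℂ α)
    (hV : Module.finrank ℂ (homSpace V V) = 1) : euler (toInt α) (toInt α) ≤ 1 := by
  have h1 := euler_self_add_finrank_ext V V
  omega

end RealSchurRoot

/-! ### Recognising an irreducible semi-invariant from its zeros and its weight. -/

section Irreducible

variable {Q : Type} [Quiver.{0} Q] [Fintype Q] [DecidableEq Q] [∀ x y : Q, Finite (x ⟶ y)]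
  {α β ν : Q → ℕ} {f : MvPolynomial (Coord β) ℂ} {V : Rep ℂ α} {N : Rep ℂ ν}

theorem leftWeight_zero : leftWeight (0 : Q → ℤ) = 0 := by
  funext x; simp [leftWeight_apply]

theorem rightWeight_zero : rightWeight (0 : Q → ℤ) = 0 := by
  funext x; simp [rightWeight_apply]

theorem leftWeight_add (γ δ : Q → ℤ) : leftWeight (γ + δ) = leftWeight γ + leftWeight δ := by
  funext x; simp [leftWeight_apply, mul_add, Finset.sum_add_distrib]; ring

/-- Weight zero would force α = 0; then Hom(V,W) = 0 for all W, so `f` vanishes nowhere and is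
constant. -/
theorem leftWeight_ne_zero (hQ : Acyclic Q) (hf : ¬ IsUnit f)
    (h : ∀ W, evalAt f W ≠ 0 ↔ homSpace V W = ⊥) : leftWeight (toInt α) ≠ 0 := by
  intro h0
  have hα : ∀ x, α x = 0 := fun x => by
    have := congrFun (leftWeight_injective hQ (h0.trans leftWeight_zero.symm)) x
    simpa [toInt] using this
  refine hf (isUnit_of_eval_ne_zero fun z => (h (repOf z)).2 ?_)
  rw [Submodule.eq_bot_iff]
  intro φ _
  funext x
  have : IsEmpty (Fin (α x)) := by rw [hα]; infer_instance
  ext i k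
  exact this.elim k

theorem rightWeight_ne_zero (hQ : Acyclic Q) (hf : ¬ IsUnit f)
    (h : ∀ W, evalAt f W ≠ 0 ↔ homSpace W N = ⊥) : rightWeight (toInt ν) ≠ 0 := by
  intro h0
  have hν : ∀ x, ν x = 0 := fun x => by
    have := congrFun (rightWeight_injective hQ (h0.trans rightWeight_zero.symm)) x
    simpa [toInt] using this
  refine hf (isUnit_of_eval_ne_zero fun z => (h (repOf z)).2 ?_)
  rw [Submodule.eq_bot_iff]
  intro φ _
  funext x
  have : IsEmpty (Fin (ν x)) := by rw [hν]; infer_instance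
  ext i k
  exact this.elim i

/-- The weight makes ⟨α,β⟩ = 0, so some g represents V. It has the zeros and the weight of `f`,
hence is proportional to it. No determinant has to be compared. -/
theorem represents_of_ne_zero_iff (hQ : Acyclic Q) (hβ : ∀ x, β x ≠ 0) (hf : Irreducible f)
    (hσ : ScalarWeight f (leftWeight (toInt α)))
    (h : ∀ W, evalAt f W ≠ 0 ↔ homSpace V W = ⊥) : Represents f V := by
  have h0 : euler (toInt α) (toInt β) = 0 := by
    rw [euler_eq_sum_leftWeight]
    exact hσ.sum_eq_zero hf.ne_zero
  obtain ⟨g, hg⟩ := exists_represents V h0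
  obtain ⟨c, hc, rfl⟩ := eq_C_mul_of_evalAt_iff hβ hf hσ hg.isSemiInvariant.scalarWeight
    (leftWeight_ne_zero hQ hf.not_isUnit h) fun W => (hg.ne_zero_iff W).trans (h W).symm
  have h1 := hg.C_mul (inv_ne_zero hc)
  rwa [← mul_assoc, ← C_mul, inv_mul_cancel₀ hc, C_1, one_mul] at h1

theorem coRepresents_of_ne_zero_iff (hQ : Acyclic Q) (hβ : ∀ x, β x ≠ 0) (hf : Irreducible f)
    (hσ : ScalarWeight f (rightWeight (toInt ν)))
    (h : ∀ W, evalAt f W ≠ 0 ↔ homSpace W N = ⊥) : CoRepresents f N := by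
  have h0 : euler (toInt β) (toInt ν) = 0 := by
    have := hσ.sum_eq_zero hf.ne_zero
    rw [euler_eq_sum_rightWeight, neg_eq_zero, ← this]
    exact Finset.sum_congr rfl fun x _ => mul_comm _ _
  obtain ⟨g, hg⟩ := exists_coRepresents N h0
  obtain ⟨c, hc, rfl⟩ := eq_C_mul_of_evalAt_iff hβ hf hσ hg.scalarWeight
    (rightWeight_ne_zero hQ hf.not_isUnit h) fun W => (hg.ne_zero_iff W).trans (h W).symm
  have h1 := hg.C_mul (inv_ne_zero hc)
  rwa [← mul_assoc, ← C_mul, inv_mul_cancel₀ hc, C_1, one_mul] at h1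

theorem Represents.dim_eq_zero_of_isUnit (hQ : Acyclic Q) (hβ : ∀ x, β x ≠ 0)
    (h : Represents f V) (hf : IsUnit f) (x : Q) : α x = 0 := by
  obtain ⟨c, hc, rfl⟩ := isUnit_iff_exists_C.1 hf
  have h1 : ScalarWeight (C c : MvPolynomial (Coord β) ℂ) 0 := fun t W => by simp [evalAt]
  have h2 := h1.unique hβ (by simpa using hc) h.isSemiInvariant.scalarWeight
  have h3 := congrFun (leftWeight_injective hQ (h2.symm.trans leftWeight_zero.symm)) x
  simpa [toInt] using h3

end Irreducible

/-! ### Irreducible semi-invariants come from representations with only scalar endomorphisms. -/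

section Brick

variable {Q : Type} [Quiver.{0} Q]

/-- The kernel of an endomorphism. -/
@[reducible] def LinRep.ker {M : LinRep Q} {ψ : ∀ x, M.obj x →ₗ[ℂ] M.obj x} (hψ : ψ ∈ LinRep.hom M M) :
    LinRep Q where
  obj x := LinearMap.ker (ψ x)
  map {x y} a := (M.map a).restrict fun m hm => by
    rw [LinearMap.mem_ker] at hm ⊢
    rw [LinRep.mem_hom.1 hψ, hm, map_zero]

/-- The image of an endomorphism. -/
@[reducible] def LinRep.range {M : LinRep Q} {ψ : ∀ x, M.obj x →ₗ[ℂ] M.obj x} (hψ : ψ ∈ LinRep.hom M M) :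
    LinRep Q where
  obj x := LinearMap.range (ψ x)
  map {x y} a := (M.map a).restrict fun m hm => by
    obtain ⟨m, rfl⟩ := hm
    exact ⟨M.map a m, LinRep.mem_hom.1 hψ a m⟩

variable [Fintype Q] [DecidableEq Q] [∀ x y : Q, Finite (x ⟶ y)] {α β : Q → ℕ}
  {f : MvPolynomial (Coord β) ℂ} {V : Rep ℂ α}

theorem LinRep.toInt_dim_ker_add_range {M : LinRep Q} {ψ : ∀ x, M.obj x →ₗ[ℂ] M.obj x}
    (hψ : ψ ∈ LinRep.hom M M) :
    toInt (LinRep.ker hψ).dim + toInt (LinRep.range hψ).dim = toInt M.dim := by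
  funext x
  have := LinearMap.finrank_range_add_finrank_ker (ψ x)
  simp only [Pi.add_apply, toInt, LinRep.dim, LinRep.ker, LinRep.range]
  omega

/-- The image is a quotient of `M`, so a morphism out of it can be pulled back to `M`. -/
theorem LinRep.hom_range_eq_bot {M W : LinRep Q} {ψ : ∀ x, M.obj x →ₗ[ℂ] M.obj x}
    (hψ : ψ ∈ LinRep.hom M M) (h : LinRep.hom M W = ⊥) :
    LinRep.hom (LinRep.range hψ) W = ⊥ := by
  rw [LinRep.hom_eq_bot_iff] at h ⊢
  rintro φ hφ x ⟨_, m, rfl⟩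
  refine h (fun x => φ x ∘ₗ (ψ x).rangeRestrict) (LinRep.mem_hom.2 ?_) x m
  intro x y a m
  refine Eq.trans ?_ (LinRep.mem_hom.1 hφ a ((ψ x).rangeRestrict m))
  exact congrArg (φ y) (Subtype.ext (LinRep.mem_hom.1 hψ a m))

/-- A morphism vanishing on the kernel of `ψ` descends to its image: left exactness of Hom(·,W). -/
theorem LinRep.hom_eq_bot_of_ker_of_range {M W : LinRep Q} {ψ : ∀ x, M.obj x →ₗ[ℂ] M.obj x}
    (hψ : ψ ∈ LinRep.hom M M) (hK : LinRep.hom (LinRep.ker hψ) W = ⊥)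
    (hI : LinRep.hom (LinRep.range hψ) W = ⊥) : LinRep.hom M W = ⊥ := by
  rw [LinRep.hom_eq_bot_iff] at hK hI ⊢
  intro φ hφ
  have h1 : ∀ x, LinearMap.ker (ψ x) ≤ LinearMap.ker (φ x) := by
    intro x m hm
    refine hK (fun x => φ x ∘ₗ (LinearMap.ker (ψ x)).subtype) (LinRep.mem_hom.2 ?_) x ⟨m, hm⟩
    intro x y a m
    exact LinRep.mem_hom.1 hφ a m.1
  have h2 : ∀ x, ∃ χ : LinearMap.range (ψ x) →ₗ[ℂ] W.obj x, ∀ m, χ ⟨ψ x m, m, rfl⟩ = φ x m := by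
    intro x
    refine ⟨(LinearMap.ker (ψ x)).liftQ (φ x) (h1 x) ∘ₗ
      (ψ x).quotKerEquivRange.symm.toLinearMap, fun m => ?_⟩
    have : (ψ x).quotKerEquivRange.symm ⟨ψ x m, m, rfl⟩ = Submodule.Quotient.mk m := by
      rw [LinearEquiv.symm_apply_eq]; rfl
    simp [this]
  choose χ hχ using h2
  intro x m
  rw [← hχ]
  refine hI χ (LinRep.mem_hom.2 ?_) x _
  rintro x y a ⟨_, m, rfl⟩
  refine Eq.trans ?_ (((hχ y (M.map a m)).trans (LinRep.mem_hom.1 hφ a m)).trans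
    (congrArg (W.map a) (hχ x m).symm))
  exact congrArg (χ y) (Subtype.ext (LinRep.mem_hom.1 hψ a m).symm)

/-- Take W with f(W) ≠ 0. The image I of `ψ` is a quotient of V, so Hom(I,W) = 0, and a
subrepresentation, so Ext(I,W) = 0. Thus ⟨dim I,β⟩ = 0, and the same follows for the kernel K. Then
c^K c^I has the zeros and the weight of `f`, so irreducibility makes one factor constant and the
corresponding representation zero. Failure of injectivity at `x` excludes K = 0. -/
theorem Represents.endomorphism_eq_zero (hQ : Acyclic Q) (hβ : ∀ x, β x ≠ 0) (hf : Irreducible f)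
    (h : Represents f V) {ψ : ∀ x, (LinRep.ofRep V).obj x →ₗ[ℂ] (LinRep.ofRep V).obj x}
    (hψ : ψ ∈ LinRep.hom (LinRep.ofRep V) (LinRep.ofRep V)) (x : Q) (hx : ¬ Function.Injective (ψ x)) :
    ψ = 0 := by
  have h0 := LinRep.toInt_dim_ker_add_range hψ
  rw [LinRep.dim_ofRep] at h0
  have hV : ∀ W, evalAt f W ≠ 0 ↔ LinRep.hom (LinRep.ofRep V) (LinRep.ofRep W) = ⊥ := fun W =>
    (h.ne_zero_iff W).trans (homSpace_eq_bot_iff V W)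
  have hVβ : ∀ W : Rep ℂ β, euler (toInt (LinRep.ofRep V).dim) (toInt (LinRep.ofRep W).dim) = 0 := by
    intro W
    rw [LinRep.dim_ofRep, LinRep.dim_ofRep]
    exact h.euler_eq_zero
  have hIβ : euler (toInt (LinRep.range hψ).dim) (toInt β) = 0 := by
    obtain ⟨W, hW⟩ := exists_evalAt_ne_zero hf.ne_zero
    rw [hV] at hW
    have h1 := LinRep.euler_nonpos (LinRep.hom_range_eq_bot hψ hW)
    have h2 := LinRep.euler_nonneg (LinRep.d_surjective_of_injective
      (K := LinRep.range hψ) (ι := fun x => (LinearMap.range (ψ x)).subtype)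
      (LinRep.mem_hom.2 fun _ _ => rfl) (fun x => Subtype.val_injective)
      ((LinRep.hom_eq_bot_iff_surjective (hVβ W)).1 hW))
    rw [LinRep.dim_ofRep] at h1 h2
    exact le_antisymm h1 h2
  have hKβ : euler (toInt (LinRep.ker hψ).dim) (toInt β) = 0 := by
    have h1 := euler_add_left (toInt (LinRep.ker hψ).dim) (toInt (LinRep.range hψ).dim) (toInt β)
    rw [h0, h.euler_eq_zero, hIβ] at h1
    omega
  obtain ⟨VK, g, hg, hgW⟩ := exists_represents_linRep (LinRep.ker hψ) hKβ
  obtain ⟨VI, k, hk, hkW⟩ := exists_represents_linRep (LinRep.range hψ) hIβ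
  have hw : ScalarWeight (g * k) (leftWeight (toInt α)) := by
    rw [← h0, leftWeight_add]
    exact hg.isSemiInvariant.scalarWeight.mul hk.isSemiInvariant.scalarWeight
  obtain ⟨c, hc, hgk⟩ := eq_C_mul_of_evalAt_iff hβ hf h.isSemiInvariant.scalarWeight hw
    (leftWeight_ne_zero hQ hf.not_isUnit h.ne_zero_iff) (by
      intro W
      have h1 : evalAt (g * k) W = evalAt g W * evalAt k W := map_mul _ _ _
      rw [h1, mul_ne_zero_iff, hgW, hkW, hV]
      refine ⟨fun h2 => LinRep.hom_eq_bot_of_ker_of_range hψ h2.1 h2.2, fun hW =>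
        ⟨?_, LinRep.hom_range_eq_bot hψ hW⟩⟩
      rw [LinRep.hom_eq_bot_iff_surjective (by rw [LinRep.dim_ofRep]; exact hKβ)]
      exact LinRep.d_surjective_of_injective
        (K := LinRep.ker hψ) (ι := fun x => (LinearMap.ker (ψ x)).subtype)
        (LinRep.mem_hom.2 fun _ _ => rfl) (fun x => Subtype.val_injective)
        ((LinRep.hom_eq_bot_iff_surjective (hVβ W)).1 hW))
  have hirr : Irreducible (g * k) := by
    rw [hgk]
    exact (irreducible_isUnit_mul (isUnit_iff_exists_C.2 ⟨c, hc, rfl⟩)).2 hf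
  rcases hirr.isUnit_or_isUnit rfl with hu | hu
  · have h1 := hg.dim_eq_zero_of_isUnit hQ hβ hu x
    exact absurd (LinearMap.ker_eq_bot.1 (Submodule.finrank_eq_zero.1 h1)) hx
  · funext y
    have h1 := hk.dim_eq_zero_of_isUnit hQ hβ hu y
    exact LinearMap.range_eq_bot.1 (Submodule.finrank_eq_zero.1 h1)

/-- An irreducible semi-invariant `c^V` comes from a representation `V` with `End(V) = ℂ`. -/
theorem Represents.finrank_end (hQ : Acyclic Q) (hβ : ∀ x, β x ≠ 0) (hf : Irreducible f)
    (h : Represents f V) : Module.finrank ℂ (homSpace V V) = 1 := by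
  rw [(homSpaceEquiv V V).finrank_eq]
  have hne : ∃ x, α x ≠ 0 := by
    by_contra! h0
    refine leftWeight_ne_zero hQ hf.not_isUnit h.ne_zero_iff ?_
    rw [show toInt α = 0 from funext fun x => by simp [toInt, h0], leftWeight_zero]
  obtain ⟨x, hx⟩ := hne
  have : NeZero (α x) := ⟨hx⟩
  let one : LinRep.hom (LinRep.ofRep V) (LinRep.ofRep V) :=
    ⟨fun x => LinearMap.id, LinRep.mem_hom.2 fun _ _ => rfl⟩
  refine finrank_eq_one_iff_of_nonzero' one ?_ |>.2 ?_
  · intro h0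
    have h1 := LinearMap.congr_fun (congrFun (congrArg Subtype.val h0) x) (Pi.single 0 1)
    have h2 : (Pi.single 0 1 : Fin (α x) → ℂ) 0 = 0 := congrFun h1 0
    simp at h2
  · rintro ⟨φ, hφ⟩
    have : Nontrivial ((LinRep.ofRep V).obj x) :=
      inferInstanceAs (Nontrivial (Fin (α x) → ℂ))
    -- An eigenvalue at a single vertex suffices: φ - c is not injective there, hence vanishes at
    -- every vertex.
    obtain ⟨c, hc⟩ := Module.End.exists_eigenvalue (φ x)
    obtain ⟨v, hv⟩ := hc.exists_hasEigenvector
    refine ⟨c, Subtype.ext ?_⟩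
    have hψ := (LinRep.hom (LinRep.ofRep V) (LinRep.ofRep V)).sub_mem hφ
      ((LinRep.hom (LinRep.ofRep V) (LinRep.ofRep V)).smul_mem c one.2)
    have h1 := h.endomorphism_eq_zero hQ hβ hf hψ x (by
      intro hinj
      refine hv.2 (hinj ?_)
      rw [map_zero]
      have := hv.apply_eq_smul
      simp [one, this])
    exact (sub_eq_zero.1 h1).symm

end Brick

end QuiverSlice

namespace QuiverSlice

/-! ### The dual of Ext through the trace pairing. -/

section TraceDuality

variable {Q : Type} [Quiver.{0} Q] [Fintype Q] [DecidableEq Q] [∀ x y : Q, Finite (x ⟶ y)]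

/-- A choice of enumeration of the arrows. -/
@[reducible] def homFintype (x y : Q) : Fintype (x ⟶ y) := Fintype.ofFinite _

attribute [local instance] homFintype

/-- The transpose of `d`, whose kernel is dual to `Ext(M, W)`. -/
def LinRep.dT (M W : LinRep Q) : (∀ x y : Q, (x ⟶ y) → W.obj y →ₗ[ℂ] M.obj x) →ₗ[ℂ]
    (∀ x, W.obj x →ₗ[ℂ] M.obj x) where
  toFun ψ x := ∑ y, ∑ b : x ⟶ y, ψ x y b ∘ₗ W.map b - ∑ z, ∑ b : z ⟶ x, M.map b ∘ₗ ψ z x b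
  map_add' φ ψ := by
    funext x
    simp only [Pi.add_apply, LinearMap.add_comp, LinearMap.comp_add, Finset.sum_add_distrib]
    abel
  map_smul' c φ := by
    funext x
    simp [smul_sub, LinearMap.smul_comp, LinearMap.comp_smul, Finset.smul_sum]

theorem LinRep.mem_ker_dT {M W : LinRep Q} {ψ : ∀ x y : Q, (x ⟶ y) → W.obj y →ₗ[ℂ] M.obj x} :
    ψ ∈ LinearMap.ker (LinRep.dT M W) ↔ ∀ x w, ∑ y, ∑ b : x ⟶ y, ψ x y b (W.map b w) =
      ∑ z, ∑ b : z ⟶ x, M.map b (ψ z x b w) := by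
  simp only [LinearMap.mem_ker, dT, LinearMap.coe_mk, AddHom.coe_mk, funext_iff,
    Pi.zero_apply, sub_eq_zero, LinearMap.ext_iff, LinearMap.comp_apply, LinearMap.sum_apply]

/-- Rank-one maps v = ξ(·)a turn the trace into ξ(u(a)). -/
theorem eq_zero_of_trace_comp_eq_zero {A B : Type} [AddCommGroup A] [Module ℂ A]
    [FiniteDimensional ℂ A] [AddCommGroup B] [Module ℂ B] [FiniteDimensional ℂ B]
    {u : A →ₗ[ℂ] B} (h : ∀ v : B →ₗ[ℂ] A, LinearMap.trace ℂ B (u ∘ₗ v) = 0) : u = 0 := by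
  ext a
  rw [LinearMap.zero_apply, ← Module.forall_dual_apply_eq_zero_iff ℂ]
  intro ξ
  have h1 := h (ξ.smulRight a)
  have h2 : u ∘ₗ ξ.smulRight a = ξ.smulRight (u a) := by ext; simp
  rwa [h2, LinearMap.trace_smulRight] at h1

theorem sum_comp_linearMap {ι A B D : Type} [AddCommGroup A] [Module ℂ A] [AddCommGroup B]
    [Module ℂ B] [AddCommGroup D] [Module ℂ D] (s : Finset ι) (u : ι → B →ₗ[ℂ] D)
    (v : A →ₗ[ℂ] B) : (∑ i ∈ s, u i) ∘ₗ v = ∑ i ∈ s, u i ∘ₗ v := by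
  ext a; simp [LinearMap.sum_apply]

/-- The trace pairing on the sources. -/
def LinRep.pairDom (M W : LinRep Q) : (∀ x, W.obj x →ₗ[ℂ] M.obj x) →ₗ[ℂ]
    Module.Dual ℂ (∀ x, M.obj x →ₗ[ℂ] W.obj x) :=
  LinearMap.mk₂ ℂ (fun u φ => ∑ x, LinearMap.trace ℂ _ (u x ∘ₗ φ x))
    (by intros; simp [LinearMap.add_comp, Finset.sum_add_distrib])
    (by intros; simp [LinearMap.smul_comp, Finset.mul_sum])
    (by intros; simp [LinearMap.comp_add, Finset.sum_add_distrib])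
    (by intros; simp [LinearMap.comp_smul, Finset.mul_sum])

/-- The trace pairing on the targets. -/
def LinRep.pairCod (M W : LinRep Q) : (∀ x y : Q, (x ⟶ y) → W.obj y →ₗ[ℂ] M.obj x) →ₗ[ℂ]
    Module.Dual ℂ (∀ x y : Q, (x ⟶ y) → M.obj x →ₗ[ℂ] W.obj y) :=
  LinearMap.mk₂ ℂ (fun u φ => ∑ x, ∑ y, ∑ b : x ⟶ y, LinearMap.trace ℂ _ (u x y b ∘ₗ φ x y b))
    (by intros; simp [LinearMap.add_comp, Finset.sum_add_distrib])
    (by intros; simp [LinearMap.smul_comp, Finset.mul_sum])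
    (by intros; simp [LinearMap.comp_add, Finset.sum_add_distrib])
    (by intros; simp [LinearMap.comp_smul, Finset.mul_sum])

theorem LinRep.pairDom_injective (M W : LinRep Q) : Function.Injective (LinRep.pairDom M W) := by
  rw [injective_iff_map_eq_zero]
  intro u hu
  funext x
  refine eq_zero_of_trace_comp_eq_zero fun v => ?_
  have h1 := LinearMap.congr_fun hu (Pi.single x v)
  simp only [pairDom, LinearMap.mk₂_apply, LinearMap.zero_apply] at h1
  rw [Finset.sum_eq_single x] at h1
  · simpa using h1
  · intro y _ hy
    simp [hy]
  · simp

theorem LinRep.pairCod_injective (M W : LinRep Q) : Function.Injective (LinRep.pairCod M W) := by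
  classical
  rw [injective_iff_map_eq_zero]
  intro u hu
  funext x y b
  refine eq_zero_of_trace_comp_eq_zero fun v => ?_
  have h1 := LinearMap.congr_fun hu (Pi.single x (Pi.single y (Pi.single b v)))
  simp only [pairCod, LinearMap.mk₂_apply, LinearMap.zero_apply] at h1
  rw [Finset.sum_eq_single x, Finset.sum_eq_single y, Finset.sum_eq_single b] at h1
  · simpa using h1
  · intro y _ hy
    simp [hy]
  · simp
  · intro y _ hy
    simp [hy]
  · simp
  · intro y _ hy
    simp [hy]
  · simp

/-- Cyclicity of the trace makes `dT` the negative adjoint of `d`. -/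
theorem LinRep.pairCod_d (M W : LinRep Q)
    (ψ : ∀ x y : Q, (x ⟶ y) → W.obj y →ₗ[ℂ] M.obj x) (φ : ∀ x, M.obj x →ₗ[ℂ] W.obj x) :
    LinRep.pairCod M W ψ (LinRep.d M W φ) = -LinRep.pairDom M W (LinRep.dT M W ψ) φ := by
  simp only [pairCod, pairDom, d, dT, LinearMap.mk₂_apply, LinearMap.coe_mk, AddHom.coe_mk,
    LinearMap.comp_sub, LinearMap.sub_comp, map_sub, Finset.sum_sub_distrib, neg_sub,
    sum_comp_linearMap, map_sum]
  congr 1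
  · rw [Finset.sum_comm]
    refine Finset.sum_congr rfl fun x _ => Finset.sum_congr rfl fun y _ =>
      Finset.sum_congr rfl fun b _ => ?_
    rw [← LinearMap.comp_assoc, LinearMap.trace_comp_comm', LinearMap.comp_assoc]

/-- The trace pairing identifies the kernel of `dT` with the dual of the cokernel of `d`, so its
dimension is dim Ext(M,W). -/
theorem LinRep.finrank_ker_dT (M W : LinRep Q) :
    (Module.finrank ℂ (LinearMap.ker (LinRep.dT M W)) : ℤ) + euler (toInt M.dim) (toInt W.dim) =
      Module.finrank ℂ (LinRep.hom M W) := by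
  have hfr : Module.finrank ℂ (∀ x y : Q, (x ⟶ y) → W.obj y →ₗ[ℂ] M.obj x) =
      Module.finrank ℂ (∀ x y : Q, (x ⟶ y) → M.obj x →ₗ[ℂ] W.obj y) := by
    simp only [Module.finrank_pi_fintype, Module.finrank_linearMap, mul_comm]
  let E := LinearEquiv.ofInjectiveOfFinrankEq (LinRep.pairCod M W) (LinRep.pairCod_injective M W)
    (hfr.trans Subspace.dual_finrank_eq.symm)
  have hE : ∀ ψ, E ψ = LinRep.pairCod M W ψ := fun ψ => rfl
  have hker : LinearMap.ker (LinRep.dT M W) =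
      (LinearMap.ker (LinRep.d M W).dualMap).comap E.toLinearMap := by
    ext ψ
    rw [Submodule.mem_comap, LinearMap.mem_ker, LinearMap.mem_ker, LinearEquiv.coe_coe, hE]
    constructor
    · intro h
      refine LinearMap.ext fun φ => ?_
      rw [LinearMap.dualMap_apply, LinRep.pairCod_d, h]
      simp
    · intro h
      apply LinRep.pairDom_injective
      refine LinearMap.ext fun φ => ?_
      have h1 := LinearMap.congr_fun h φ
      rw [LinearMap.dualMap_apply, LinRep.pairCod_d, LinearMap.zero_apply, neg_eq_zero] at h1
      rw [h1, map_zero, LinearMap.zero_apply]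
  have h1 : Module.finrank ℂ (LinearMap.ker (LinRep.dT M W)) =
      Module.finrank ℂ (LinearMap.ker (LinRep.d M W).dualMap) := by
    rw [hker]
    exact (E.ofSubmodule' _).finrank_eq
  have h2 := LinearMap.finrank_range_add_finrank_ker (LinRep.d M W).dualMap
  have h3 := LinearMap.finrank_range_add_finrank_ker (LinRep.d M W)
  rw [LinearMap.finrank_range_dualMap_eq_finrank_range, Subspace.dual_finrank_eq] at h2
  have h4 : Module.finrank ℂ (LinRep.hom M W) =
    Module.finrank ℂ (LinearMap.ker (LinRep.d M W)) := rfl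
  rw [LinRep.euler_dim, h1, h4]
  omega

end TraceDuality

/-! ### The Auslander–Reiten translate and its universal property. -/

section Translate

variable {Q : Type} [Quiver.{0} Q] [Fintype Q] [DecidableEq Q] [∀ x y : Q, Finite (x ⟶ y)]

attribute [local instance] homFintype

/-- The action of a path on a representation. -/
def LinRep.pathMap (W : LinRep Q) {x : Q} : ∀ {y : Q}, Quiver.Path x y → W.obj x →ₗ[ℂ] W.obj y
  | _, .nil => LinearMap.id
  | _, .cons p a => W.map a ∘ₗ LinRep.pathMap W p

/-- The indecomposable projective representation at a vertex. -/
@[reducible] def projRep (hQ : Acyclic Q) (x : Q) : LinRep Q where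
  obj y := Quiver.Path x y →₀ ℂ
  finiteDimensional y := by
    have := hQ.finite_path x y
    infer_instance
  map a := Finsupp.lmapDomain ℂ ℂ fun p => p.cons a

theorem dim_projRep (hQ : Acyclic Q) (x : Q) : toInt (projRep hQ x).dim = pathCount x := by
  funext y
  have := hQ.finite_path x y
  have := Fintype.ofFinite (Quiver.Path x y)
  simp only [toInt, LinRep.dim, pathCount]
  rw [Module.finrank_finsupp_self, Nat.card_eq_fintype_card]

/-- Membership is linear in the projective, so it can be tested on its basis of paths. -/
theorem mem_ker_dT_projRep (hQ : Acyclic Q) {M : LinRep Q} {x : Q}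
    {u : ∀ y z : Q, (y ⟶ z) → (Quiver.Path x z →₀ ℂ) →ₗ[ℂ] M.obj y} :
    u ∈ LinearMap.ker (LinRep.dT M (projRep hQ x)) ↔ ∀ (y : Q) (p : Quiver.Path x y),
      ∑ z, ∑ b : y ⟶ z, u y z b (Finsupp.single (p.cons b) 1) =
        ∑ z, ∑ b : z ⟶ y, M.map b (u z y b (Finsupp.single p 1)) := by
  rw [LinRep.mem_ker_dT]
  constructor
  · intro h y p
    rw [← h y (Finsupp.single p 1)]
    simp
  · intro h y w
    induction w using Finsupp.induction_linear with
    | zero => simp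
    | add v w hv hw =>
      simp only [map_add, Finset.sum_add_distrib] at hv hw ⊢
      rw [hv, hw]
    | single p c =>
      have h1 : Finsupp.single p c = c • Finsupp.single p (1 : ℂ) := by simp
      rw [h1]
      simp only [map_smul, ← Finset.smul_sum]
      rw [← h y p]
      simp

/-- The Auslander–Reiten translate of a representation. -/
@[reducible] def translate (hQ : Acyclic Q) (M : LinRep Q) : LinRep Q where
  obj x := LinearMap.ker (LinRep.dT M (projRep hQ x))
  finiteDimensional x := by
    have := hQ.finite_path
    infer_instance
  map {x x'} c := LinearMap.restrict
    { toFun := fun u y z b => u y z b ∘ₗ Finsupp.lmapDomain ℂ ℂ fun q => c.toPath.comp q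
      map_add' := fun _ _ => rfl
      map_smul' := fun _ _ => rfl } (by
      intro u hu
      rw [mem_ker_dT_projRep] at hu ⊢
      intro y p
      simpa using hu y (c.toPath.comp p))

/-- An arrow from `x` to `x'` acts through the map between projectives that prefixes paths by it. At
each vertex the translate is the dual of Ext(M, P_x). -/
theorem translate_map_apply (hQ : Acyclic Q) (M : LinRep Q) {x x' : Q} (c : x ⟶ x')
    (u : (translate hQ M).obj x) {y z : Q} (b : y ⟶ z) (q : Quiver.Path x' z) :
    ((translate hQ M).map c u).1 y z b (Finsupp.single q 1) =
      u.1 y z b (Finsupp.single (c.toPath.comp q) 1) := by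
  change u.1 y z b (Finsupp.lmapDomain ℂ ℂ (fun q => c.toPath.comp q) (Finsupp.single q 1)) = _
  simp

theorem translate_pathMap_apply (hQ : Acyclic Q) (M : LinRep Q) {x x' : Q}
    (p : Quiver.Path x x') (u : (translate hQ M).obj x) {y z : Q} (b : y ⟶ z)
    (q : Quiver.Path x' z) :
    ((translate hQ M).pathMap p u).1 y z b (Finsupp.single q 1) =
      u.1 y z b (Finsupp.single (p.comp q) 1) := by
  induction p with
  | nil => simp [LinRep.pathMap]
  | cons p c ih =>
    have h1 := translate_map_apply hQ M c ((translate hQ M).pathMap p u) b q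
    refine h1.trans ?_
    rw [ih, ← Quiver.Path.comp_assoc]
    rfl

theorem LinRep.hom_pathMap {M N : LinRep Q} {φ : ∀ x, M.obj x →ₗ[ℂ] N.obj x}
    (hφ : φ ∈ LinRep.hom M N) {x y : Q} (p : Quiver.Path x y) (m : M.obj x) :
    φ y (M.pathMap p m) = N.pathMap p (φ x m) := by
  induction p with
  | nil => rfl
  | cons p a ih =>
    simp only [LinRep.pathMap, LinearMap.comp_apply]
    rw [LinRep.mem_hom.1 hφ, ih]

/-- Evaluation of the components of the translate at trivial paths. -/
def evalNil (hQ : Acyclic Q) (M W : LinRep Q) : LinRep.hom W (translate hQ M) →ₗ[ℂ]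
    (∀ x y : Q, (x ⟶ y) → W.obj y →ₗ[ℂ] M.obj x) where
  toFun φ x y b :=
    { toFun := fun w => (φ.1 y w).1 x y b (Finsupp.single .nil 1)
      map_add' := by intro v w; rw [map_add]; rfl
      map_smul' := by intro v w; rw [map_smul]; rfl }
  map_add' _ _ := rfl
  map_smul' _ _ := rfl

/-- A Yoneda argument: a morphism commutes with path maps, so its component at a path `p` is its
component at the trivial path evaluated on the transport of `w` along `p`. -/
theorem evalNil_injective (hQ : Acyclic Q) (M W : LinRep Q) :
    Function.Injective (evalNil hQ M W) := by
  rw [injective_iff_map_eq_zero]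
  rintro ⟨φ, hφ⟩ h
  refine Subtype.ext ?_
  funext x
  refine LinearMap.ext fun w => Subtype.ext ?_
  funext y z b
  refine Finsupp.lhom_ext' fun p => LinearMap.ext_ring ?_
  change (φ x w).1 y z b (Finsupp.single p 1) = 0
  have h1 := translate_pathMap_apply hQ M p (φ x w) b .nil
  rw [Quiver.Path.comp_nil] at h1
  rw [← h1, ← LinRep.hom_pathMap hφ]
  exact LinearMap.congr_fun (congrFun (congrFun (congrFun h y) z) b) (W.pathMap p w)

/-- With injectivity this is the Auslander–Reiten formula: Hom(W,τM) is the kernel of `dT`, the dual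
of Ext(M,W). An element ψ of that kernel comes from the morphism sending w to the family p ↦ ψ_b(W_p
w). -/
theorem range_evalNil (hQ : Acyclic Q) (M W : LinRep Q) :
    LinearMap.range (evalNil hQ M W) = LinearMap.ker (LinRep.dT M W) := by
  apply le_antisymm
  · rintro _ ⟨⟨φ, hφ⟩, rfl⟩
    rw [LinRep.mem_ker_dT]
    intro x w
    have h1 := (mem_ker_dT_projRep hQ).1 (φ x w).2 x .nil
    refine Eq.trans ?_ h1
    refine Finset.sum_congr rfl fun y _ => Finset.sum_congr rfl fun b _ => ?_
    change (φ y (W.map b w)).1 x y b (Finsupp.single .nil 1) = _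
    have h2 := translate_map_apply hQ M b (φ x w) b .nil
    rw [← LinRep.mem_hom.1 hφ] at h2
    exact h2
  · intro ψ hψ
    rw [LinRep.mem_ker_dT] at hψ
    let lc : ∀ x z : Q, W.obj x →ₗ[ℂ] ((Quiver.Path x z →₀ ℂ) →ₗ[ℂ] W.obj z) := fun x z =>
      { toFun := fun w => Finsupp.linearCombination ℂ fun p => W.pathMap p w
        map_add' := by intro v w; ext p; simp
        map_smul' := by intro c w; ext p; simp }
    have hlc : ∀ (x z : Q) (w : W.obj x) (p : Quiver.Path x z),
        lc x z w (Finsupp.single p 1) = W.pathMap p w := by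
      intro x z w p
      simp [lc]
    let φ : ∀ x, W.obj x →ₗ[ℂ] (translate hQ M).obj x := fun x =>
      LinearMap.codRestrict _
        { toFun := fun w y z b => ψ y z b ∘ₗ lc x z w
          map_add' := by intro v w; funext y z b; rw [map_add, LinearMap.comp_add]; rfl
          map_smul' := by
            intro c w
            funext y z b
            change ψ y z b ∘ₗ lc x z (c • w) = c • (ψ y z b ∘ₗ lc x z w)
            rw [map_smul, LinearMap.comp_smul] }
        (by
          intro w
          rw [mem_ker_dT_projRep]
          intro y p
          simp only [LinearMap.coe_mk, AddHom.coe_mk, LinearMap.comp_apply, hlc]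
          exact hψ y (W.pathMap p w))
    have hφ : ∀ (x y z : Q) (b : y ⟶ z) (w : W.obj x) (p : Quiver.Path x z),
        (φ x w).1 y z b (Finsupp.single p 1) = ψ y z b (W.pathMap p w) := by
      intro x y z b w p
      rw [← hlc]
      rfl
    have hcomp : ∀ {x y z : Q} (a : x ⟶ y) (p : Quiver.Path y z) (w : W.obj x),
        W.pathMap p (W.map a w) = W.pathMap (a.toPath.comp p) w := by
      intro x y z a p w
      induction p with
      | nil => rfl
      | cons p c ih =>
        simp only [LinRep.pathMap, LinearMap.comp_apply, Quiver.Path.comp_cons]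
        rw [ih]
    refine ⟨⟨φ, LinRep.mem_hom.2 ?_⟩, ?_⟩
    · intro x y a w
      refine Subtype.ext ?_
      funext u v b
      refine Finsupp.lhom_ext' fun p => LinearMap.ext_ring ?_
      change (φ y (W.map a w)).1 u v b (Finsupp.single p 1) =
        ((translate hQ M).map a (φ x w)).1 u v b (Finsupp.single p 1)
      rw [translate_map_apply, hφ, hφ, hcomp]
    · funext x y b
      refine LinearMap.ext fun w => ?_
      exact hφ y x y b w .nil

theorem finrank_hom_translate (hQ : Acyclic Q) (M W : LinRep Q) :
    (Module.finrank ℂ (LinRep.hom W (translate hQ M)) : ℤ) + euler (toInt M.dim) (toInt W.dim) =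
      Module.finrank ℂ (LinRep.hom M W) := by
  rw [← LinRep.finrank_ker_dT M W, ← range_evalNil hQ,
    LinearMap.finrank_range_of_inj (evalNil_injective hQ M W)]

/-- Once Hom(M,P_x) = 0, the dimension of Ext(M,P_x) is minus an Euler number. -/
theorem dim_translate (hQ : Acyclic Q) (M : LinRep Q) (x : Q)
    (h : LinRep.hom M (projRep hQ x) = ⊥) :
    toInt (translate hQ M).dim x = -euler (toInt M.dim) (pathCount x) := by
  have h1 := LinRep.finrank_ker_dT M (projRep hQ x)
  rw [h, finrank_bot, dim_projRep] at h1
  simp only [toInt, LinRep.dim] at h1 ⊢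
  push_cast at h1
  linarith

/-- The path-counting matrix is unitriangular for an ordering compatible with the arrows. -/
theorem eq_of_sum_pathCount_mul_eq (hQ : Acyclic Q) {c d : Q → ℤ}
    (h : ∀ x, ∑ y, pathCount x y * c y = ∑ y, pathCount x y * d y) : c = d := by
  have hpath : ∀ {x y : Q} (p : Quiver.Path x y), x = y ∨
      Relation.TransGen (fun u v : Q => Nonempty (v ⟶ u)) y x := by
    intro x y p
    induction p with
    | nil => exact Or.inl rfl
    | cons p a ih =>
      rcases ih with rfl | ih
      · exact Or.inr (.single ⟨a⟩)
      · exact Or.inr (.head ⟨a⟩ ih)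
  funext x
  induction x using hQ.wellFounded_swap.transGen.induction with
  | _ x ih =>
    have h1 := h x
    rw [← Finset.add_sum_erase _ _ (Finset.mem_univ x),
      ← Finset.add_sum_erase _ _ (Finset.mem_univ x), pathCount_self hQ] at h1
    have h2 : ∑ y ∈ Finset.univ.erase x, pathCount x y * c y =
        ∑ y ∈ Finset.univ.erase x, pathCount x y * d y := by
      refine Finset.sum_congr rfl fun y hy => ?_
      by_cases hp : Nonempty (Quiver.Path x y)
      · obtain ⟨p⟩ := hp
        rcases hpath p with rfl | hp
        · simp at hy
        · rw [ih y hp]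
      · have := not_nonempty_iff.1 hp
        simp [pathCount]
    omega

/-- A representation without non-zero maps to some representation with full support has no
non-zero maps to projectives. -/
theorem hom_projRep_eq_bot (hQ : Acyclic Q) {M W : LinRep Q} (hW : ∀ x, Nontrivial (W.obj x))
    (h : LinRep.hom M W = ⊥) (x : Q) : LinRep.hom M (projRep hQ x) = ⊥ := by
  rw [LinRep.hom_eq_bot_iff] at h ⊢
  intro φ hφ
  suffices hp : ∀ {y : Q} (p : Quiver.Path x y) (m : M.obj y), φ y m p = 0 from
    fun y m => Finsupp.ext fun p => hp p m
  have hcons : ∀ {y z w : Q} (a : y ⟶ w) (m : M.obj y) (q : Quiver.Path x z) (b : z ⟶ w),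
      (¬ ∃ h : z = y, h ▸ b = a) → φ w (M.map a m) (q.cons b) = 0 := by
    intro y z w a m q b hne
    rw [LinRep.mem_hom.1 hφ]
    refine Finsupp.mapDomain_of_notMem_range _ _ ?_
    rintro ⟨p, hp⟩
    simp only [Quiver.Path.cons.injEq] at hp
    obtain ⟨rfl, hp1, hp2⟩ := hp
    exact hne ⟨rfl, (eq_of_heq hp2).symm⟩
  have hcons' : ∀ {y w : Q} (a : y ⟶ w) (m : M.obj y) (q : Quiver.Path x y),
      φ w (M.map a m) (q.cons a) = φ y m q := by
    intro y w a m q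
    rw [LinRep.mem_hom.1 hφ]
    refine Finsupp.mapDomain_apply (fun p p' hpp => ?_) _ _
    simpa using hpp
  have hnil : ∀ {y : Q} (a : y ⟶ x) (m : M.obj y), φ x (M.map a m) .nil = 0 := by
    intro y a m
    rw [LinRep.mem_hom.1 hφ]
    refine Finsupp.mapDomain_of_notMem_range _ _ ?_
    rintro ⟨p, hp⟩
    exact Quiver.Path.cons_ne_nil _ _ hp
  -- If the coefficient of `p` kills the images of all arrows into y, then for w in W(y) the maps m
  -- ↦ Σ_q φ(m)_{pq} W_q w form a morphism from M to W. It vanishes by hypothesis; at y only q = nil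
  -- occurs, so φ(m)_p w = 0, and w ≠ 0.
  have key : ∀ {y : Q} (p : Quiver.Path x y),
      (∀ {z : Q} (a : z ⟶ y) (m : M.obj z), φ y (M.map a m) p = 0) →
      ∀ m : M.obj y, φ y m p = 0 := by
    intro y p hp m
    have hfin := hQ.finite_path y
    let _ : ∀ z, Fintype (Quiver.Path y z) := fun z => Fintype.ofFinite _
    have := hW y
    obtain ⟨w, hw⟩ := exists_ne (0 : W.obj y)
    let θ : ∀ z, M.obj z →ₗ[ℂ] W.obj z := fun z =>
      ∑ q : Quiver.Path y z,
        ((Finsupp.lapply (p.comp q) : (Quiver.Path x z →₀ ℂ) →ₗ[ℂ] ℂ) ∘ₗ φ z).smulRight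
          (W.pathMap q w)
    have hθ : ∀ z m, θ z m = ∑ q : Quiver.Path y z, φ z m (p.comp q) • W.pathMap q w := by
      intro z m
      simp [θ]
    have hmem : θ ∈ LinRep.hom M W := by
      rw [LinRep.mem_hom]
      intro z z' a m
      rw [hθ, hθ, map_sum]
      have hinj : Function.Injective fun q : Quiver.Path y z => q.cons a := by
        intro q q' hqq
        simpa using hqq
      rw [← Finset.sum_subset (Finset.subset_univ (Finset.univ.map ⟨_, hinj⟩)),
        Finset.sum_map]
      · refine Finset.sum_congr rfl fun q _ => ?_
        rw [map_smul]
        congr 1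
        exact hcons' a m (p.comp q)
      · intro q _ hq
        cases q with
        | nil => rw [Quiver.Path.comp_nil, hp, zero_smul]
        | cons q b =>
          rw [Quiver.Path.comp_cons, hcons a m _ b, zero_smul]
          rintro ⟨rfl, rfl⟩
          exact hq (by simp)
    have h1 := h θ hmem y m
    rw [hθ, Finset.sum_eq_single .nil] at h1
    · rw [smul_eq_zero] at h1
      exact h1.resolve_right hw
    · intro q _ hq
      exact absurd (hQ.path_eq_nil q) hq
    · simp
  -- Along an arrow, the coefficient of a path either vanishes or equals the coefficient of the path
  -- shortened by that arrow, so induction on the path supplies the hypothesis of `key`.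
  intro y p
  induction p with
  | nil => exact key _ fun a m => hnil a m
  | cons p b ih =>
    refine key _ fun {z} a m => ?_
    by_cases hb : ∃ h : _ = z, h ▸ b = a
    · obtain ⟨rfl, rfl⟩ := hb
      rw [hcons', ih]
    · exact hcons a m p b hb

end Translate

/-! ### The translate in matrix form. -/

section Duality

variable {Q : Type} [Quiver.{0} Q] [Fintype Q] [DecidableEq Q] [∀ x y : Q, Finite (x ⟶ y)]
  {α β ν : Q → ℕ}

/-- The Auslander–Reiten translate of a representation `V`, and its dimension vector. -/
theorem exists_translate (hQ : Acyclic Q) (hβ : ∀ x, β x ≠ 0) (V : Rep ℂ α) (W₀ : Rep ℂ β)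
    (h : homSpace V W₀ = ⊥) : ∃ (ν : Q → ℕ) (N : Rep ℂ ν),
      (∀ η, euler (toInt α) η = -euler η (toInt ν)) ∧
      ∀ (δ : Q → ℕ) (W : Rep ℂ δ), (Module.finrank ℂ (homSpace W N) : ℤ) +
        euler (toInt α) (toInt δ) = Module.finrank ℂ (homSpace V W) := by
  let M := LinRep.ofRep V
  have hM : M.dim = α := LinRep.dim_ofRep V
  obtain ⟨N, ⟨θ⟩⟩ := (translate hQ M).exists_iso_ofRep
  refine ⟨_, N, ?_, ?_⟩
  · rw [← leftWeight_eq_rightWeight_iff]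
    -- Both weights are compared by pairing them with the dimension vectors of the projectives,
    -- where the dimension of the translate is known.
    refine eq_of_sum_pathCount_mul_eq hQ fun x => ?_
    have h1 := dim_translate hQ M x (hom_projRep_eq_bot hQ (fun x => by
      have : NeZero (β x) := ⟨hβ x⟩
      exact inferInstanceAs (Nontrivial (Fin (β x) → ℂ))) ((homSpace_eq_bot_iff V W₀).1 h) x)
    have h2 := euler_pathCount hQ x (toInt (translate hQ M).dim)
    rw [h1, euler_eq_sum_rightWeight, neg_inj, euler_eq_sum_leftWeight, hM] at h2
    rw [h2]
    exact Finset.sum_congr rfl fun y _ => mul_comm _ _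
  · intro δ W
    have h1 := finrank_hom_translate hQ M (LinRep.ofRep W)
    simp only [M, LinRep.dim_ofRep] at h1
    rw [(homSpaceEquiv V W).finrank_eq, (homSpaceEquiv W N).finrank_eq, ← h1,
      (LinRep.homCongr (LinRep.Iso.refl (LinRep.ofRep W)) θ).finrank_eq]

end Duality

end QuiverSlice

namespace QuiverSlice

/-! ### The inverse translate through the opposite quiver. -/

section Opposite

open Opposite

variable {Q : Type} [Quiver.{0} Q] [Fintype Q] [DecidableEq Q] [∀ x y : Q, Finite (x ⟶ y)]
  {α β ν : Q → ℕ}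

instance fintypeOpposite : Fintype Qᵒᵖ := Fintype.ofEquiv Q equivToOpposite

instance decidableEqOpposite : DecidableEq Qᵒᵖ := Classical.decEq _

instance finiteHomOpposite (x y : Qᵒᵖ) : Finite (x ⟶ y) :=
  Finite.of_injective (fun a : x ⟶ y => a.unop) fun _ _ h => Quiver.Hom.unop_inj h

theorem Acyclic.op (hQ : Acyclic Q) : Acyclic Qᵒᵖ := by
  have h : ∀ {x y : Qᵒᵖ} (p : Quiver.Path x y),
      ∃ q : Quiver.Path y.unop x.unop, q.length = p.length := by
    intro x y p
    induction p with
    | nil => exact ⟨.nil, rfl⟩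
    | cons p a ih =>
      obtain ⟨q, hq⟩ := ih
      refine ⟨(Quiver.Hom.unop a).toPath.comp q, ?_⟩
      simp [hq, add_comm]
  intro x p
  obtain ⟨q, hq⟩ := h p
  rw [← hq]
  exact hQ _ q

theorem euler_op (γ δ : Q → ℤ) :
    euler (fun x : Qᵒᵖ => γ x.unop) (fun x : Qᵒᵖ => δ x.unop) = euler δ γ := by
  have hs : ∀ g : Q → ℤ, ∑ x : Qᵒᵖ, g x.unop = ∑ x, g x := fun g =>
    (Fintype.sum_equiv equivToOpposite g (fun x => g x.unop) fun _ => rfl).symm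
  have hcard : ∀ x y : Qᵒᵖ, Nat.card (x ⟶ y) = Nat.card (y.unop ⟶ x.unop) := fun x y =>
    Nat.card_congr ⟨fun a => a.unop, fun a => a.op, fun _ => rfl, fun _ => rfl⟩
  simp only [euler, hcard]
  rw [hs fun x => γ x * δ x,
    hs fun x => ∑ y : Qᵒᵖ, (Nat.card (y.unop ⟶ x) : ℤ) * (γ x * δ y.unop)]
  congr 1
  · exact Finset.sum_congr rfl fun _ _ => mul_comm _ _
  · rw [Finset.sum_congr rfl fun x _ =>
      hs fun y => (Nat.card (y ⟶ x) : ℤ) * (γ x * δ y), Finset.sum_comm]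
    exact Finset.sum_congr rfl fun _ _ => Finset.sum_congr rfl fun _ _ => by ring

/-- The transpose of a representation. -/
def opRep (V : Rep ℂ α) : Rep ℂ (fun x : Qᵒᵖ => α x.unop) :=
  fun x y a => (V y.unop x.unop a.unop).transpose

/-- The transpose of a representation of the opposite quiver. -/
def unopRep {α : Qᵒᵖ → ℕ} (V : Rep ℂ α) : Rep ℂ (fun x : Q => α (op x)) :=
  fun x y a => (V (op y) (op x) a.op).transpose

/-- Transposition reverses arrows, exchanges the two arguments of Hom, and turns `d` into its
negative. -/
theorem finrank_homSpace_opRep (V : Rep ℂ α) (W : Rep ℂ β) :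
    Module.finrank ℂ (homSpace (opRep W) (opRep V)) = Module.finrank ℂ (homSpace V W) := by
  let E : Dom α β ≃ₗ[ℂ] Dom (fun x : Qᵒᵖ => β x.unop) (fun x : Qᵒᵖ => α x.unop) :=
    { toFun := fun φ x => (φ x.unop).transpose
      map_add' := fun _ _ => rfl
      map_smul' := fun _ _ => rfl
      invFun := fun φ x => (φ (op x)).transpose
      left_inv := fun _ => rfl
      right_inv := fun _ => rfl }
  have h : homSpace V W = (homSpace (opRep W) (opRep V)).comap E.toLinearMap := by
    ext φ
    rw [Submodule.mem_comap]
    simp only [homSpace, LinearMap.mem_ker, funext_iff]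
    have h1 : ∀ (x y : Q) (a : x ⟶ y), dMap (opRep W) (opRep V) (E φ) (op y) (op x) a.op =
        -(dMap V W φ x y a).transpose := by
      intro x y a
      simp only [dMap, LinearMap.coe_mk, AddHom.coe_mk, Matrix.transpose_sub,
        Matrix.transpose_mul, neg_sub]
      rfl
    constructor
    · intro h x y a
      refine (h1 y.unop x.unop a.unop).trans ?_
      rw [h]
      simp
    · intro h x y a
      have h2 := h1 x y a
      rw [LinearEquiv.coe_coe] at h
      rw [h] at h2
      simpa using (neg_eq_zero.1 h2.symm)
  rw [h]
  exact (E.ofSubmodule' _).finrank_eq.symm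

theorem homSpace_opRep_eq_bot (V : Rep ℂ α) (W : Rep ℂ β) :
    homSpace (opRep W) (opRep V) = ⊥ ↔ homSpace V W = ⊥ := by
  rw [← Submodule.finrank_eq_zero (R := ℂ), finrank_homSpace_opRep,
    Submodule.finrank_eq_zero]

/-- The inverse Auslander–Reiten translate of a representation `N`, and its dimension vector. -/
theorem exists_cotranslate (hQ : Acyclic Q) (hβ : ∀ x, β x ≠ 0) (N : Rep ℂ ν) (W₀ : Rep ℂ β)
    (h : homSpace W₀ N = ⊥) : ∃ (α : Q → ℕ) (V : Rep ℂ α),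
      (∀ η, euler (toInt α) η = -euler η (toInt ν)) ∧
      ∀ (δ : Q → ℕ) (W : Rep ℂ δ), (Module.finrank ℂ (homSpace V W) : ℤ) +
        euler (toInt δ) (toInt ν) = Module.finrank ℂ (homSpace W N) := by
  obtain ⟨μ, V, h1, h2⟩ := exists_translate hQ.op (fun x => hβ x.unop) (opRep N) (opRep W₀)
    ((homSpace_opRep_eq_bot _ _).2 h)
  refine ⟨fun x => μ (op x), unopRep V, ?_, ?_⟩
  · intro η
    have h3 := h1 fun x => η x.unop
    have h4 := euler_op (toInt ν) η
    have h5 := euler_op η (toInt fun x => μ (op x))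
    have h6 : toInt (fun x : Qᵒᵖ => ν x.unop) = fun x : Qᵒᵖ => toInt ν x.unop := rfl
    have h7 : toInt μ = fun x : Qᵒᵖ => toInt (fun x => μ (op x)) x.unop := rfl
    rw [h6, h4, h7, h5] at h3
    omega
  · intro δ W
    have h3 := h2 _ (opRep W)
    have h4 := euler_op (toInt ν) (toInt δ)
    have h6 : toInt (fun x : Qᵒᵖ => ν x.unop) = fun x : Qᵒᵖ => toInt ν x.unop := rfl
    have h7 : toInt (fun x : Qᵒᵖ => δ x.unop) = fun x : Qᵒᵖ => toInt δ x.unop := rfl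
    rw [finrank_homSpace_opRep, h6, h7, h4] at h3
    rw [← h3]
    have h8 := finrank_homSpace_opRep (unopRep V) W
    rw [← h8]
    rfl

end Opposite

/-! ### Translating semi-invariants and exceptional representations. -/

section Translate

variable {Q : Type} [Quiver.{0} Q] [Fintype Q] [DecidableEq Q] [∀ x y : Q, Finite (x ⟶ y)]
  {α β ν : Q → ℕ} {f : MvPolynomial (Coord β) ℂ} {V : Rep ℂ α} {N : Rep ℂ ν}

theorem homSpace_eq_bot_of_finrank {α β γ δ : Q → ℕ} {V : Rep ℂ α} {W : Rep ℂ β}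
    {V' : Rep ℂ γ} {W' : Rep ℂ δ}
    (h : Module.finrank ℂ (homSpace V W) = Module.finrank ℂ (homSpace V' W')) :
    homSpace V W = ⊥ ↔ homSpace V' W' = ⊥ := by
  rw [← Submodule.finrank_eq_zero (R := ℂ), h, Submodule.finrank_eq_zero]

/-- The semi-invariant `c^V` can be written in terms of the Auslander–Reiten translate of `V`. -/
theorem Represents.exists_coRepresents (hQ : Acyclic Q) (hβ : ∀ x, β x ≠ 0) (hf : Irreducible f)
    (h : Represents f V) : ∃ (ν : Q → ℕ) (N : Rep ℂ ν), CoRepresents f N ∧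
      (∀ η, euler (toInt α) η = -euler η (toInt ν)) ∧
      ∀ (δ : Q → ℕ) (W : Rep ℂ δ), (Module.finrank ℂ (homSpace W N) : ℤ) +
        euler (toInt α) (toInt δ) = Module.finrank ℂ (homSpace V W) := by
  obtain ⟨W₀, hW₀⟩ := exists_evalAt_ne_zero hf.ne_zero
  obtain ⟨ν, N, h1, h2⟩ := exists_translate hQ hβ V W₀ ((h.ne_zero_iff W₀).1 hW₀)
  refine ⟨ν, N, coRepresents_of_ne_zero_iff hQ hβ hf ?_ fun W => ?_, h1, h2⟩
  · rw [← (leftWeight_eq_rightWeight_iff _ _).2 h1]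
    exact h.isSemiInvariant.scalarWeight
  · rw [h.ne_zero_iff]
    have h3 := h2 β W
    rw [h.euler_eq_zero, add_zero] at h3
    exact (homSpace_eq_bot_of_finrank (by exact_mod_cast h3)).symm

/-- Needed after a construction on the translate, to return to a representation in the first
argument through the inverse translate. -/
theorem CoRepresents.exists_represents (hQ : Acyclic Q) (hβ : ∀ x, β x ≠ 0) (hf : Irreducible f)
    (h : CoRepresents f N) : ∃ (α : Q → ℕ) (V : Rep ℂ α), Represents f V ∧
      ∀ η, euler (toInt α) η = -euler η (toInt ν) := by
  obtain ⟨W₀, hW₀⟩ := exists_evalAt_ne_zero hf.ne_zero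
  obtain ⟨α, V, h1, h2⟩ := exists_cotranslate hQ hβ N W₀ ((h.ne_zero_iff W₀).1 hW₀)
  refine ⟨α, V, represents_of_ne_zero_iff hQ hβ hf ?_ fun W => ?_, h1⟩
  · rw [(leftWeight_eq_rightWeight_iff _ _).2 h1]
    exact h.scalarWeight
  · rw [h.ne_zero_iff]
    have h3 := h2 β W
    rw [h.euler_eq_zero, add_zero] at h3
    exact (homSpace_eq_bot_of_finrank (by exact_mod_cast h3)).symm

/-- The Auslander–Reiten translate of an exceptional representation is exceptional. -/
theorem isRealSchurRoot_translate (hν : ∀ η, euler (toInt α) η = -euler η (toInt ν))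
    (hN : ∀ (δ : Q → ℕ) (W : Rep ℂ δ), (Module.finrank ℂ (homSpace W N) : ℤ) +
        euler (toInt α) (toInt δ) = Module.finrank ℂ (homSpace V W))
    (hV : Module.finrank ℂ (homSpace V V) = 1) (hq : euler (toInt α) (toInt α) = 1) :
    IsRealSchurRoot (toInt ν) := by
  -- At W = V, dim Hom(V,N) + 1 = 1, so Hom(V,N) = 0. At W = N, dim End(N) - ⟨ν,ν⟩ = 0, so End(N) is
  -- one-dimensional.
  have h1 := hN α V
  have h2 := hN ν N
  have h3 := euler_self_eq_of_dual hν
  rw [hV, hq] at h1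
  have h4 : homSpace V N = ⊥ := by
    rw [← Submodule.finrank_eq_zero (R := ℂ)]
    omega
  rw [h4, finrank_bot, hν, h3, hq] at h2
  exact isRealSchurRoot_of_brick N (by omega) (h3.trans hq)

end Translate

end QuiverSlice

namespace QuiverSlice

/-! ### Carrying determinants from one quiver to another. -/

section Transfer

variable {Q : Type} [Fintype Q] [DecidableEq Q] [Quiver.{0} Q] [∀ x y : Q, Finite (x ⟶ y)]
  {R : Type} [Fintype R] [DecidableEq R] [Quiver.{0} R] [∀ x y : R, Finite (x ⟶ y)]

theorem exists_det_conj {D C D' C' : Type} [AddCommGroup D] [Module ℂ D] [AddCommGroup C]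
    [Module ℂ C] [AddCommGroup D'] [Module ℂ D'] [AddCommGroup C'] [Module ℂ C']
    (ε : C ≃ₗ[ℂ] D) (E₁ : D ≃ₗ[ℂ] D') (E₂ : C ≃ₗ[ℂ] C') :
    ∃ ε' : C' ≃ₗ[ℂ] D', ∀ (d : D →ₗ[ℂ] C) (d' : D' →ₗ[ℂ] C'), (∀ φ, d' (E₁ φ) = E₂ (d φ)) →
      LinearMap.det ((ε' : C' →ₗ[ℂ] D') ∘ₗ d') = LinearMap.det ((ε : C →ₗ[ℂ] D) ∘ₗ d) := by
  refine ⟨E₂.symm ≪≫ₗ ε ≪≫ₗ E₁, fun d d' h => ?_⟩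
  rw [← LinearMap.det_conj ((ε : C →ₗ[ℂ] D) ∘ₗ d) E₁]
  congr 1
  refine LinearMap.ext fun v => ?_
  have h1 := h (E₁.symm v)
  rw [LinearEquiv.apply_symm_apply] at h1
  simp [h1]

/-- Isomorphic maps d have proportional determinants even on different quivers. Surjectivity of `P`
ensures that every representation of the new quiver is tested. -/
theorem Represents.transfer {α β : Q → ℕ} {α' β' : R → ℕ} {f : MvPolynomial (Coord β) ℂ}
    {f' : MvPolynomial (Coord β') ℂ} {V : Rep ℂ α} {V' : Rep ℂ α'} (h : Represents f V)
    (P : Rep ℂ β → Rep ℂ β') (hP : Function.Surjective P)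
    (hf : ∀ W, evalAt f' (P W) = evalAt f W)
    (E₁ : Dom α β ≃ₗ[ℂ] Dom α' β') (E₂ : Cod α β ≃ₗ[ℂ] Cod α' β')
    (hE : ∀ W φ, dMap V' (P W) (E₁ φ) = E₂ (dMap V W φ)) : Represents f' V' := by
  obtain ⟨ε, c, hc, h⟩ := h
  obtain ⟨ε', h'⟩ := exists_det_conj ε E₁ E₂
  refine ⟨ε', c, hc, fun W' => ?_⟩
  obtain ⟨W, rfl⟩ := hP W'
  rw [hf, h, h' _ _ (hE W)]

theorem CoRepresents.transfer {β ν : Q → ℕ} {β' ν' : R → ℕ} {f : MvPolynomial (Coord β) ℂ}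
    {f' : MvPolynomial (Coord β') ℂ} {N : Rep ℂ ν} {N' : Rep ℂ ν'} (h : CoRepresents f N)
    (P : Rep ℂ β → Rep ℂ β') (hP : Function.Surjective P)
    (hf : ∀ W, evalAt f' (P W) = evalAt f W)
    (E₁ : Dom β ν ≃ₗ[ℂ] Dom β' ν') (E₂ : Cod β ν ≃ₗ[ℂ] Cod β' ν')
    (hE : ∀ W φ, dMap (P W) N' (E₁ φ) = E₂ (dMap W N φ)) : CoRepresents f' N' := by
  obtain ⟨ε, c, hc, h⟩ := h
  obtain ⟨ε', h'⟩ := exists_det_conj ε E₁ E₂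
  refine ⟨ε', c, hc, fun W' => ?_⟩
  obtain ⟨W, rfl⟩ := hP W'
  rw [hf, h, h' _ _ (hE W)]

theorem euler_eq_of_equiv {α β : Q → ℕ} {α' β' : R → ℕ} (E₁ : Dom α β ≃ₗ[ℂ] Dom α' β')
    (E₂ : Cod α β ≃ₗ[ℂ] Cod α' β') : euler (toInt α') (toInt β') = euler (toInt α) (toInt β) := by
  rw [euler_toInt, euler_toInt, E₁.finrank_eq, E₂.finrank_eq]

/-- A factorisation in fewer variables remains one in more variables, and the units are the
constants in both rings. -/
theorem irreducible_of_rename {ι τ : Type} [Finite ι] [Finite τ] {φ : ι → τ} (hφ : Function.Injective φ)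
    {f : MvPolynomial ι ℂ} (hf : Irreducible (rename φ f)) : Irreducible f := by
  have hu : ∀ g : MvPolynomial ι ℂ, IsUnit (rename φ g) → IsUnit g := by
    intro g hg
    obtain ⟨c, hc, h⟩ := isUnit_iff_exists_C.1 hg
    rw [← rename_C φ c] at h
    exact isUnit_iff_exists_C.2 ⟨c, hc, rename_injective φ hφ h⟩
  refine ⟨fun h => hf.not_isUnit (h.map _), fun a b h => ?_⟩
  rw [h, map_mul] at hf
  exact (hf.isUnit_or_isUnit rfl).imp (hu a) (hu b)

end Transfer

/-! ### Simplification at a vertex with α_x = 0. -/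

section SplitIn

variable {Q : Type} [Fintype Q] [DecidableEq Q] [Quiver.{0} Q] [∀ x y : Q, Finite (x ⟶ y)]

/-- The projection of the simplified quiver to the quiver it comes from. -/
def SplitIn.prefunctor (x : Q) : SplitIn x ⥤q Q where
  obj := SplitIn.vert
  map := SplitIn.arrow

/-- Each copy of x is labelled by the unique arrow ending there, so no arrow of the original quiver
appears twice. -/
theorem SplitIn.total_injective {x : Q} {u v u' v' : SplitIn x} {a : u ⟶ v} {a' : u' ⟶ v'}
    (h : (⟨u.vert, v.vert, SplitIn.arrow a⟩ : Σ y z : Q, (y ⟶ z)) = ⟨u'.vert, v'.vert, SplitIn.arrow a'⟩) :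
    (⟨u, v, a⟩ : Σ y z : SplitIn x, (y ⟶ z)) = ⟨u', v', a'⟩ := by
  rcases u with ⟨u, hu⟩ | u
  swap
  · exact a.elim
  rcases u' with ⟨u', hu'⟩ | u'
  swap
  · exact a'.elim
  rcases v with ⟨v, hv⟩ | v <;> rcases v' with ⟨v', hv'⟩ | v'
  · simp only [vert, arrow, Sigma.mk.injEq] at h
    obtain ⟨rfl, h⟩ := h
    replace h := Sigma.mk.inj (eq_of_heq h)
    obtain ⟨rfl, h⟩ := h
    replace h := eq_of_heq h
    subst h
    rfl
  · simp only [vert, arrow, Sigma.mk.injEq] at h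
    obtain ⟨rfl, h⟩ := h
    replace h := Sigma.mk.inj (eq_of_heq h)
    exact absurd h.1 hv
  · simp only [vert, arrow, Sigma.mk.injEq] at h
    obtain ⟨rfl, h⟩ := h
    replace h := Sigma.mk.inj (eq_of_heq h)
    exact absurd h.1.symm hv'
  · obtain ⟨a, rfl⟩ := a
    obtain ⟨a', rfl⟩ := a'
    simp only [vert, arrow, Sigma.mk.injEq] at h
    obtain ⟨rfl, h⟩ := h
    replace h := Sigma.mk.inj (eq_of_heq h)
    have h2 := eq_of_heq h.2
    subst h2
    rfl

variable (x : Q) {p q : Q → ℕ}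

/-- The restriction of a family of matrices along the projection of the simplified quiver. -/
def SplitIn.codPull (q p : Q → ℕ) :
    Cod q p →ₗ[ℂ] Cod (fun u : SplitIn x => q u.vert) (fun u : SplitIn x => p u.vert) where
  toFun ψ u v a := ψ u.vert v.vert (SplitIn.arrow a)
  map_add' _ _ := rfl
  map_smul' _ _ := rfl

/-- The restriction of a family of matrices along the projection of the simplified quiver. -/
def SplitIn.domPull (q p : Q → ℕ) :
    Dom q p →ₗ[ℂ] Dom (fun u : SplitIn x => q u.vert) (fun u : SplitIn x => p u.vert) where
  toFun φ u := φ u.vert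
  map_add' _ _ := rfl
  map_smul' _ _ := rfl

theorem SplitIn.codPull_surjective : Function.Surjective (SplitIn.codPull x q p) := by
  let T : CodIdx (fun u : SplitIn x => q u.vert) (fun u : SplitIn x => p u.vert) → CodIdx q p :=
    fun c => ⟨c.1.vert, c.2.1.vert, SplitIn.arrow c.2.2.1, c.2.2.2⟩
  have hT : Function.Injective T := by
    rintro ⟨u, v, a, i⟩ ⟨u', v', a', i'⟩ h
    have h1 := SplitIn.total_injective (congrArg
      (fun c : CodIdx q p => (⟨c.1, c.2.1, c.2.2.1⟩ : Σ y z : Q, (y ⟶ z))) h)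
    simp only [Sigma.mk.injEq] at h1
    obtain ⟨rfl, h1⟩ := h1
    rw [heq_eq_eq, Sigma.mk.injEq] at h1
    obtain ⟨rfl, h1⟩ := h1
    rw [heq_eq_eq] at h1
    subst h1
    simp only [T, Sigma.mk.injEq, heq_eq_eq, true_and] at h
    rw [h]
  intro ψ'
  obtain ⟨c, hc⟩ := hT.surjective_comp_right (codEquiv _ _ ψ')
  refine ⟨(codEquiv q p).symm c, (codEquiv _ _).injective ?_⟩
  rw [← hc]
  rfl

/-- Only arrows leaving x are lost, and their components are matrices with q_x = 0 columns. -/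
theorem SplitIn.codPull_injective (hq : q x = 0) : Function.Injective (SplitIn.codPull x q p) := by
  intro ψ ψ' h
  funext y z a
  by_cases hy : y = x
  · subst hy
    ext i k
    exact absurd k.2 (by omega)
  by_cases hz : z = x
  · subst hz
    exact congrFun (congrFun (congrFun h (Sum.inl ⟨y, hy⟩)) (Sum.inr ⟨y, a⟩)) ⟨a, rfl⟩
  · exact congrFun (congrFun (congrFun h (Sum.inl ⟨y, hy⟩)) (Sum.inl ⟨z, hz⟩)) a

theorem SplitIn.domPull_bijective (hq : q x = 0) :
    Function.Bijective (SplitIn.domPull x q p) := by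
  constructor
  · intro φ φ' h
    funext y
    by_cases hy : y = x
    · subst hy
      ext i k
      exact absurd k.2 (by omega)
    · exact congrFun h (Sum.inl ⟨y, hy⟩)
  · intro φ
    refine ⟨fun y => if hy : y = x then 0 else φ (Sum.inl ⟨y, hy⟩), ?_⟩
    funext u
    rcases u with ⟨y, hy⟩ | b
    · exact dif_neg hy
    · ext i k
      have : k.1 < q x := k.2
      omega

/-- A simplification at a vertex `x` with `α_x = 0`. -/
theorem Represents.exists_splitIn {α β : Q → ℕ} {f : MvPolynomial (Coord β) ℂ} {V : Rep ℂ α}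
    (h : Represents f V) (hx : α x = 0) (f' : MvPolynomial (Coord (splitInBeta β x)) ℂ)
    (hf' : rename (splitInCoord β x) f' = f) :
    ∃ (α' : SplitIn x → ℕ) (V' : Rep ℂ α'), Represents f' V' ∧
      euler (toInt α') (toInt α') = euler (toInt α) (toInt α) := by
  let E₁ : ∀ p : Q → ℕ, Dom α p ≃ₗ[ℂ] _ := fun p =>
    LinearEquiv.ofBijective _ (SplitIn.domPull_bijective x (p := p) hx)
  let E₂ : ∀ p : Q → ℕ, Cod α p ≃ₗ[ℂ] _ := fun p =>
    LinearEquiv.ofBijective (SplitIn.codPull x α p)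
      ⟨SplitIn.codPull_injective x hx, SplitIn.codPull_surjective x⟩
  refine ⟨_, SplitIn.codPull x α α V, h.transfer (SplitIn.codPull x β β)
    (SplitIn.codPull_surjective x) (fun W => ?_) (E₁ β) (E₂ β) fun W φ => rfl,
    euler_eq_of_equiv (E₁ α) (E₂ α)⟩
  rw [← hf', evalAt_rename]
  rfl

/-- If two coordinates had the same image, no representation could restrict to the indicator of one
of them, against surjectivity of restriction. -/
theorem splitInCoord_injective (β : Q → ℕ) : Function.Injective (splitInCoord β x) := by
  classical
  intro c c' h
  by_contra hc
  obtain ⟨W, hW⟩ := SplitIn.codPull_surjective (q := β) (p := β) x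
    ((codEquiv _ _).symm (Pi.single c 1))
  have h2 : ∀ b : CodIdx (fun u : SplitIn x => β u.vert) (fun u : SplitIn x => β u.vert),
      codEquiv β β W (splitInCoord β x b) = (Pi.single c 1 : _ → ℂ) b := fun b =>
    (congrFun (congrArg (codEquiv _ _) hW) b).trans
      (congrFun (LinearEquiv.apply_symm_apply _ _) b)
  have h3 := (h2 c).symm.trans ((congrArg _ h).trans (h2 c'))
  rw [Pi.single_eq_same, Pi.single_eq_of_ne (Ne.symm hc)] at h3
  exact one_ne_zero h3

end SplitIn

/-! ### Simplification at a vertex with α*_x = 0. -/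

section SplitOut

variable {Q : Type} [Fintype Q] [DecidableEq Q] [Quiver.{0} Q] [∀ x y : Q, Finite (x ⟶ y)]

/-- The projection of the simplified quiver to the quiver it comes from. -/
def SplitOut.prefunctor (x : Q) : SplitOut x ⥤q Q where
  obj := SplitOut.vert
  map := SplitOut.arrow

theorem SplitOut.total_injective {x : Q} {u v u' v' : SplitOut x} {a : u ⟶ v} {a' : u' ⟶ v'}
    (h : (⟨v.vert, u.vert, SplitOut.arrow a⟩ : Σ z y : Q, (y ⟶ z)) = ⟨v'.vert, u'.vert, SplitOut.arrow a'⟩) :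
    (⟨v, u, a⟩ : Σ z y : SplitOut x, (y ⟶ z)) = ⟨v', u', a'⟩ := by
  rcases v with ⟨v, hv⟩ | v
  swap
  · rcases u with u | u <;> exact a.elim
  rcases v' with ⟨v', hv'⟩ | v'
  swap
  · rcases u' with u' | u' <;> exact a'.elim
  rcases u with ⟨u, hu⟩ | u <;> rcases u' with ⟨u', hu'⟩ | u'
  · simp only [vert, arrow, Sigma.mk.injEq] at h
    obtain ⟨rfl, h⟩ := h
    replace h := Sigma.mk.inj (eq_of_heq h)
    obtain ⟨rfl, h⟩ := h
    replace h := eq_of_heq h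
    subst h
    rfl
  · simp only [vert, arrow, Sigma.mk.injEq] at h
    obtain ⟨rfl, h⟩ := h
    replace h := Sigma.mk.inj (eq_of_heq h)
    exact absurd h.1 hu
  · simp only [vert, arrow, Sigma.mk.injEq] at h
    obtain ⟨rfl, h⟩ := h
    replace h := Sigma.mk.inj (eq_of_heq h)
    exact absurd h.1.symm hu'
  · obtain ⟨a, rfl⟩ := a
    obtain ⟨a', rfl⟩ := a'
    simp only [vert, arrow, Sigma.mk.injEq] at h
    obtain ⟨rfl, h⟩ := h
    replace h := Sigma.mk.inj (eq_of_heq h)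
    have h2 := eq_of_heq h.2
    subst h2
    rfl

variable (x : Q) {p q : Q → ℕ}

/-- The restriction of a family of matrices along the projection of the simplified quiver. -/
def SplitOut.codPull (q p : Q → ℕ) :
    Cod q p →ₗ[ℂ] Cod (fun u : SplitOut x => q u.vert) (fun u : SplitOut x => p u.vert) where
  toFun ψ u v a := ψ u.vert v.vert (SplitOut.arrow a)
  map_add' _ _ := rfl
  map_smul' _ _ := rfl

/-- The restriction of a family of matrices along the projection of the simplified quiver. -/
def SplitOut.domPull (q p : Q → ℕ) :
    Dom q p →ₗ[ℂ] Dom (fun u : SplitOut x => q u.vert) (fun u : SplitOut x => p u.vert) where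
  toFun φ u := φ u.vert
  map_add' _ _ := rfl
  map_smul' _ _ := rfl

theorem SplitOut.codPull_surjective : Function.Surjective (SplitOut.codPull x q p) := by
  let T : CodIdx (fun u : SplitOut x => q u.vert) (fun u : SplitOut x => p u.vert) → CodIdx q p :=
    fun c => ⟨c.1.vert, c.2.1.vert, SplitOut.arrow c.2.2.1, c.2.2.2⟩
  have hT : Function.Injective T := by
    rintro ⟨u, v, a, i⟩ ⟨u', v', a', i'⟩ h
    have h1 := SplitOut.total_injective (congrArg
      (fun c : CodIdx q p => (⟨c.2.1, c.1, c.2.2.1⟩ : Σ z y : Q, (y ⟶ z))) h)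
    simp only [Sigma.mk.injEq] at h1
    obtain ⟨rfl, h1⟩ := h1
    rw [heq_eq_eq, Sigma.mk.injEq] at h1
    obtain ⟨rfl, h1⟩ := h1
    rw [heq_eq_eq] at h1
    subst h1
    simp only [T, Sigma.mk.injEq, heq_eq_eq, true_and] at h
    rw [h]
  intro ψ'
  obtain ⟨c, hc⟩ := hT.surjective_comp_right (codEquiv _ _ ψ')
  refine ⟨(codEquiv q p).symm c, (codEquiv _ _).injective ?_⟩
  rw [← hc]
  rfl

/-- Now the arrows into x are lost; their components have p_x = 0 rows. -/
theorem SplitOut.codPull_injective (hp : p x = 0) :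
    Function.Injective (SplitOut.codPull x q p) := by
  intro ψ ψ' h
  funext y z a
  by_cases hz : z = x
  · subst hz
    ext i k
    exact absurd i.2 (by omega)
  by_cases hy : y = x
  · subst hy
    exact congrFun (congrFun (congrFun h (Sum.inr ⟨z, a⟩)) (Sum.inl ⟨z, hz⟩)) ⟨a, rfl⟩
  · exact congrFun (congrFun (congrFun h (Sum.inl ⟨y, hy⟩)) (Sum.inl ⟨z, hz⟩)) a

theorem SplitOut.domPull_bijective (hp : p x = 0) :
    Function.Bijective (SplitOut.domPull x q p) := by
  constructor
  · intro φ φ' h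
    funext y
    by_cases hy : y = x
    · subst hy
      ext i k
      exact absurd i.2 (by omega)
    · exact congrFun h (Sum.inl ⟨y, hy⟩)
  · intro φ
    refine ⟨fun y => if hy : y = x then 0 else φ (Sum.inl ⟨y, hy⟩), ?_⟩
    funext u
    rcases u with ⟨y, hy⟩ | b
    · exact dif_neg hy
    · ext i k
      have : i.1 < p x := i.2
      omega

/-- A simplification at a vertex `x` with `α*_x = 0`. -/
theorem CoRepresents.exists_splitOut {β ν : Q → ℕ} {f : MvPolynomial (Coord β) ℂ} {N : Rep ℂ ν}
    (h : CoRepresents f N) (hx : ν x = 0) (f' : MvPolynomial (Coord (splitOutBeta β x)) ℂ)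
    (hf' : rename (splitOutCoord β x) f' = f) :
    ∃ (ν' : SplitOut x → ℕ) (N' : Rep ℂ ν'), CoRepresents f' N' ∧
      euler (toInt ν') (toInt ν') = euler (toInt ν) (toInt ν) := by
  let E₁ : ∀ q : Q → ℕ, Dom q ν ≃ₗ[ℂ] _ := fun q =>
    LinearEquiv.ofBijective _ (SplitOut.domPull_bijective x (q := q) hx)
  let E₂ : ∀ q : Q → ℕ, Cod q ν ≃ₗ[ℂ] _ := fun q =>
    LinearEquiv.ofBijective (SplitOut.codPull x q ν)
      ⟨SplitOut.codPull_injective x hx, SplitOut.codPull_surjective x⟩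
  refine ⟨_, SplitOut.codPull x ν ν N, h.transfer (SplitOut.codPull x β β)
    (SplitOut.codPull_surjective x) (fun W => ?_) (E₁ β) (E₂ β) fun W φ => rfl,
    euler_eq_of_equiv (E₁ ν) (E₂ ν)⟩
  rw [← hf', evalAt_rename]
  rfl

theorem splitOutCoord_injective (β : Q → ℕ) : Function.Injective (splitOutCoord β x) := by
  classical
  intro c c' h
  by_contra hc
  obtain ⟨W, hW⟩ := SplitOut.codPull_surjective (q := β) (p := β) x
    ((codEquiv _ _).symm (Pi.single c 1))
  have h2 : ∀ b : CodIdx (fun u : SplitOut x => β u.vert) (fun u : SplitOut x => β u.vert),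
      codEquiv β β W (splitOutCoord β x b) = (Pi.single c 1 : _ → ℂ) b := fun b =>
    (congrFun (congrArg (codEquiv _ _) hW) b).trans
      (congrFun (LinearEquiv.apply_symm_apply _ _) b)
  have h3 := (h2 c).symm.trans ((congrArg _ h).trans (h2 c'))
  rw [Pi.single_eq_same, Pi.single_eq_of_ne (Ne.symm hc)] at h3
  exact one_ne_zero h3

end SplitOut

/-! ### The Tits form as an invariant of simplification. -/

/-- The function is, up to a scalar, an irreducible Schofield semi-invariant `c^V` on a quiver
without oriented cycles, where `V` has Tits form `k`. -/
def IsSchofield (S : QuiverFunction) (k : ℤ) : Prop :=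
  Acyclic S.Vertex ∧ (∀ x, S.dim x ≠ 0) ∧ Irreducible S.poly ∧
    ∃ (α : S.Vertex → ℕ) (V : Rep ℂ α), Represents S.poly V ∧ euler (toInt α) (toInt α) = k

/-- Uniqueness of the weight identifies γ with the dimension vector of V or of its translate. A left
step is made on V directly. A right step is made on the translate and followed by the inverse
translate; both passages preserve the Tits form. -/
theorem IsSchofield.simplifyStep {S T : QuiverFunction} {k : ℤ} (h : IsSchofield S k)
    (hST : SimplifyStep S T) : IsSchofield T k := by
  obtain ⟨hQ, hβ, hirr, α, V, hV, hk⟩ := h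
  cases hST with
  | left β f γ hγ x hx f' hf' =>
    simp only at hQ hβ hirr V hV hk α
    have h1 := hγ.scalarWeight.unique hβ hirr.ne_zero hV.isSemiInvariant.scalarWeight
    have h2 := leftWeight_injective hQ h1
    have h3 : α x = 0 := by
      rw [h2] at hx
      exact Int.ofNat_eq_zero.1 hx
    obtain ⟨α', V', h4, h5⟩ := hV.exists_splitIn x h3 f' hf'
    exact ⟨hQ.of_prefunctor (SplitIn.prefunctor x), fun u => hβ _,
      irreducible_of_rename (splitInCoord_injective x β) (hf' ▸ hirr), α', V', h4, h5.trans hk⟩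
  | right β f γ hγ x hx f' hf' =>
    simp only at hQ hβ hirr V hV hk α
    obtain ⟨ν, N, hN, hν, -⟩ := hV.exists_coRepresents hQ hβ hirr
    have h1 := hγ.scalarWeight.unique hβ hirr.ne_zero hN.scalarWeight
    have h2 := rightWeight_injective hQ h1
    have h3 : ν x = 0 := by
      rw [h2] at hx
      exact Int.ofNat_eq_zero.1 hx
    obtain ⟨ν', N', h4, h5⟩ := hN.exists_splitOut x h3 f' hf'
    have h6 : Irreducible f' := irreducible_of_rename (splitOutCoord_injective x β) (hf' ▸ hirr)
    have h7 := hQ.of_prefunctor (SplitOut.prefunctor x)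
    obtain ⟨α', V', h8, h9⟩ := h4.exists_represents h7 (fun u => hβ _) h6
    refine ⟨h7, fun u => hβ _, h6, α', V', h8, ?_⟩
    rw [← euler_self_eq_of_dual h9, h5, euler_self_eq_of_dual hν, hk]

theorem IsSchofield.simplifies {S T : QuiverFunction} {k : ℤ} (h : IsSchofield S k)
    (hST : Simplifies S T) : IsSchofield T k := by
  induction hST with
  | refl => exact h
  | tail _ hst ih => exact ih.simplifyStep hst

/-- The weight determines the dimension vector of V, and End(V) = ℂ by irreducibility, so only
vanishing of Ext(V,V) is in question. -/
theorem IsSchofield.isRealSchurRoot_iff {S : QuiverFunction} {k : ℤ} (h : IsSchofield S k)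
    {γ : S.Vertex → ℤ} (hγ : IsSemiInvariant S.poly (leftWeight γ)) :
    IsRealSchurRoot γ ↔ k = 1 := by
  obtain ⟨hQ, hβ, hirr, α, V, hV, hk⟩ := h
  have h1 := hγ.scalarWeight.unique hβ hirr.ne_zero hV.isSemiInvariant.scalarWeight
  rw [leftWeight_injective hQ h1]
  constructor
  · intro h
    rw [← hk, h.euler_self]
  · rintro rfl
    exact isRealSchurRoot_of_brick V (hV.finrank_end hQ hβ hirr) hk

theorem IsSchofield.le_one {S : QuiverFunction} {k : ℤ} (h : IsSchofield S k) : k ≤ 1 := by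
  obtain ⟨hQ, hβ, hirr, α, V, hV, hk⟩ := h
  rw [← hk]
  exact euler_self_le_of_brick V (hV.finrank_end hQ hβ hirr)

end QuiverSlice

namespace QuiverSlice

/-! ### Functions regular on a principal open set. -/

section Regular

variable {τ ι : Type} {D : MvPolynomial τ ℂ} {F G : (τ → ℂ) → ℂ}

/-- `F` is given on the principal open set `D ≠ 0` by a polynomial divided by a power of `D`. -/
def RegularOn (D : MvPolynomial τ ℂ) (F : (τ → ℂ) → ℂ) : Prop :=
  ∃ (N : ℕ) (P : MvPolynomial τ ℂ), ∀ z, eval z D ≠ 0 → eval z P = eval z D ^ N * F z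

theorem regularOn_eval (P : MvPolynomial τ ℂ) : RegularOn D fun z => eval z P :=
  ⟨0, P, fun z _ => by simp⟩

theorem regularOn_const (c : ℂ) : RegularOn D fun _ => c := by
  simpa using regularOn_eval (D := D) (C c)

theorem RegularOn.add (hF : RegularOn D F) (hG : RegularOn D G) :
    RegularOn D fun z => F z + G z := by
  obtain ⟨N, P, hP⟩ := hF
  obtain ⟨M, R, hR⟩ := hG
  refine ⟨N + M, D ^ M * P + D ^ N * R, fun z hz => ?_⟩
  rw [map_add, map_mul, map_mul, map_pow, map_pow, hP z hz, hR z hz]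
  ring

theorem RegularOn.mul (hF : RegularOn D F) (hG : RegularOn D G) :
    RegularOn D fun z => F z * G z := by
  obtain ⟨N, P, hP⟩ := hF
  obtain ⟨M, R, hR⟩ := hG
  refine ⟨N + M, P * R, fun z hz => ?_⟩
  rw [map_mul, hP z hz, hR z hz]
  ring

theorem RegularOn.sum {s : Finset ι} {F : ι → (τ → ℂ) → ℂ} (h : ∀ i, RegularOn D (F i)) :
    RegularOn D fun z => ∑ i ∈ s, F i z := by
  classical
  induction s using Finset.induction_on with
  | empty => simpa using regularOn_const 0
  | insert i s hi ih =>
    simp only [Finset.sum_insert hi]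
    exact (h i).add ih

theorem RegularOn.eval {F : ι → (τ → ℂ) → ℂ} (h : ∀ i, RegularOn D (F i))
    (g : MvPolynomial ι ℂ) : RegularOn D fun z => MvPolynomial.eval (fun i => F i z) g := by
  induction g using MvPolynomial.induction_on with
  | C a => simpa using regularOn_const a
  | add p q hp hq => simpa using hp.add hq
  | mul_X p i hp => simpa using hp.mul (h i)

theorem RegularOn.congr (hF : RegularOn D F) (h : ∀ z, MvPolynomial.eval z D ≠ 0 → F z = G z) :
    RegularOn D G := by
  obtain ⟨N, P, hP⟩ := hF
  exact ⟨N, P, fun z hz => by rw [hP z hz, h z hz]⟩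

end Regular

/-! ### The slice as a restriction, and the weight of the induced function. -/

section Slice

variable {Q : Type} [Fintype Q] [DecidableEq Q] [Quiver.{0} Q] [∀ x y : Q, Finite (x ⟶ y)]
  {α β : Q → ℕ} {l j : Q}

/-- The vertices `l` and `j` are joined by a 1-source or a 1-sink whose free vertex is `l`. -/
def SlicePair (l j : Q) : Prop :=
  (∃ a : l ⟶ j, IsOneSource a) ∨ (∃ a : j ⟶ l, IsOneSink a)

theorem SlicePair.ne (h : SlicePair l j) (hQ : Acyclic Q) : l ≠ j := by
  obtain ⟨a, -⟩ | ⟨a, -⟩ := h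
  · exact hQ.ne_of_hom a
  · exact (hQ.ne_of_hom a).symm

theorem SlicePair.ends (h : SlicePair l j) {u v : Q} (b : u ⟶ v) (hb : u = l ∨ v = l) :
    (u = l ∧ v = j) ∨ (u = j ∧ v = l) := by
  obtain ⟨a, ha⟩ | ⟨a, ha⟩ := h
  · have := ha u v b hb
    simp only [Quiver.Total.mk.injEq] at this
    exact Or.inl ⟨this.1, this.2.1⟩
  · have := ha u v b hb
    simp only [Quiver.Total.mk.injEq] at this
    exact Or.inr ⟨this.1, this.2.1⟩

theorem SlicePair.total_eq (h : SlicePair l j) {u v u' v' : Q} (b : u ⟶ v) (b' : u' ⟶ v')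
    (hb : u = l ∨ v = l) (hb' : u' = l ∨ v' = l) :
    (⟨u, v, b⟩ : Quiver.Total Q) = ⟨u', v', b'⟩ := by
  obtain ⟨a, ha⟩ | ⟨a, ha⟩ := h
  · exact (ha u v b hb).trans (ha u' v' b' hb').symm
  · exact (ha u v b hb).trans (ha u' v' b' hb').symm

/-- The representation whose matrix at the arrow touching `l` is a block of `X`, and which agrees
with `W` at the other arrows. -/
def fill (l j : Q) (X : Matrix (Fin (β j)) (Fin (β j)) ℂ) (W : Rep ℂ β) : Rep ℂ β :=
  fun x y b => Matrix.of fun p q => if x = l ∨ y = l then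
    if h : (p : ℕ) < β j ∧ (q : ℕ) < β j then X ⟨p, h.1⟩ ⟨q, h.2⟩ else 0
  else W x y b p q

theorem SlicePair.lt (h : SlicePair l j) (hle : β l ≤ β j) {u v : Q} (b : u ⟶ v)
    (hb : u = l ∨ v = l) (p : Fin (β v)) (q : Fin (β u)) : (p : ℕ) < β j ∧ (q : ℕ) < β j := by
  have hp := p.2
  have hq := q.2
  obtain ⟨rfl, rfl⟩ | ⟨rfl, rfl⟩ := h.ends b hb <;> omega

theorem fill_apply_of_ne (X : Matrix (Fin (β j)) (Fin (β j)) ℂ) (W : Rep ℂ β) {u v : Q}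
    (b : u ⟶ v) (hb : ¬(u = l ∨ v = l)) : fill l j X W u v b = W u v b := by
  ext p q
  exact if_neg hb

theorem SlicePair.fill_apply (h : SlicePair l j) (hle : β l ≤ β j)
    (X : Matrix (Fin (β j)) (Fin (β j)) ℂ) (W : Rep ℂ β) {u v : Q} (b : u ⟶ v)
    (hb : u = l ∨ v = l) (p : Fin (β v)) (q : Fin (β u)) :
    fill l j X W u v b p q = X ⟨p, (h.lt hle b hb p q).1⟩ ⟨q, (h.lt hle b hb p q).2⟩ := by
  simp only [fill, Matrix.of_apply]
  rw [if_pos hb, dif_pos (h.lt hle b hb p q)]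

theorem SlicePair.fill_one_apply (h : SlicePair l j) (hle : β l ≤ β j) (W : Rep ℂ β) {u v : Q}
    (b : u ⟶ v) (hb : u = l ∨ v = l) (p : Fin (β v)) (q : Fin (β u)) :
    fill l j 1 W u v b p q = if (p : ℕ) = q then 1 else 0 := by
  rw [h.fill_apply hle _ _ _ hb, Matrix.one_apply]
  simp only [Fin.mk.injEq]

theorem SlicePair.evalAt_restrictAt (h : SlicePair l j) (hle : β l ≤ β j)
    (f : MvPolynomial (Coord β) ℂ) (W : Rep ℂ β) :
    evalAt (restrictAt l f) W = evalAt f (fill l j 1 W) := by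
  unfold evalAt restrictAt
  rw [← coe_aeval_eq_eval, ← coe_aeval_eq_eval, RingHom.coe_coe, RingHom.coe_coe, aeval_bind₁]
  congr 2
  funext c
  obtain ⟨u, v, b, p, q⟩ := c
  simp only
  by_cases hb : u = l ∨ v = l
  · rw [if_pos hb, h.fill_one_apply hle _ _ hb]
    split_ifs <;> simp
  · rw [if_neg hb, fill_apply_of_ne _ _ _ hb]
    simp

/-- The restriction of a representation to the slice. -/
def sliceRep (hle : β l ≤ β j) (W : Rep ℂ β) : Rep ℂ (sliceBeta β l j) :=
  repOf (coordOf W ∘ sliceCoord hle)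

theorem sliceRep_surjective (hlj : l ≠ j) (hle : β l ≤ β j) :
    Function.Surjective (sliceRep (β := β) (l := l) (j := j) hle) := by
  intro W'
  obtain ⟨c, hc⟩ := (sliceCoord_injective (β := β) hlj hle).surjective_comp_right (coordOf W')
  refine ⟨repOf c, ?_⟩
  simp only at hc
  rw [sliceRep, coordOf_repOf, hc, repOf_coordOf]

theorem SlicePair.evalAt_sliceRep (h : SlicePair l j) {hle : β l ≤ β j}
    {f : MvPolynomial (Coord β) ℂ} {fa : MvPolynomial (Coord (sliceBeta β l j)) ℂ}
    (hfa : IsInduced hle f fa) (W : Rep ℂ β) :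
    evalAt fa (sliceRep hle W) = evalAt f (fill l j 1 W) := by
  rw [← h.evalAt_restrictAt hle, ← hfa, evalAt_rename]
  rfl

theorem sliceDim_left (hlj : l ≠ j) : sliceDim β l j l = β l := if_neg hlj

/-- The free vertex, as a vertex of the sliced quiver. -/
def freeVertex (hlj : l ≠ j) (hl : β l ≠ 0) : SliceVertex β l j :=
  ⟨l, by rwa [sliceDim_left hlj]⟩

/-- The induced function on the slice has weight `⟨α, F ·⟩`, where `F` is the linear map with
`F(e_l) = e_l + e_j` and `F(e_x) = e_x` for `x ≠ l`. -/
theorem SlicePair.scalarWeight (h : SlicePair l j) (hlj : l ≠ j) (hl : β l ≠ 0) {hle : β l ≤ β j}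
    {f : MvPolynomial (Coord β) ℂ} {fa : MvPolynomial (Coord (sliceBeta β l j)) ℂ}
    (hfa : IsInduced hle f fa) {σ : Q → ℤ} (hσ : IsSemiInvariant f σ) :
    ScalarWeight fa fun u => σ u.1 + if u.1 = l then σ j else 0 := by
  intro t W'
  obtain ⟨W, rfl⟩ := sliceRep_surjective hlj hle W'
  -- A vertex dropped from the slice gets the scalar 1; its dimension 0 makes the value irrelevant
  -- in the final product.
  let T : Q → ℂˣ := fun x => if hx : sliceDim β l j x ≠ 0 then t ⟨x, hx⟩ else 1
  have hT : ∀ u : SliceVertex β l j, T u.1 = t u := fun u => dif_pos u.2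
  -- At j the first β_l coordinates are scaled like l and the rest like j. This diagonal element
  -- fixes the normal form (δ_{pq}) and induces the given scalar action on the slice.
  let d : ∀ x : Q, Fin (β x) → ℂˣ := fun x i => if x = j ∧ (i : ℕ) < β l then T l else T x
  let g : ∀ x : Q, GL (Fin (β x)) ℂ := fun x =>
    ⟨Matrix.diagonal fun i => (d x i : ℂ), Matrix.diagonal fun i => ((d x i : ℂ))⁻¹,
      by simp [Matrix.diagonal_mul_diagonal], by simp [Matrix.diagonal_mul_diagonal]⟩
  have hact : ∀ (W : Rep ℂ β) (u v : Q) (b : u ⟶ v) p q,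
      act g W u v b p q = d v p * W u v b p q * (d u q : ℂ)⁻¹ := by
    intro W u v b p q
    simp only [act]
    rw [show (g v : Matrix (Fin (β v)) (Fin (β v)) ℂ) = Matrix.diagonal fun i => (d v i : ℂ) from rfl,
      show ((g u)⁻¹ : GL (Fin (β u)) ℂ).val = Matrix.diagonal fun i => ((d u i : ℂ))⁻¹ from rfl,
      Matrix.mul_diagonal, Matrix.diagonal_mul]
  have h1 : fill l j 1 (act g W) = act g (fill l j 1 W) := by
    funext u v b
    ext p q
    rw [hact]
    by_cases hb : u = l ∨ v = l
    · rw [h.fill_one_apply hle _ _ hb, h.fill_one_apply hle _ _ hb]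
      by_cases hpq : (p : ℕ) = q
      · have hd : d v p = d u q := by
          have hp := p.2
          have hq := q.2
          simp only [d]
          obtain ⟨rfl, rfl⟩ | ⟨rfl, rfl⟩ := h.ends b hb
          · rw [if_pos ⟨rfl, by omega⟩, if_neg fun h => hlj h.1]
          · rw [if_neg fun h => hlj h.1, if_pos ⟨rfl, by omega⟩]
        rw [if_pos hpq, hd]
        simp
      · simp [hpq]
    · rw [fill_apply_of_ne _ _ _ hb, fill_apply_of_ne _ _ _ hb, hact]
  have hd : ∀ (u : SliceVertex β l j) i, d (fold l j u.1) (sliceIdx hle u i) = t u := by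
    intro u i
    rw [← hT u]
    have hi : (i : ℕ) < sliceDim β l j u.1 := i.2
    simp only [d, sliceIdx, fold, sliceDim] at hi ⊢
    split_ifs <;> grind
  have h2 : sliceRep hle (act g W) = scaleRep t (sliceRep hle W) := by
    funext u v b
    ext p q
    have := hact W (fold l j u.1) (fold l j v.1) b (sliceIdx hle v p) (sliceIdx hle u q)
    rw [hd, hd] at this
    refine this.trans ?_
    simp only [scaleRep, Matrix.smul_apply, smul_eq_mul]
    change _ = _ * W (fold l j u.1) (fold l j v.1) b (sliceIdx hle v p) (sliceIdx hle u q)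
    ring
  rw [← h2, h.evalAt_sliceRep hfa, h1, hσ, h.evalAt_sliceRep hfa]
  congr 2
  have hdet : ∀ x, (g x : Matrix (Fin (β x)) (Fin (β x)) ℂ).det =
      (T x : ℂ) ^ sliceDim β l j x * if x = j then (T l : ℂ) ^ β l else 1 := by
    intro x
    rw [show (g x : Matrix (Fin (β x)) (Fin (β x)) ℂ) = Matrix.diagonal fun i => (d x i : ℂ) from rfl,
      Matrix.det_diagonal]
    by_cases hx : x = j
    · subst hx
      simp only [d, true_and, sliceDim, if_true]
      obtain ⟨k, hk⟩ := Nat.exists_eq_add_of_le hle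
      rw [Fin.prod_univ_eq_prod_range (fun i => ((if i < β l then T l else T x : ℂˣ) : ℂ)) (β x),
        hk, Finset.prod_range_add, Finset.prod_congr rfl fun i hi => by
          rw [if_pos (Finset.mem_range.1 hi)]]
      simp [mul_comm]
    · simp [d, hx, sliceDim]
  have h3 : ∀ x, ((g x : Matrix (Fin (β x)) (Fin (β x)) ℂ).det) ^ σ x =
      (T x : ℂ) ^ (sliceDim β l j x * σ x) * if x = j then (T l : ℂ) ^ (β l * σ j) else 1 := by
    intro x
    rw [hdet, mul_zpow, ← zpow_natCast, ← zpow_mul]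
    split_ifs with hx
    · subst hx
      rw [← zpow_natCast, ← zpow_mul]
    · simp
  simp only [h3]
  rw [Finset.prod_mul_distrib, Finset.prod_ite_eq' Finset.univ j, if_pos (Finset.mem_univ _)]
  have h4 : (T l : ℂ) ^ (β l * σ j) =
      ∏ x, (T x : ℂ) ^ (sliceDim β l j x * if x = l then σ j else 0) := by
    rw [Finset.prod_eq_single l]
    · rw [if_pos rfl, sliceDim_left hlj]
    · intro x _ hx
      simp [hx]
    · simp
  rw [h4, ← Finset.prod_mul_distrib]
  have h5 : ∀ x, (T x : ℂ) ^ (sliceDim β l j x * σ x) *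
      (T x : ℂ) ^ (sliceDim β l j x * if x = l then σ j else 0) =
      (T x : ℂ) ^ (sliceDim β l j x * (σ x + if x = l then σ j else 0)) := by
    intro x
    rw [← zpow_add₀ (T x).ne_zero, mul_add]
  simp only [h5]
  have h6 : ∏ u : {x : Q // sliceDim β l j x ≠ 0}, (T u.1 : ℂ) ^ (sliceDim β l j u.1 *
      (σ u.1 + if u.1 = l then σ j else 0)) = ∏ x, (T x : ℂ) ^ (sliceDim β l j x *
      (σ x + if x = l then σ j else 0)) := by
    rw [← Finset.prod_filter_mul_prod_filter_not Finset.univ fun x => sliceDim β l j x ≠ 0,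
      Finset.prod_subtype _ (p := fun x => sliceDim β l j x ≠ 0) (by simp)]
    refine (mul_one _).symm.trans (congrArg _ (Finset.prod_eq_one fun x hx => ?_).symm)
    have hx : sliceDim β l j x = 0 := by simpa using hx
    simp [hx]
  rw [← h6]
  refine Finset.prod_congr rfl fun u _ => ?_
  have := hT u
  rw [this]
  rfl

end Slice

end QuiverSlice

namespace QuiverSlice

/-! ### Irreducibility of the induced function by a generic base change at j. -/

section BaseChange

variable {Q : Type} [Fintype Q] [DecidableEq Q] [Quiver.{0} Q] [∀ x y : Q, Finite (x ⟶ y)]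
  {α β : Q → ℕ} {l j : Q}

theorem act_update_one_apply (G : GL (Fin (β j)) ℂ) (W : Rep ℂ β) {u v : Q} (b : u ⟶ v) :
    act (Function.update 1 j G) W u v b =
      (Function.update (1 : ∀ x, GL (Fin (β x)) ℂ) j G v).val * W u v b *
      (Function.update (1 : ∀ x, GL (Fin (β x)) ℂ) j G⁻¹ u).val := by
  simp only [act]
  congr 2
  by_cases hu : u = j
  · subst hu; simp
  · simp [hu]

/-- Moving the matrix at the arrow touching `l` to its normal form by a base change at `j`. -/
theorem SlicePair.exists_baseChange (h : SlicePair l j) (hlj : l ≠ j) (hle : β l ≤ β j) :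
    ∃ k : ℤ, (k = 1 ∨ k = -1) ∧ ∀ (G : GL (Fin (β j)) ℂ) (W : Rep ℂ β),
      fill l j G.val W = act (Function.update 1 j (G ^ k))
        (fill l j 1 (act (Function.update 1 j (G ^ k)⁻¹) W)) := by
  have hoff : ∀ (G : GL (Fin (β j)) ℂ) (W : Rep ℂ β) {u v : Q} (b : u ⟶ v),
      ¬(u = l ∨ v = l) → fill l j 1 W u v b = act (Function.update 1 j G)
        (fill l j 1 (act (Function.update 1 j G⁻¹) W)) u v b := by
    intro G W u v b hb
    rw [act_update_one_apply, fill_apply_of_ne _ _ _ hb, fill_apply_of_ne _ _ _ hb,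
      act_update_one_apply]
    have h1 : ∀ (G : GL (Fin (β j)) ℂ) (x : Q),
        (Function.update (1 : ∀ x, GL (Fin (β x)) ℂ) j G x).val *
        (Function.update (1 : ∀ x, GL (Fin (β x)) ℂ) j G⁻¹ x).val = 1 := by
      intro G x
      by_cases hx : x = j
      · subst hx
        simp only [Function.update_self]
        exact G.mul_inv
      · simp [hx]
    rw [inv_inv, Matrix.mul_assoc, Matrix.mul_assoc, Matrix.mul_assoc, h1, Matrix.mul_one,
      ← Matrix.mul_assoc, h1, Matrix.one_mul]
  obtain ⟨a, ha⟩ | ⟨a, ha⟩ := id h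
  · refine ⟨1, Or.inl rfl, fun G W => ?_⟩
    funext u v b
    by_cases hb : u = l ∨ v = l
    · have hab := ha u v b hb
      simp only [Quiver.Total.mk.injEq] at hab
      obtain ⟨rfl, rfl, -⟩ := hab
      rw [act_update_one_apply, Function.update_self, Function.update_of_ne hlj]
      ext p q
      rw [h.fill_apply hle _ _ _ hb, Pi.one_apply, Units.val_one, Matrix.mul_one,
        Matrix.mul_apply]
      simp only [h.fill_one_apply hle _ _ hb]
      rw [Finset.sum_eq_single ⟨q, (h.lt hle b hb p q).2⟩]
      · simp
      · intro i _ hi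
        rw [if_neg fun h => hi (Fin.ext h), mul_zero]
      · simp
    · rw [← hoff _ _ _ hb, fill_apply_of_ne _ _ _ hb, fill_apply_of_ne _ _ _ hb]
  · refine ⟨-1, Or.inr rfl, fun G W => ?_⟩
    funext u v b
    by_cases hb : u = l ∨ v = l
    · have hab := ha u v b hb
      simp only [Quiver.Total.mk.injEq] at hab
      obtain ⟨rfl, rfl, -⟩ := hab
      rw [act_update_one_apply, Function.update_self, Function.update_of_ne hlj]
      ext p q
      rw [h.fill_apply hle _ _ _ hb, Pi.one_apply, Units.val_one, Matrix.one_mul,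
        Matrix.mul_apply]
      simp only [h.fill_one_apply hle _ _ hb]
      rw [Finset.sum_eq_single ⟨p, (h.lt hle b hb p q).1⟩]
      · simp
      · intro i _ hi
        rw [if_neg fun h => hi (Fin.ext h.symm), zero_mul]
      · simp
    · rw [← hoff _ _ _ hb, fill_apply_of_ne _ _ _ hb, fill_apply_of_ne _ _ _ hb]

theorem prod_det_update_one (G : GL (Fin (β j)) ℂ) (σ : Q → ℤ) :
    ∏ x, (Function.update (1 : ∀ x, GL (Fin (β x)) ℂ) j G x).val.det ^ σ x = G.val.det ^ σ j := by
  rw [Finset.prod_eq_single j]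
  · simp
  · intro x _ hx
    simp [hx]
  · simp

/-- Coordinates for a representation together with a square matrix. -/
abbrev FillCoord (β : Q → ℕ) (j : Q) : Type := (Fin (β j) × Fin (β j)) ⊕ Coord β

/-- The square matrix with the given coordinates. -/
def fillMatrix (z : FillCoord β j → ℂ) : Matrix (Fin (β j)) (Fin (β j)) ℂ :=
  Matrix.of fun p q => z (Sum.inl (p, q))

/-- The determinant of the square matrix, as a polynomial. -/
def fillDet (β : Q → ℕ) (j : Q) : MvPolynomial (FillCoord β j) ℂ :=
  (Matrix.of fun p q => X (Sum.inl (p, q)) : Matrix (Fin (β j)) (Fin (β j)) _).det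

theorem eval_fillMatrix (z : FillCoord β j → ℂ) :
    (eval z).mapMatrix (Matrix.of fun p q => X (Sum.inl (p, q)) :
      Matrix (Fin (β j)) (Fin (β j)) (MvPolynomial (FillCoord β j) ℂ)) = fillMatrix z := by
  ext p q
  simp [fillMatrix]

theorem eval_fillDet (z : FillCoord β j → ℂ) : eval z (fillDet β j) = (fillMatrix z).det := by
  rw [fillDet, RingHom.map_det, eval_fillMatrix]

/-- The square matrix with the given coordinates, if it is invertible. -/
def fillGL (z : FillCoord β j → ℂ) : GL (Fin (β j)) ℂ :=
  if h : (fillMatrix z).det ≠ 0 then Matrix.GeneralLinearGroup.mkOfDetNeZero _ h else 1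

theorem fillGL_val {z : FillCoord β j → ℂ} (h : eval z (fillDet β j) ≠ 0) :
    (fillGL z).val = fillMatrix z := by
  rw [eval_fillDet] at h
  rw [fillGL, dif_pos h]
  rfl

/-- The inverse is the adjugate divided by the determinant, the only denominator that occurs. -/
theorem regularOn_fillGL {k : ℤ} (hk : k = 1 ∨ k = -1) (p q : Fin (β j)) :
    RegularOn (fillDet β j) fun z => (fillGL z ^ k).val p q := by
  obtain rfl | rfl := hk
  · refine (regularOn_eval (X (Sum.inl (p, q)))).congr fun z hz => ?_
    rw [zpow_one, fillGL_val hz]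
    simp [fillMatrix]
  · refine ⟨1, (Matrix.adjugate (Matrix.of fun p q => X (Sum.inl (p, q)))) p q, fun z hz => ?_⟩
    have h1 := congrFun (congrFun (RingHom.map_adjugate (eval z) (Matrix.of fun p q =>
      X (Sum.inl (p, q)) : Matrix (Fin (β j)) (Fin (β j)) (MvPolynomial (FillCoord β j) ℂ))) p) q
    rw [RingHom.mapMatrix_apply, Matrix.map_apply] at h1
    have h2 : (fillGL z ^ (-1 : ℤ)).val =
        (eval z (fillDet β j))⁻¹ • (fillMatrix z).adjugate := by
      rw [zpow_neg_one, Matrix.coe_units_inv, fillGL_val hz, Matrix.inv_def, Ring.inverse_eq_inv',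
        eval_fillDet]
    rw [h1, eval_fillMatrix, pow_one]
    beta_reduce
    rw [h2, Matrix.smul_apply, smul_eq_mul, mul_inv_cancel_left₀ hz]

theorem regularOn_act {k : ℤ} (hk : k = 1 ∨ k = -1) (c : Coord β) :
    RegularOn (fillDet β j) fun z =>
      coordOf (act (Function.update 1 j (fillGL z ^ k)⁻¹) (repOf (z ∘ Sum.inr))) c := by
  obtain ⟨u, v, b, p, q⟩ := c
  have h1 : ∀ (k : ℤ), (k = 1 ∨ k = -1) → ∀ (x : Q) (p q : Fin (β x)),
      RegularOn (fillDet β j) fun z =>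
        (Function.update (1 : ∀ x, GL (Fin (β x)) ℂ) j (fillGL z ^ k) x).val p q := by
    intro k hk x p q
    by_cases hx : x = j
    · subst hx
      simpa using regularOn_fillGL hk p q
    · simpa [hx] using regularOn_const _
  have hk' : -k = 1 ∨ -k = -1 := by omega
  simp only [coordOf, act_update_one_apply, Matrix.mul_apply, inv_inv]
  refine RegularOn.sum fun i => RegularOn.mul (RegularOn.sum fun i' => RegularOn.mul ?_ ?_) ?_
  · simpa only [zpow_neg] using h1 _ hk' v p i'
  · simpa [repOf] using regularOn_eval (D := fillDet β j) (X (Sum.inr ⟨u, v, b, i', i⟩))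
  · exact h1 _ hk u i q

/-- The coordinates of `fill` as coordinates of a representation together with a square matrix. -/
def fillVar (β : Q → ℕ) (l j : Q) (c : Coord β) : FillCoord β j :=
  if h : (c.1 = l ∨ c.2.1 = l) ∧ (c.2.2.2.1 : ℕ) < β j ∧ (c.2.2.2.2 : ℕ) < β j then
    Sum.inl (⟨c.2.2.2.1, h.2.1⟩, ⟨c.2.2.2.2, h.2.2⟩) else Sum.inr c

/-- The matrix positions of X are used by one arrow only, since exactly one arrow touches l. -/
theorem SlicePair.fillVar_injective (h : SlicePair l j) : Function.Injective (fillVar β l j) := by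
  intro c c' hc
  simp only [fillVar] at hc
  split_ifs at hc with h1 h2
  · simp only [Sum.inl.injEq, Prod.mk.injEq, Fin.mk.injEq] at hc
    obtain ⟨u, v, b, p, q⟩ := c
    obtain ⟨u', v', b', p', q'⟩ := c'
    have h3 := h.total_eq b b' h1.1 h2.1
    simp only [Quiver.Total.mk.injEq] at h3
    obtain ⟨rfl, rfl, h3⟩ := h3
    obtain rfl := eq_of_heq h3
    obtain rfl := Fin.ext hc.1
    obtain rfl := Fin.ext hc.2
    rfl
  · exact Sum.inr.inj hc

theorem SlicePair.eval_rename_fillVar (h : SlicePair l j) (hle : β l ≤ β j)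
    (f : MvPolynomial (Coord β) ℂ) (z : FillCoord β j → ℂ) :
    eval z (rename (fillVar β l j) f) =
      evalAt f (fill l j (fillMatrix z) (repOf (z ∘ Sum.inr))) := by
  rw [eval_rename, evalAt_eq]
  congr 2
  funext c
  obtain ⟨u, v, b, p, q⟩ := c
  simp only [coordOf, Function.comp_apply]
  by_cases hb : u = l ∨ v = l
  · rw [h.fill_apply hle _ _ _ hb, fillVar, dif_pos ⟨hb, h.lt hle b hb p q⟩]
    rfl
  · rw [fill_apply_of_ne _ _ _ hb, fillVar, dif_neg fun h => hb h.1]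
    rfl

/-- The coordinates of a representation, together with the identity matrix. -/
def onePoint (j : Q) (W : Rep ℂ β) : FillCoord β j → ℂ :=
  Sum.elim (fun pq => if pq.1 = pq.2 then 1 else 0) (coordOf W)

/-- The specialization of the square matrix to the identity. -/
def specialize (β : Q → ℕ) (j : Q) : MvPolynomial (FillCoord β j) ℂ →ₐ[ℂ] MvPolynomial (Coord β) ℂ :=
  aeval (Sum.elim (fun pq => C (if pq.1 = pq.2 then 1 else 0)) X)

theorem evalAt_specialize (P : MvPolynomial (FillCoord β j) ℂ) (W : Rep ℂ β) :
    evalAt (specialize β j P) W = eval (onePoint j W) P := by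
  rw [evalAt_eq, specialize, ← coe_aeval_eq_eval, ← coe_aeval_eq_eval, RingHom.coe_coe,
    RingHom.coe_coe, ← AlgHom.comp_apply, comp_aeval]
  congr 2
  funext c
  rcases c with c | c <;> simp [onePoint]

theorem fillMatrix_onePoint (W : Rep ℂ β) : fillMatrix (onePoint j W) = 1 := by
  ext p q
  rw [Matrix.one_apply]
  rfl

theorem eval_fillDet_onePoint (W : Rep ℂ β) : eval (onePoint j W) (fillDet β j) = 1 := by
  rw [eval_fillDet, fillMatrix_onePoint, Matrix.det_one]

theorem specialize_fillDet : specialize β j (fillDet β j) = 1 :=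
  evalAt_ext fun W => by
    rw [evalAt_specialize, eval_fillDet_onePoint]
    simp [evalAt]

/-- The pull-back of a polynomial on the slice to the matrices `X` and representations `W`,
`det X` being inverted. -/
theorem exists_pullback {k : ℤ} (hk : k = 1 ∨ k = -1) (hle : β l ≤ β j)
    (g : MvPolynomial (Coord (sliceBeta β l j)) ℂ) :
    ∃ (N : ℕ) (P : MvPolynomial (FillCoord β j) ℂ),
      (∀ z, eval z (fillDet β j) ≠ 0 → eval z P = eval z (fillDet β j) ^ N *
        evalAt g (sliceRep hle (act (Function.update 1 j (fillGL z ^ k)⁻¹)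
          (repOf (z ∘ Sum.inr))))) ∧ specialize β j P = rename (sliceCoord hle) g := by
  have h1 := RegularOn.eval (fun c => regularOn_act (β := β) (j := j) hk (sliceCoord hle c)) g
  obtain ⟨N, P, h1⟩ := h1
  refine ⟨N, P, h1, evalAt_ext fun W => ?_⟩
  have h2 := eval_fillDet_onePoint (j := j) W
  rw [evalAt_specialize, h1 _ (h2 ▸ one_ne_zero), h2, one_pow, one_mul]
  have h3 : fillGL (onePoint j W) = 1 :=
    Units.ext ((fillGL_val (h2 ▸ one_ne_zero)).trans (fillMatrix_onePoint W))
  beta_reduce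
  rw [h3, one_zpow, inv_one, show Function.update (1 : ∀ x, GL (Fin (β x)) ℂ) j 1 = 1 from
    Function.update_eq_self j 1, evalAt_rename]
  have h4 : act 1 W = W := by
    funext u v b
    simp [act]
  change _ = evalAt g (sliceRep hle W)
  conv_rhs => rw [← h4]
  rfl

/-- The generic determinant is a non-zero polynomial, since it specialises to 1, so polynomial
identities may be checked where it does not vanish. -/
theorem eq_zero_of_fillDet {P : MvPolynomial (FillCoord β j) ℂ}
    (h : ∀ z, eval z (fillDet β j) ≠ 0 → eval z P = 0) : P = 0 := by
  have h1 : fillDet β j * P = 0 := MvPolynomial.funext fun z => by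
    rw [map_mul, map_zero]
    by_cases hz : eval z (fillDet β j) = 0
    · rw [hz, zero_mul]
    · rw [h z hz, mul_zero]
  refine (mul_eq_zero.1 h1).resolve_left fun h0 => ?_
  have h2 := specialize_fillDet (β := β) (j := j)
  rw [h0, map_zero] at h2
  exact zero_ne_one h2

variable {hle : β l ≤ β j} {f : MvPolynomial (Coord β) ℂ}
  {fa : MvPolynomial (Coord (sliceBeta β l j)) ℂ} {σ : Q → ℤ}

/-- On the open set of all `X` with `det X ≠ 0`, the function `f` is the induced function on the
slice, up to a power of `det X`. -/
theorem SlicePair.exists_eval_eq (h : SlicePair l j) (hlj : l ≠ j) (hfa : IsInduced hle f fa)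
    (hσ : IsSemiInvariant f σ) : ∃ (k : ℤ) (A B : ℕ), (k = 1 ∨ k = -1) ∧
      ∀ z, eval z (fillDet β j) ≠ 0 →
        eval z (fillDet β j) ^ A * eval z (rename (fillVar β l j) f) =
        eval z (fillDet β j) ^ B * evalAt fa (sliceRep hle
          (act (Function.update 1 j (fillGL z ^ k)⁻¹) (repOf (z ∘ Sum.inr)))) := by
  obtain ⟨k, hk, h1⟩ := h.exists_baseChange hlj hle
  -- The base change contributes det(X)^(-kσ_j). Putting the positive and negative parts of the
  -- exponent on opposite sides avoids denominators.
  refine ⟨k, (k * σ j).toNat, (-(k * σ j)).toNat, hk, fun z hz => ?_⟩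
  rw [h.eval_rename_fillVar hle, ← fillGL_val hz, h1, hσ, prod_det_update_one,
    h.evalAt_sliceRep hfa, ← mul_assoc]
  congr 1
  have h2 : (fillGL z ^ k).val.det = eval z (fillDet β j) ^ k := by
    rw [eval_fillDet, ← fillGL_val hz]
    obtain rfl | rfl := hk
    · simp
    · rw [zpow_neg_one, zpow_neg_one, Matrix.coe_units_inv, Matrix.det_nonsing_inv,
        Ring.inverse_eq_inv']
  rw [h2, ← zpow_mul, ← zpow_natCast, ← zpow_natCast, ← zpow_neg, ← zpow_add₀ hz]
  congr 1
  omega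

theorem SlicePair.induced_ne_zero (h : SlicePair l j) (hlj : l ≠ j) (hfa : IsInduced hle f fa)
    (hσ : IsSemiInvariant f σ) (hf : f ≠ 0) : fa ≠ 0 := by
  rintro rfl
  obtain ⟨k, A, B, hk, h1⟩ := h.exists_eval_eq hlj hfa hσ
  refine hf (rename_injective _ h.fillVar_injective ?_)
  rw [map_zero]
  refine eq_zero_of_fillDet fun z hz => ?_
  have h2 := h1 z hz
  simp only [evalAt, map_zero, mul_zero, mul_eq_zero] at h2
  exact h2.resolve_left (pow_ne_zero _ hz)

theorem isUnit_of_rename {ι τ : Type} [Finite ι] [Finite τ] {φ : ι → τ} (hφ : Function.Injective φ)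
    {f : MvPolynomial ι ℂ} (hf : IsUnit (rename φ f)) : IsUnit f := by
  obtain ⟨c, hc, h⟩ := isUnit_iff_exists_C.1 hf
  rw [← rename_C φ c] at h
  exact isUnit_iff_exists_C.2 ⟨c, hc, rename_injective φ hφ h⟩

/-- The function induced on a slice by an irreducible semi-invariant is irreducible or
constant. -/
theorem SlicePair.irreducible (h : SlicePair l j) (hlj : l ≠ j) (hfa : IsInduced hle f fa)
    (hσ : IsSemiInvariant f σ) (hf : Irreducible f) (hu : ¬IsUnit fa) : Irreducible fa := by
  obtain ⟨k, A, B, hk, h1⟩ := h.exists_eval_eq hlj hfa hσ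
  have hp : Prime (rename (fillVar β l j) f) := prime_rename h.fillVar_injective hf.prime
  have h0 : rename (sliceCoord hle) fa ≠ 0 := fun h2 => h.induced_ne_zero hlj hfa hσ hf.ne_zero
    (rename_injective _ (sliceCoord_injective hlj hle) (h2.trans (map_zero _).symm))
  have hs : specialize β j (rename (fillVar β l j) f) = rename (sliceCoord hle) fa :=
    evalAt_ext fun W => by
      rw [evalAt_specialize, h.eval_rename_fillVar hle, fillMatrix_onePoint, hfa,
        h.evalAt_restrictAt hle]
      rfl
  refine ⟨hu, fun g₁ g₂ hg => ?_⟩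
  obtain ⟨N₁, P₁, h3, h4⟩ := exists_pullback hk hle g₁
  obtain ⟨N₂, P₂, h5, h6⟩ := exists_pullback hk hle g₂
  -- A factorisation of the slice function lifts to one of `f` in the enlarged polynomial ring, up
  -- to powers of the determinant, and there `f` is prime.
  have h7 : fillDet β j ^ (A + N₁ + N₂) * rename (fillVar β l j) f =
      fillDet β j ^ B * (P₁ * P₂) := by
    rw [← sub_eq_zero]
    refine eq_zero_of_fillDet fun z hz => ?_
    have h8 := h1 z hz
    rw [hg] at h8
    simp only [evalAt, map_mul] at h8
    simp only [map_sub, map_mul, map_pow]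
    rw [h3 z hz, h5 z hz, pow_add, pow_add]
    simp only [evalAt] at h8 ⊢
    linear_combination (eval z (fillDet β j) ^ N₁ * eval z (fillDet β j) ^ N₂) * h8
  -- Setting X to the identity turns divisibility of `P₁` by `f` into divisibility of `g₁` by `fa =
  -- g₁ g₂`, so `g₂` is a unit.
  have hmain : ∀ {g₁ g₂ : MvPolynomial (Coord (sliceBeta β l j)) ℂ} {P₁}, fa = g₁ * g₂ →
      specialize β j P₁ = rename (sliceCoord hle) g₁ →
      rename (fillVar β l j) f ∣ P₁ → IsUnit g₂ := by
    rintro g₁ g₂ P₁ hg h4 ⟨R, rfl⟩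
    rw [map_mul, hs, hg, map_mul] at h4
    rw [hg, map_mul] at h0
    refine isUnit_of_rename (sliceCoord_injective hlj hle) (IsUnit.of_mul_eq_one
      (specialize β j R) (mul_left_cancel₀ (left_ne_zero_of_mul h0) ?_))
    rw [mul_one, ← mul_assoc, h4]
  have h8 : rename (fillVar β l j) f ∣ fillDet β j ^ B * (P₁ * P₂) := ⟨_, by rw [← h7, mul_comm]⟩
  rcases hp.dvd_or_dvd h8 with h9 | h9
  -- If `f` divided a power of det X, then at X = 1 the function `fa` would divide 1.
  · obtain ⟨R, hR⟩ := h9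
    have h10 := congrArg (specialize β j) hR
    rw [map_pow, specialize_fillDet, one_pow, map_mul, hs] at h10
    exact absurd (isUnit_of_rename (sliceCoord_injective hlj hle)
      (IsUnit.of_mul_eq_one _ h10.symm)) hu
  · rcases hp.dvd_or_dvd h9 with h10 | h10
    · exact Or.inr (hmain hg h4 h10)
    · exact Or.inl (hmain (hg.trans (mul_comm _ _)) h6 h10)

end BaseChange

end QuiverSlice

namespace QuiverSlice

/-! ### The Euler form at the free vertex, and constant slices. -/

section Pendant

variable {Q : Type} [Fintype Q] [DecidableEq Q] [Quiver.{0} Q] [∀ x y : Q, Finite (x ⟶ y)]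
  {l j : Q}

theorem card_hom_of_source (hlj : l ≠ j) (h : ∃ a : l ⟶ j, IsOneSource a) (x : Q) :
    Nat.card (x ⟶ l) = 0 ∧ Nat.card (l ⟶ x) = if x = j then 1 else 0 := by
  obtain ⟨a, ha⟩ := h
  constructor
  · have : IsEmpty (x ⟶ l) := ⟨fun b => by
      have := ha x l b (Or.inr rfl)
      simp only [Quiver.Total.mk.injEq] at this
      exact hlj this.2.1⟩
    exact Nat.card_of_isEmpty
  · split_ifs with hx
    · subst hx
      rw [Nat.card_eq_one_iff_unique]
      refine ⟨⟨fun b c => ?_⟩, ⟨a⟩⟩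
      have := (ha l x b (Or.inl rfl)).trans (ha l x c (Or.inl rfl)).symm
      simpa using this
    · have : IsEmpty (l ⟶ x) := ⟨fun b => by
        have := ha l x b (Or.inl rfl)
        simp only [Quiver.Total.mk.injEq] at this
        exact hx this.2.1⟩
      exact Nat.card_of_isEmpty

theorem card_hom_of_sink (hlj : l ≠ j) (h : ∃ a : j ⟶ l, IsOneSink a) (x : Q) :
    Nat.card (l ⟶ x) = 0 ∧ Nat.card (x ⟶ l) = if x = j then 1 else 0 := by
  obtain ⟨a, ha⟩ := h
  constructor
  · have : IsEmpty (l ⟶ x) := ⟨fun b => by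
      have := ha l x b (Or.inl rfl)
      simp only [Quiver.Total.mk.injEq] at this
      exact hlj this.1⟩
    exact Nat.card_of_isEmpty
  · split_ifs with hx
    · subst hx
      rw [Nat.card_eq_one_iff_unique]
      refine ⟨⟨fun b c => ?_⟩, ⟨a⟩⟩
      have := (ha x l b (Or.inr rfl)).trans (ha x l c (Or.inr rfl)).symm
      simpa using this
    · have : IsEmpty (x ⟶ l) := ⟨fun b => by
        have := ha x l b (Or.inr rfl)
        simp only [Quiver.Total.mk.injEq] at this
        exact hx this.1⟩
      exact Nat.card_of_isEmpty

theorem leftWeight_of_source (hlj : l ≠ j) (h : ∃ a : l ⟶ j, IsOneSource a) (γ : Q → ℤ) :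
    leftWeight γ l = γ l := by
  simp [leftWeight_apply, fun x => (card_hom_of_source hlj h x).1]

theorem rightWeight_of_source (hlj : l ≠ j) (h : ∃ a : l ⟶ j, IsOneSource a) (γ : Q → ℤ) :
    rightWeight γ l = γ j - γ l := by
  simp [rightWeight_apply, fun x => (card_hom_of_source hlj h x).2]

theorem leftWeight_of_sink (hlj : l ≠ j) (h : ∃ a : j ⟶ l, IsOneSink a) (γ : Q → ℤ) :
    leftWeight γ l = γ l - γ j := by
  simp [leftWeight_apply, fun x => (card_hom_of_sink hlj h x).2]

theorem rightWeight_of_sink (hlj : l ≠ j) (h : ∃ a : j ⟶ l, IsOneSink a) (γ : Q → ℤ) :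
    rightWeight γ l = -γ l := by
  simp [rightWeight_apply, fun x => (card_hom_of_sink hlj h x).1]

/-- These are the weights supported on l and j that become trivial on the slice. They come from
multiples of the basis vector at l, on the left for a source and on the right for a sink. -/
theorem leftWeight_single_of_source (hlj : l ≠ j) (h : ∃ a : l ⟶ j, IsOneSource a) (m : ℤ) :
    leftWeight (Pi.single l m) = fun x => (if x = l then m else 0) - if x = j then m else 0 := by
  funext x
  rw [leftWeight_apply, Finset.sum_eq_single l, (card_hom_of_source hlj h x).2]
  · simp [Pi.single_apply]
  · intro y _ hy
    simp [hy]
  · simp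

theorem rightWeight_single_of_sink (hlj : l ≠ j) (h : ∃ a : j ⟶ l, IsOneSink a) (m : ℤ) :
    rightWeight (Pi.single l m) = fun x => (if x = j then m else 0) - if x = l then m else 0 := by
  funext x
  rw [rightWeight_apply, Finset.sum_eq_single l, (card_hom_of_sink hlj h x).2]
  · simp [Pi.single_apply]
  · intro y _ hy
    simp [hy]
  · simp

theorem euler_single_self_of_slicePair (hlj : l ≠ j) (h : SlicePair l j) (m : ℤ) :
    euler (Pi.single l m) (Pi.single l m) = m * m := by
  rw [show (Pi.single l m : Q → ℤ) = m • Pi.single l 1 by rw [← Pi.single_smul, smul_eq_mul, mul_one],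
    euler_smul_left, euler_smul_right, euler_single_right]
  rcases h with h | h
  · rw [leftWeight_of_source hlj h]; simp
  · rw [leftWeight_of_sink hlj h]; simp [hlj.symm]

variable {α β ν : Q → ℕ} {f : MvPolynomial (Coord β) ℂ} {V : Rep ℂ α} {N : Rep ℂ ν}
  {hle : β l ≤ β j} {fa : MvPolynomial (Coord (sliceBeta β l j)) ℂ}

theorem sliceBeta_ne_zero (u : SliceVertex β l j) : sliceBeta β l j u ≠ 0 := u.2

/-- If the induced function on a slice is constant, then the Tits form is positive. -/
theorem Represents.euler_pos_of_isUnit (hQ : Acyclic Q) (hβ : ∀ x, β x ≠ 0) (hf : Irreducible f)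
    (hV : Represents f V) (h : SlicePair l j) (hfa : IsInduced hle f fa) (hu : IsUnit fa) :
    0 < euler (toInt α) (toInt α) := by
  have hlj := h.ne hQ
  obtain ⟨c, hc, rfl⟩ := isUnit_iff_exists_C.1 hu
  have h1 : ScalarWeight (C c : MvPolynomial (Coord (sliceBeta β l j)) ℂ) 0 :=
    fun t W => by simp [evalAt]
  have h2 := (h.scalarWeight hlj (hβ l) hfa hV.isSemiInvariant).unique sliceBeta_ne_zero
    hu.ne_zero h1
  -- A constant has weight zero, so the weight of `f` vanishes away from l and j, and its values at
  -- l and j are opposite. The vertex j is left out because the slice may have dropped it.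
  have h3 : ∀ x, x ≠ j → leftWeight (toInt α) x +
      (if x = l then leftWeight (toInt α) j else 0) = 0 := fun x hx =>
    congrFun h2 ⟨x, by simpa [sliceDim, hx] using hβ x⟩
  have h4 := h3 l hlj
  rw [if_pos rfl] at h4
  have h5 : leftWeight (toInt α) = fun x => (if x = l then leftWeight (toInt α) l else 0) -
      if x = j then leftWeight (toInt α) l else 0 := by
    funext x
    by_cases hx : x = j
    · subst hx
      rw [if_neg hlj.symm, if_pos rfl]
      omega
    · rw [if_neg hx]
      have := h3 x hx
      split_ifs at this ⊢ with hxl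
      · subst hxl; simp
      · omega
  have h6 := leftWeight_ne_zero hQ hf.not_isUnit hV.ne_zero_iff
  have h7 : leftWeight (toInt α) l ≠ 0 := by
    intro h0
    refine h6 ?_
    rw [h5, h0]
    funext x
    simp
  -- At a source α is a multiple of the basis vector at l; at a sink its dual is. In either case the
  -- Tits form is the square of the weight at l.
  have h8 : euler (toInt α) (toInt α) = leftWeight (toInt α) l * leftWeight (toInt α) l := by
    rcases id h with hs | hs
    · rw [← leftWeight_single_of_source hlj hs] at h5
      conv_lhs => rw [leftWeight_injective hQ h5]
      exact euler_single_self_of_slicePair hlj h _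
    · have h9 : leftWeight (toInt α) = rightWeight (Pi.single l (-leftWeight (toInt α) l)) := by
        rw [rightWeight_single_of_sink hlj hs]
        refine h5.trans (funext fun x => ?_)
        split_ifs <;> ring
      rw [← euler_self_eq_of_dual ((leftWeight_eq_rightWeight_iff _ _).1 h9),
        euler_single_self_of_slicePair hlj h]
      ring
  rw [h8]
  exact mul_self_pos.2 h7

end Pendant

/-! ### The case β_l = β_j: factoring out the determinant of the removed arrow. -/

section Square

variable {Q : Type} [Fintype Q] [DecidableEq Q] [Quiver.{0} Q] [∀ x y : Q, Finite (x ⟶ y)]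
  {l j : Q} {α β ν : Q → ℕ} {f : MvPolynomial (Coord β) ℂ} {V : Rep ℂ α} {N : Rep ℂ ν}
  {hle : β l ≤ β j} {fa : MvPolynomial (Coord (sliceBeta β l j)) ℂ}

/-- The matrix at the arrow is square. Where its determinant D is non-zero, a base change at l
brings it to the identity and multiplies `f` by a power of D, with exponent the weight at l up to
sign. D is not constant, being 0 at the zero representation and 1 at the identity. -/
theorem SlicePair.exists_det (h : SlicePair l j) (hlj : l ≠ j) (hl : β l ≠ 0) (heq : β l = β j)
    {σ : Q → ℤ} (hσ : IsSemiInvariant f σ) : ∃ D : MvPolynomial (Coord β) ℂ, D ≠ 0 ∧ ¬IsUnit D ∧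
      ∃ k : ℤ, (((∃ a : l ⟶ j, IsOneSource a) ∧ k = σ l) ∨
        ((∃ a : j ⟶ l, IsOneSink a) ∧ k = -σ l)) ∧
      ∀ W, evalAt D W ≠ 0 → evalAt f W = evalAt D W ^ k * evalAt (restrictAt l f) W := by
  have hle : β l ≤ β j := heq.le
  obtain ⟨a, ha⟩ | ⟨a, ha⟩ := id h
  · let D : MvPolynomial (Coord β) ℂ := (Matrix.of fun p q : Fin (β l) =>
      X ⟨l, j, a, Fin.cast heq p, q⟩ : Matrix (Fin (β l)) (Fin (β l)) _).det
    let M : Rep ℂ β → Matrix (Fin (β l)) (Fin (β l)) ℂ := fun W =>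
      (W l j a).submatrix (Fin.cast heq) id
    have hD : ∀ W, evalAt D W = (M W).det := by
      intro W
      rw [evalAt_eq, RingHom.map_det]
      congr 1
      ext p q
      simp [M, coordOf]
    refine ⟨D, ?_, ?_, σ l, Or.inl ⟨⟨a, ha⟩, rfl⟩, ?_⟩
    · intro h0
      have h1 := hD (fill l j 1 0)
      have h2 : M (fill l j 1 0) = 1 := by
        ext p q
        simp only [M, Matrix.submatrix_apply]
        rw [h.fill_one_apply hle _ _ (Or.inl rfl), Matrix.one_apply]
        simp [Fin.ext_iff]
      rw [h0, h2, Matrix.det_one] at h1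
      simp [evalAt] at h1
    · intro hu
      obtain ⟨c, hc, hDc⟩ := isUnit_iff_exists_C.1 hu
      have h1 := hD 0
      have : Nonempty (Fin (β l)) := Fin.pos_iff_nonempty.1 (by omega)
      rw [hDc, show M 0 = 0 from rfl, Matrix.det_zero] at h1
      exact hc (by simpa [evalAt] using h1)
    · intro W hW
      rw [hD] at hW
      let G : GL (Fin (β l)) ℂ := Matrix.GeneralLinearGroup.mkOfDetNeZero (M W) hW
      have h1 : W = act (Function.update 1 l G⁻¹) (fill l j 1 W) := by
        funext u v b
        rw [act_update_one_apply, inv_inv]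
        by_cases hb : u = l ∨ v = l
        · have hab := ha u v b hb
          simp only [Quiver.Total.mk.injEq] at hab
          obtain ⟨rfl, rfl, hab⟩ := hab
          obtain rfl := eq_of_heq hab
          rw [Function.update_of_ne hlj.symm, Pi.one_apply, Units.val_one, Matrix.one_mul,
            Function.update_self]
          ext p q
          rw [Matrix.mul_apply, Finset.sum_eq_single (Fin.cast heq.symm p)]
          · rw [h.fill_one_apply hle _ _ hb, if_pos (by simp), one_mul]
            simp [G, M, Matrix.GeneralLinearGroup.mkOfDetNeZero]
          · intro i _ hi
            rw [h.fill_one_apply hle _ _ hb, if_neg, zero_mul]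
            exact fun h => hi (Fin.ext h.symm)
          · simp
        · rw [fill_apply_of_ne _ _ _ hb]
          push Not at hb
          rw [Function.update_of_ne hb.1, Function.update_of_ne hb.2]
          simp
      conv_lhs => rw [h1, hσ, prod_det_update_one, ← h.evalAt_restrictAt hle]
      congr 1
      rw [Matrix.coe_units_inv, Matrix.det_nonsing_inv, Ring.inverse_eq_inv', inv_zpow, inv_inv, hD]
      rfl
  · let D : MvPolynomial (Coord β) ℂ := (Matrix.of fun p q : Fin (β l) =>
      X ⟨j, l, a, p, Fin.cast heq q⟩ : Matrix (Fin (β l)) (Fin (β l)) _).det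
    let M : Rep ℂ β → Matrix (Fin (β l)) (Fin (β l)) ℂ := fun W =>
      (W j l a).submatrix id (Fin.cast heq)
    have hD : ∀ W, evalAt D W = (M W).det := by
      intro W
      rw [evalAt_eq, RingHom.map_det]
      congr 1
      ext p q
      simp [M, coordOf]
    refine ⟨D, ?_, ?_, -σ l, Or.inr ⟨⟨a, ha⟩, rfl⟩, ?_⟩
    · intro h0
      have h1 := hD (fill l j 1 0)
      have h2 : M (fill l j 1 0) = 1 := by
        ext p q
        simp only [M, Matrix.submatrix_apply]
        rw [h.fill_one_apply hle _ _ (Or.inr rfl), Matrix.one_apply]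
        simp [Fin.ext_iff]
      rw [h0, h2, Matrix.det_one] at h1
      simp [evalAt] at h1
    · intro hu
      obtain ⟨c, hc, hDc⟩ := isUnit_iff_exists_C.1 hu
      have h1 := hD 0
      have : Nonempty (Fin (β l)) := Fin.pos_iff_nonempty.1 (by omega)
      rw [hDc, show M 0 = 0 from rfl, Matrix.det_zero] at h1
      exact hc (by simpa [evalAt] using h1)
    · intro W hW
      rw [hD] at hW
      let G : GL (Fin (β l)) ℂ := Matrix.GeneralLinearGroup.mkOfDetNeZero (M W) hW
      have h1 : W = act (Function.update 1 l G) (fill l j 1 W) := by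
        funext u v b
        rw [act_update_one_apply]
        by_cases hb : u = l ∨ v = l
        · have hab := ha u v b hb
          simp only [Quiver.Total.mk.injEq] at hab
          obtain ⟨rfl, rfl, hab⟩ := hab
          obtain rfl := eq_of_heq hab
          rw [Function.update_of_ne hlj.symm, Pi.one_apply, Units.val_one, Matrix.mul_one,
            Function.update_self]
          ext p q
          rw [Matrix.mul_apply, Finset.sum_eq_single (Fin.cast heq.symm q)]
          · rw [h.fill_one_apply hle _ _ hb, if_pos (by simp), mul_one]
            simp [G, M, Matrix.GeneralLinearGroup.mkOfDetNeZero]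
          · intro i _ hi
            rw [h.fill_one_apply hle _ _ hb, if_neg, mul_zero]
            exact fun h => hi (Fin.ext h)
          · simp
        · rw [fill_apply_of_ne _ _ _ hb]
          push Not at hb
          rw [Function.update_of_ne hb.1, Function.update_of_ne hb.2]
          simp
      conv_lhs => rw [h1, hσ, prod_det_update_one, ← h.evalAt_restrictAt hle]
      rw [zpow_neg, hD]
      rfl

/-- If `β_l = β_j` and the induced function is not constant, then `f` does not depend on the
arrow, and the weight of `f` vanishes at `l`. -/
theorem SlicePair.eq_restrictAt (h : SlicePair l j) (hlj : l ≠ j) (hl : β l ≠ 0)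
    (heq : β l = β j) (hfa : IsInduced hle f fa) (hf : Irreducible f) (hu : ¬IsUnit fa)
    (hV : Represents f V)
    (hν : ∀ η, euler (toInt α) η = -euler η (toInt ν)) :
    f = restrictAt l f ∧ (((∃ a : l ⟶ j, IsOneSource a) ∧ α l = 0) ∨
        ((∃ a : j ⟶ l, IsOneSink a) ∧ ν l = 0)) := by
  obtain ⟨D, hD0, hDu, k, hk, hD⟩ := h.exists_det hlj hl heq hV.isSemiInvariant
  -- The exponent is α_l at a source and ν_l at a sink, hence non-negative.
  have hm : ∃ m : ℕ, k = m ∧ (((∃ a : l ⟶ j, IsOneSource a) ∧ α l = m) ∨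
        ((∃ a : j ⟶ l, IsOneSink a) ∧ ν l = m)) := by
    rcases hk with ⟨hs, hk⟩ | ⟨hs, hk⟩
    · exact ⟨α l, hk.trans (leftWeight_of_source hlj hs _), Or.inl ⟨hs, rfl⟩⟩
    · refine ⟨ν l, ?_, Or.inr ⟨hs, rfl⟩⟩
      rw [hk, (leftWeight_eq_rightWeight_iff _ _).2 hν, rightWeight_of_sink hlj hs, neg_neg]
      rfl
  obtain ⟨m, rfl, hm⟩ := hm
  have h1 : f = D ^ m * restrictAt l f := by
    refine mul_left_cancel₀ hD0 (evalAt_ext fun W => ?_)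
    have h2 := hD W
    simp only [evalAt, map_mul, map_pow, zpow_natCast] at h2 ⊢
    by_cases hW : eval (fun c => W c.1 c.2.1 c.2.2.1 c.2.2.2.1 c.2.2.2.2) D = 0
    · rw [hW, zero_mul, zero_mul]
    · rw [h2 hW]
  rcases Nat.eq_zero_or_pos m with rfl | hm0
  · exact ⟨by simpa using h1, hm⟩
  -- With a positive exponent D divides the irreducible `f`; the cofactor is then a unit and the
  -- slice constant.
  · obtain ⟨n, rfl⟩ := Nat.exists_eq_succ_of_ne_zero hm0.ne'
    rw [pow_succ', mul_assoc] at h1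
    have h2 := (hf.isUnit_or_isUnit h1).resolve_left hDu
    have h3 := isUnit_of_mul_isUnit_right h2
    rw [← hfa] at h3
    exact absurd (isUnit_of_rename (sliceCoord_injective hlj hle) h3) hu

end Square

end QuiverSlice

namespace QuiverSlice

/-! ### The quiver of a slice with β_l = β_j: vertex j is dropped and l takes its place. -/

section FoldPull

variable {Q : Type} [Fintype Q] [DecidableEq Q] [Quiver.{0} Q] [∀ x y : Q, Finite (x ⟶ y)]
  {l j : Q} {β : Q → ℕ}

/-- The projection of the sliced quiver. -/
def sliceFold (β : Q → ℕ) (l j : Q) : SliceVertex β l j ⥤q Q where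
  obj u := fold l j u.1
  map b := b

theorem fold_ne (hlj : l ≠ j) (x : Q) : fold l j x ≠ l := by
  unfold fold
  split_ifs with h
  · exact hlj.symm
  · exact h

theorem ne_of_eq (heq : β l = β j) (u : SliceVertex β l j) : u.1 ≠ j := by
  intro h
  apply u.2
  simp [sliceDim, h, heq]

theorem fold_injective (heq : β l = β j) {u v : SliceVertex β l j}
    (h : fold l j u.1 = fold l j v.1) : u = v := by
  have hu := ne_of_eq heq u
  have hv := ne_of_eq heq v
  apply Subtype.ext
  unfold fold at h
  grind

theorem exists_fold_eq (hlj : l ≠ j) (hβ : ∀ x, β x ≠ 0) {x : Q} (hx : x ≠ l) :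
    ∃ u : SliceVertex β l j, fold l j u.1 = x := by
  by_cases hxj : x = j
  · exact ⟨freeVertex hlj (hβ l), by simp [fold, freeVertex, hxj]⟩
  · exact ⟨⟨x, by simpa [sliceDim, hxj] using hβ x⟩, if_neg hx⟩

variable {p q : Q → ℕ} {p' q' : SliceVertex β l j → ℕ}

/-- The restriction of a family of matrices to the slice. -/
def foldDom (ep : ∀ u, Fin (p' u) ≃ Fin (p (fold l j u.1)))
    (eq : ∀ u, Fin (q' u) ≃ Fin (q (fold l j u.1))) : Dom q p →ₗ[ℂ] Dom q' p' where
  toFun φ u := (φ (fold l j u.1)).submatrix (ep u) (eq u)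
  map_add' _ _ := rfl
  map_smul' _ _ := rfl

/-- The restriction of a family of matrices to the slice. -/
def foldCod (ep : ∀ u, Fin (p' u) ≃ Fin (p (fold l j u.1)))
    (eq : ∀ u, Fin (q' u) ≃ Fin (q (fold l j u.1))) : Cod q p →ₗ[ℂ] Cod q' p' where
  toFun φ u v b := (φ (fold l j u.1) (fold l j v.1) b).submatrix (ep v) (eq u)
  map_add' _ _ := rfl
  map_smul' _ _ := rfl

variable (ep : ∀ u, Fin (p' u) ≃ Fin (p (fold l j u.1)))
    (eq : ∀ u, Fin (q' u) ≃ Fin (q (fold l j u.1)))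

theorem submatrix_equiv_injective {m n m' n' : Type} (e : m' ≃ m) (e' : n' ≃ n)
    {A B : Matrix m n ℂ} (h : A.submatrix e e' = B.submatrix e e') : A = B := by
  ext i k
  simpa using congrFun (congrFun h (e.symm i)) (e'.symm k)

/-- Every vertex other than l is the image of exactly one slice vertex. The component at l is an
empty matrix by `h0`. -/
theorem foldDom_bijective (heq : β l = β j) (hlj : l ≠ j) (hβ : ∀ x, β x ≠ 0)
    (h0 : p l = 0 ∨ q l = 0) : Function.Bijective (foldDom ep eq) := by
  constructor
  · intro φ φ' h
    funext x
    by_cases hx : x = l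
    · subst hx
      ext i k
      have hi := i.2
      have hk := k.2
      omega
    · obtain ⟨u, rfl⟩ := exists_fold_eq hlj hβ hx
      exact submatrix_equiv_injective _ _ (congrFun h u)
  · let T : DomIdx q' p' → DomIdx q p := fun c => ⟨fold l j c.1.1, ep _ c.2.1, eq _ c.2.2⟩
    have hT : Function.Injective T := by
      rintro ⟨u, i, k⟩ ⟨u', i', k'⟩ h
      obtain rfl := fold_injective heq (congrArg (fun c : DomIdx q p => c.1) h)
      simp only [T, Sigma.mk.injEq, heq_eq_eq, true_and, Prod.mk.injEq,
        EmbeddingLike.apply_eq_iff_eq] at h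
      rw [h.1, h.2]
    intro φ'
    obtain ⟨c, hc⟩ := hT.surjective_comp_right (domEquiv _ _ φ')
    refine ⟨(domEquiv q p).symm c, (domEquiv _ _).injective ?_⟩
    rw [← hc]
    rfl

theorem foldCod_surjective (heq : β l = β j) : Function.Surjective (foldCod ep eq) := by
  let T : CodIdx q' p' → CodIdx q p :=
    fun c => ⟨fold l j c.1.1, fold l j c.2.1.1, c.2.2.1, ep _ c.2.2.2.1, eq _ c.2.2.2.2⟩
  have hT : Function.Injective T := by
    rintro ⟨u, v, b, i, k⟩ ⟨u', v', b', i', k'⟩ h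
    obtain rfl := fold_injective heq (congrArg (fun c : CodIdx q p => c.1) h)
    obtain rfl := fold_injective heq (congrArg (fun c : CodIdx q p => c.2.1) h)
    simp only [T, Sigma.mk.injEq, heq_eq_eq, true_and, Prod.mk.injEq,
      EmbeddingLike.apply_eq_iff_eq] at h
    obtain ⟨rfl, rfl, rfl⟩ := h
    rfl
  intro φ'
  obtain ⟨c, hc⟩ := hT.surjective_comp_right (codEquiv _ _ φ')
  refine ⟨(codEquiv q p).symm c, (codEquiv _ _).injective ?_⟩
  rw [← hc]
  rfl

/-- The removed arrow is the only one invisible on the slice; its component is empty because the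
dimension at its free end is zero. -/
theorem foldCod_injective (hlj : l ≠ j) (hβ : ∀ x, β x ≠ 0)
    (h0 : ((∃ a : l ⟶ j, IsOneSource a) ∧ q l = 0) ∨ ((∃ a : j ⟶ l, IsOneSink a) ∧ p l = 0)) :
    Function.Injective (foldCod ep eq) := by
  intro φ φ' h
  funext x y b
  by_cases hb : x = l ∨ y = l
  · ext i k
    have hi := i.2
    have hk := k.2
    rcases h0 with ⟨⟨a, ha⟩, h0⟩ | ⟨⟨a, ha⟩, h0⟩ <;>
    · have hab := ha x y b hb
      simp only [Quiver.Total.mk.injEq] at hab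
      obtain ⟨rfl, rfl, -⟩ := hab
      omega
  · push Not at hb
    obtain ⟨u, rfl⟩ := exists_fold_eq hlj hβ hb.1
    obtain ⟨v, rfl⟩ := exists_fold_eq hlj hβ hb.2
    exact submatrix_equiv_injective _ _ (congrFun (congrFun (congrFun h u) v) b)

theorem foldCod_dMap {r : Q → ℕ} {r' : SliceVertex β l j → ℕ}
    (er : ∀ u, Fin (r' u) ≃ Fin (r (fold l j u.1))) (V : Rep ℂ q) (W : Rep ℂ r) (φ : Dom q r) :
    dMap (foldCod eq eq V) (foldCod er er W) (foldDom er eq φ) = foldCod er eq (dMap V W φ) := by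
  funext u v b
  have h1 := Matrix.submatrix_mul_equiv (φ (fold l j v.1)) (V _ _ b) (er v) (eq v) (eq u)
  have h2 := Matrix.submatrix_mul_equiv (W (fold l j u.1) _ b) (φ (fold l j u.1)) (er v) (er u) (eq u)
  exact congrArg₂ (· - ·) h1 h2

variable {ep eq}

/-- `foldDom` as an equivalence. -/
def foldDomEquiv (heq : β l = β j) (hlj : l ≠ j) (hβ : ∀ x, β x ≠ 0) (h0 : p l = 0 ∨ q l = 0)
    (ep : ∀ u, Fin (p' u) ≃ Fin (p (fold l j u.1)))
    (eq : ∀ u, Fin (q' u) ≃ Fin (q (fold l j u.1))) : Dom q p ≃ₗ[ℂ] Dom q' p' :=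
  LinearEquiv.ofBijective _ (foldDom_bijective ep eq heq hlj hβ h0)

/-- `foldCod` as an equivalence. -/
def foldCodEquiv (heq : β l = β j) (hlj : l ≠ j) (hβ : ∀ x, β x ≠ 0)
    (h0 : ((∃ a : l ⟶ j, IsOneSource a) ∧ q l = 0) ∨ ((∃ a : j ⟶ l, IsOneSink a) ∧ p l = 0))
    (ep : ∀ u, Fin (p' u) ≃ Fin (p (fold l j u.1)))
    (eq : ∀ u, Fin (q' u) ≃ Fin (q (fold l j u.1))) : Cod q p ≃ₗ[ℂ] Cod q' p' :=
  LinearEquiv.ofBijective (foldCod ep eq)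
    ⟨foldCod_injective ep eq hlj hβ h0, foldCod_surjective ep eq heq⟩

/-- The pull-back of a dimension vector to the slice. -/
def foldVec (β : Q → ℕ) (l j : Q) (γ : Q → ℕ) : SliceVertex β l j → ℕ := fun u => γ (fold l j u.1)

/-- The identification of the dimensions of a pull-back. -/
def foldRefl (β : Q → ℕ) (l j : Q) (γ : Q → ℕ) (u : SliceVertex β l j) :
    Fin (foldVec β l j γ u) ≃ Fin (γ (fold l j u.1)) := Equiv.refl _

end FoldPull

/-! ### Non-constant slices with β_l = β_j have the same Tits form. -/

section Square

variable {Q : Type} [Fintype Q] [DecidableEq Q] [Quiver.{0} Q] [∀ x y : Q, Finite (x ⟶ y)]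
  {l j : Q} {α β ν : Q → ℕ} {f : MvPolynomial (Coord β) ℂ} {V : Rep ℂ α} {N : Rep ℂ ν}
  {hle : β l ≤ β j} {fa : MvPolynomial (Coord (sliceBeta β l j)) ℂ}

theorem sliceIdx_bijective (heq : β l = β j) (u : SliceVertex β l j) :
    Function.Bijective (sliceIdx heq.le u) := by
  have hu := ne_of_eq heq u
  rw [Fintype.bijective_iff_injective_and_card]
  constructor
  · intro i k h
    have h1 := congrArg Fin.val h
    simp only [sliceIdx, if_neg hu] at h1
    exact Fin.ext h1
  · simp only [Fintype.card_fin, sliceBeta, sliceDim, if_neg hu, fold]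
    split_ifs with h
    · rw [h, heq]
    · rfl

/-- The slice in the case `β_l = β_j`. -/
theorem SlicePair.exists_represents_of_eq (h : SlicePair l j) (hQ : Acyclic Q)
    (hβ : ∀ x, β x ≠ 0) (heq : β l = β j) (hfa : IsInduced hle f fa) (hf : Irreducible f)
    (hu : ¬IsUnit fa) (hV : Represents f V) :
    f = restrictAt l f ∧ Irreducible fa ∧
      ∃ (α' : SliceVertex β l j → ℕ) (V' : Rep ℂ α'), Represents fa V' ∧
        euler (toInt α') (toInt α') = euler (toInt α) (toInt α) := by
  have hlj := h.ne hQ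
  obtain ⟨ν, N, hN, hν, -⟩ := hV.exists_coRepresents hQ hβ hf
  obtain ⟨h1, h2⟩ := h.eq_restrictAt hlj (hβ l) heq hfa hf hu hV hν
  have hirr : Irreducible fa := by
    refine irreducible_of_rename (sliceCoord_injective hlj hle) ?_
    rw [hfa, ← h1]
    exact hf
  refine ⟨h1, hirr, ?_⟩
  let eb : ∀ u : SliceVertex β l j, Fin (sliceBeta β l j u) ≃ Fin (β (fold l j u.1)) :=
    fun u => Equiv.ofBijective _ (sliceIdx_bijective heq u)
  have hP : ∀ W, evalAt fa (foldCod eb eb W) = evalAt f W := by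
    intro W
    conv_rhs => rw [h1, ← hfa, evalAt_rename]
    rfl
  rcases h2 with ⟨hs, h2⟩ | ⟨hs, h2⟩
  · exact ⟨_, foldCod (foldRefl β l j α) (foldRefl β l j α) V,
      hV.transfer (foldCod eb eb) (foldCod_surjective eb eb heq) hP
        (foldDomEquiv heq hlj hβ (Or.inr h2) eb (foldRefl β l j α))
        (foldCodEquiv heq hlj hβ (Or.inl ⟨hs, h2⟩) eb (foldRefl β l j α))
        fun W φ => foldCod_dMap _ _ _ _ _,
      euler_eq_of_equiv
        (foldDomEquiv heq hlj hβ (Or.inr h2) (foldRefl β l j α) (foldRefl β l j α))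
        (foldCodEquiv heq hlj hβ (Or.inl ⟨hs, h2⟩) (foldRefl β l j α) (foldRefl β l j α))⟩
  · have h3 : CoRepresents fa (foldCod (foldRefl β l j ν) (foldRefl β l j ν) N) :=
      hN.transfer (foldCod eb eb) (foldCod_surjective eb eb heq) hP
        (foldDomEquiv heq hlj hβ (Or.inl h2) (foldRefl β l j ν) eb)
        (foldCodEquiv heq hlj hβ (Or.inr ⟨hs, h2⟩) (foldRefl β l j ν) eb)
        fun W φ => foldCod_dMap _ _ _ _ _
    obtain ⟨α', V', h4, h5⟩ := h3.exists_represents (hQ.of_prefunctor (sliceFold β l j))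
      sliceBeta_ne_zero hirr
    refine ⟨α', V', h4, ?_⟩
    rw [← euler_self_eq_of_dual h5, ← euler_self_eq_of_dual hν]
    exact euler_eq_of_equiv
      (foldDomEquiv heq hlj hβ (Or.inl h2) (foldRefl β l j ν) (foldRefl β l j ν))
      (foldCodEquiv heq hlj hβ (Or.inr ⟨hs, h2⟩) (foldRefl β l j ν) (foldRefl β l j ν))

end Square

end QuiverSlice

namespace QuiverSlice

/-! ### Representations of the sliced quiver as block decompositions. -/

section Block

variable {Q : Type} [Fintype Q] [DecidableEq Q] [Quiver.{0} Q] [∀ x y : Q, Finite (x ⟶ y)]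
  {l j : Q} {β : Q → ℕ}

/-- Projections which decompose the space of a representation at each vertex `x ≠ l` into pieces
indexed by the vertices of the sliced quiver over `x`. -/
def IsBlock (M : LinRep Q) (e : SliceVertex β l j → ∀ x, M.obj x →ₗ[ℂ] M.obj x) : Prop :=
  (∀ u v x, fold l j u.1 = x → fold l j v.1 = x → u ≠ v → ∀ m, e u x (e v x m) = 0) ∧
    ∀ x, x ≠ l → ∀ m, (∑ u : SliceVertex β l j, if fold l j u.1 = x then e u x m else 0) = m

variable {M N : LinRep Q} {e : SliceVertex β l j → ∀ x, M.obj x →ₗ[ℂ] M.obj x}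
  {e' : SliceVertex β l j → ∀ x, N.obj x →ₗ[ℂ] N.obj x}

theorem IsBlock.idem (he : IsBlock M e) (hlj : l ≠ j) (u : SliceVertex β l j)
    (m : M.obj (fold l j u.1)) : e u _ (e u _ m) = e u _ m := by
  conv_rhs => rw [← he.2 _ (fold_ne hlj u.1) m, map_sum]
  rw [Finset.sum_eq_single u]
  · rw [if_pos rfl]
  · intro v _ hv
    split_ifs with h
    · exact he.1 u v _ rfl h hv.symm m
    · exact map_zero _
  · simp

/-- The representation of the sliced quiver on the pieces of a decomposition. -/
@[reducible] def blockRep (M : LinRep Q) (e : SliceVertex β l j → ∀ x, M.obj x →ₗ[ℂ] M.obj x) :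
    LinRep (SliceVertex β l j) where
  obj u := LinearMap.range (e u (fold l j u.1))
  map {u v} b := (e v (fold l j v.1)).rangeRestrict ∘ₗ
    M.map (x := fold l j u.1) (y := fold l j v.1) b ∘ₗ
    (LinearMap.range (e u (fold l j u.1))).subtype

theorem IsBlock.ext (he : IsBlock M e) {x : Q} (hx : x ≠ l) {m n : M.obj x}
    (h : ∀ u : SliceVertex β l j, fold l j u.1 = x → e u x m = e u x n) : m = n := by
  rw [← he.2 x hx m, ← he.2 x hx n]
  refine Finset.sum_congr rfl fun u _ => ?_
  split_ifs with hu
  · exact h u hu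
  · rfl

theorem IsBlock.map_ext (he : IsBlock M e) {x : Q} (hx : x ≠ l) {E : Type} [AddCommGroup E]
    [Module ℂ E] {f g : M.obj x →ₗ[ℂ] E} (h : ∀ u : SliceVertex β l j, fold l j u.1 = x →
      ∀ m, f (e u x m) = g (e u x m)) (m : M.obj x) : f m = g m := by
  rw [← he.2 x hx m, map_sum, map_sum]
  refine Finset.sum_congr rfl fun u _ => ?_
  split_ifs with hu
  · exact h u hu m
  · simp

/-- The sum of a family of maps over the vertices of the sliced quiver above `x`. -/
def foldSum (F : ∀ u : SliceVertex β l j, M.obj (fold l j u.1) →ₗ[ℂ] N.obj (fold l j u.1)) (x : Q) :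
    M.obj x →ₗ[ℂ] N.obj x :=
  ∑ u, if h : fold l j u.1 = x then h ▸ F u else 0

theorem foldSum_apply
    (F : ∀ u : SliceVertex β l j, M.obj (fold l j u.1) →ₗ[ℂ] N.obj (fold l j u.1))
    (v : SliceVertex β l j) (m : M.obj (fold l j v.1)) :
    foldSum F (fold l j v.1) m = F v m + ∑ u ∈ Finset.univ.erase v,
      if h : fold l j u.1 = fold l j v.1 then
        (h ▸ F u : M.obj (fold l j v.1) →ₗ[ℂ] N.obj (fold l j v.1)) m else 0 := by
  have h1 : foldSum F (fold l j v.1) m = ∑ u, if h : fold l j u.1 = fold l j v.1 then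
        (h ▸ F u : M.obj (fold l j v.1) →ₗ[ℂ] N.obj (fold l j v.1)) m else 0 := by
    rw [foldSum, LinearMap.sum_apply]
    refine Finset.sum_congr rfl fun u _ => ?_
    split_ifs with h
    · rfl
    · rfl
  rw [h1, ← Finset.add_sum_erase _ _ (Finset.mem_univ v), dif_pos rfl]

/-- Arrows of the slice carry the blocks of the arrows of Q away from l. Morphisms between the
pieces therefore amount to maps at the vertices x ≠ l that commute with these arrows and with the
projections: restrict in one direction, sum over the pieces in the other. -/
theorem hom_blockRep_eq_bot_iff (hlj : l ≠ j) (he : IsBlock M e) (he' : IsBlock N e') :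
    LinRep.hom (blockRep M e) (blockRep N e') = ⊥ ↔
      ∀ Φ : ∀ x, M.obj x →ₗ[ℂ] N.obj x,
        (∀ {x y : Q} (b : x ⟶ y), x ≠ l → y ≠ l → ∀ m, Φ y (M.map b m) = N.map b (Φ x m)) →
        (∀ (u : SliceVertex β l j) m, e' u _ (Φ (fold l j u.1) m) = Φ _ (e u _ m)) →
        ∀ x, x ≠ l → ∀ m, Φ x m = 0 := by
  rw [LinRep.hom_eq_bot_iff]
  constructor
  · intro h Φ hΦ hb x hx m
    let ψ : ∀ u, (blockRep M e).obj u →ₗ[ℂ] (blockRep N e').obj u := fun u =>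
      (e' u _).rangeRestrict ∘ₗ Φ _ ∘ₗ (LinearMap.range (e u (fold l j u.1))).subtype
    have hψ : ψ ∈ LinRep.hom (blockRep M e) (blockRep N e') := by
      rw [LinRep.mem_hom]
      rintro u v b ⟨m, n, rfl⟩
      apply Subtype.ext
      change e' v _ (Φ _ (e v _ (M.map (x := fold l j u.1) (y := fold l j v.1) b (e u _ n)))) =
        e' v _ (N.map (x := fold l j u.1) (y := fold l j v.1) b (e' u _ (Φ _ (e u _ n))))
      rw [← hb, he'.idem hlj, hΦ _ (fold_ne hlj _) (fold_ne hlj _), hb u, he.idem hlj]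
    have h0 := h ψ hψ
    refine he.map_ext (g := 0) hx ?_ m
    rintro u rfl m
    have h1 := congrArg Subtype.val (h0 u ⟨e u _ m, m, rfl⟩)
    change e' u _ (Φ _ (e u _ m)) = 0 at h1
    rw [hb, he.idem hlj] at h1
    exact h1
  · rintro h ψ hψ v ⟨_, m, rfl⟩
    let F : ∀ u : SliceVertex β l j, M.obj (fold l j u.1) →ₗ[ℂ] N.obj (fold l j u.1) := fun u =>
      (LinearMap.range (e' u (fold l j u.1))).subtype ∘ₗ ψ u ∘ₗ (e u _).rangeRestrict
    have hF1 : ∀ u m, e' u _ (F u m) = F u m := by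
      intro u m
      obtain ⟨n, hn⟩ := (ψ u ((e u _).rangeRestrict m)).2
      change e' u _ (ψ u ((e u _).rangeRestrict m)).1 = (ψ u ((e u _).rangeRestrict m)).1
      rw [← hn, he'.idem hlj]
    have hF2 : ∀ u m, F u (e u _ m) = F u m := by
      intro u m
      change (ψ u _).1 = (ψ u _).1
      congr 2
      exact Subtype.ext (he.idem hlj u m)
    have hc1 : ∀ v m, e' v _ (foldSum F (fold l j v.1) m) = F v m := by
      intro v m
      rw [foldSum_apply, map_add, hF1, map_sum]
      refine (add_eq_left).2 (Finset.sum_eq_zero fun u hu => ?_)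
      split_ifs with h
      · have haux : ∀ (x : Q) (h : fold l j u.1 = x), fold l j v.1 = x → ∀ m : M.obj x,
            e' v x ((h ▸ F u : M.obj x →ₗ[ℂ] N.obj x) m) = 0 := by
          rintro x rfl hv m
          change e' v _ (F u m) = 0
          rw [← hF1]
          exact he'.1 v u _ hv rfl (Finset.ne_of_mem_erase hu).symm _
        exact haux _ h rfl m
      · exact map_zero _
    have hc2 : ∀ v m, foldSum F (fold l j v.1) (e v _ m) = F v m := by
      intro v m
      rw [foldSum_apply, hF2]
      refine (add_eq_left).2 (Finset.sum_eq_zero fun u hu => ?_)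
      split_ifs with h
      · have haux : ∀ (x : Q) (h : fold l j u.1 = x), fold l j v.1 = x → ∀ m : M.obj x,
            (h ▸ F u : M.obj x →ₗ[ℂ] N.obj x) (e v x m) = 0 := by
          rintro x rfl hv m
          change F u (e v _ m) = 0
          rw [← hF2, he.1 u v _ rfl hv (Finset.ne_of_mem_erase hu), map_zero]
        exact haux _ h rfl m
      · rfl
    have h1 := h (foldSum F) (by
      intro x y b hx hy m
      refine he.map_ext (f := foldSum F y ∘ₗ M.map b) (g := N.map b ∘ₗ foldSum F x) hx ?_ m
      rintro u rfl m
      refine he'.ext hy ?_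
      rintro v rfl
      simp only [LinearMap.comp_apply]
      rw [hc1, hc2]
      have h2 := congrArg Subtype.val
        (LinRep.mem_hom.1 hψ (x := u) (y := v) b ((e u _).rangeRestrict m))
      exact h2) (fun u m => (hc1 u m).trans (hc2 u m).symm) _ (fold_ne hlj v.1) (e v _ m)
    rw [hc2] at h1
    exact Subtype.ext h1

end Block

/-! ### The coordinate decomposition ℂ^{β_j} = ℂ^{β_l} ⊕ ℂ^{β_j - β_l}. -/

section CoordBlock

variable {Q : Type} [Fintype Q] [DecidableEq Q] [Quiver.{0} Q] [∀ x y : Q, Finite (x ⟶ y)]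
  {l j : Q} {β : Q → ℕ}

theorem sliceDim_ne_zero (hlt : β l < β j) (hβ : ∀ x, β x ≠ 0) (x : Q) : sliceDim β l j x ≠ 0 := by
  unfold sliceDim
  split_ifs
  · omega
  · exact hβ x

/-- All vertices survive in the sliced quiver if `β_l < β_j`. -/
def sliceVertexEquiv (hlt : β l < β j) (hβ : ∀ x, β x ≠ 0) : SliceVertex β l j ≃ Q :=
  Equiv.subtypeUnivEquiv (sliceDim_ne_zero hlt hβ)

theorem sum_sliceVertex {E : Type} [AddCommMonoid E] (hlt : β l < β j) (hβ : ∀ x, β x ≠ 0)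
    (g : Q → E) : ∑ u : SliceVertex β l j, g u.1 = ∑ x, g x :=
  Fintype.sum_equiv (sliceVertexEquiv hlt hβ) _ _ fun _ => rfl

/-- For β_l < β_j no vertex is dropped: above j lie l and j, above any other x ≠ l only x. -/
theorem sum_fold {E : Type} [AddCommMonoid E] (hlt : β l < β j) (hβ : ∀ x, β x ≠ 0) (hlj : l ≠ j)
    (g : Q → E) {x : Q} (hx : x ≠ l) :
    (∑ u : SliceVertex β l j, if fold l j u.1 = x then g u.1 else 0) =
      if x = j then g l + g j else g x := by
  rw [sum_sliceVertex hlt hβ fun y => if fold l j y = x then g y else 0]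
  split_ifs with hxj
  · subst hxj
    rw [← Finset.sum_pair hlj, ← Finset.sum_filter]
    refine Finset.sum_congr ?_ fun _ _ => rfl
    ext y
    unfold fold
    rw [Finset.mem_filter]
    grind
  · rw [Finset.sum_eq_single x]
    · exact if_pos (if_neg hx)
    · intro y _ hy
      refine if_neg ?_
      unfold fold
      grind
    · simp

/-- The coordinates at `x` which belong to the vertex `u` of the sliced quiver. -/
def InBlock (β : Q → ℕ) (l j u : Q) (i : ℕ) : Prop := (u = l → i < β l) ∧ (u = j → β l ≤ i)

/-- The predicate describes the range of `sliceIdx` by inequalities, without the dependent index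
type. -/
theorem inBlock_iff (hle : β l ≤ β j) (hlj : l ≠ j) (u : SliceVertex β l j)
    (i : Fin (β (fold l j u.1))) : InBlock β l j u.1 i ↔ i ∈ Set.range (sliceIdx hle u) := by
  have hb : sliceBeta β l j u = if u.1 = j then β j - β l else β u.1 := rfl
  have hf : β (fold l j u.1) = if u.1 = l then β j else β u.1 := by
    unfold fold
    split_ifs <;> rfl
  have hi := i.2
  constructor
  · rintro ⟨h1, h2⟩
    by_cases hj : u.1 = j
    · have hl : u.1 ≠ l := fun h => hlj (h.symm.trans hj)
      rw [if_pos hj] at hb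
      rw [if_neg hl, congrArg β hj] at hf
      have := h2 hj
      refine ⟨⟨i - β l, by omega⟩, Fin.ext ?_⟩
      simp only [sliceIdx, if_pos hj]
      omega
    · rw [if_neg hj] at hb
      refine ⟨⟨i, ?_⟩, Fin.ext ?_⟩
      · by_cases hl : u.1 = l
        · have := h1 hl
          rw [congrArg β hl] at hb
          omega
        · rw [if_neg hl] at hf
          omega
      · simp only [sliceIdx, if_neg hj]
  · rintro ⟨k, rfl⟩
    have hk := k.2
    constructor
    · intro hl
      have hj : u.1 ≠ j := fun h => hlj (hl.symm.trans h)
      rw [if_neg hj, congrArg β hl] at hb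
      simp only [sliceIdx, if_neg hj]
      omega
    · intro hj
      simp only [sliceIdx, if_pos hj]
      omega

open Classical in
/-- The projection onto the coordinates of a vertex of the sliced quiver. -/
def coordBlock (W : Rep ℂ β) (u : SliceVertex β l j) (x : Q) :
    (LinRep.ofRep W).obj x →ₗ[ℂ] (LinRep.ofRep W).obj x where
  toFun w i := if InBlock β l j u.1 i then w i else 0
  map_add' v w := by funext i; by_cases h : InBlock β l j u.1 i <;> simp [h]
  map_smul' c w := by funext i; by_cases h : InBlock β l j u.1 i <;> simp [h]

theorem coordBlock_apply_of (W : Rep ℂ β) (u : SliceVertex β l j) {x : Q}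
    (w : (LinRep.ofRep W).obj x) {i : Fin (β x)} (h : InBlock β l j u.1 i) :
    coordBlock W u x w i = w i := if_pos h

theorem coordBlock_apply_of_not (W : Rep ℂ β) (u : SliceVertex β l j) {x : Q}
    (w : (LinRep.ofRep W).obj x) {i : Fin (β x)} (h : ¬InBlock β l j u.1 i) :
    coordBlock W u x w i = 0 := if_neg h

theorem isBlock_coordBlock (hlt : β l < β j) (hβ : ∀ x, β x ≠ 0) (hlj : l ≠ j) (W : Rep ℂ β) :
    IsBlock (LinRep.ofRep W) (coordBlock (l := l) (j := j) W) := by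
  classical
  constructor
  · intro u v x hu hv huv m
    funext i
    by_cases h1 : InBlock β l j u.1 i
    · refine (coordBlock_apply_of W u _ h1).trans ?_
      by_cases h2 : InBlock β l j v.1 i
      · exfalso
        have h3 : u.1 ≠ v.1 := fun h => huv (Subtype.ext h)
        unfold InBlock at h1 h2
        unfold fold at hu hv
        grind
      · exact coordBlock_apply_of_not W v _ h2
    · exact coordBlock_apply_of_not W u _ h1
  · intro x hx m
    funext i
    have h1 : (∑ u : SliceVertex β l j, if fold l j u.1 = x then coordBlock W u x m else 0) i =
        ∑ u : SliceVertex β l j, if fold l j u.1 = x then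
          (fun y => if InBlock β l j y i then m i else 0) u.1 else 0 := by
      rw [Finset.sum_apply]
      refine Finset.sum_congr rfl fun u _ => ?_
      split_ifs
      · rfl
      · rfl
    refine h1.trans ((sum_fold hlt hβ hlj (fun y => if InBlock β l j y i then m i else 0) hx).trans ?_)
    unfold InBlock
    split_ifs <;> grind

/-- The pieces of a representation with respect to the coordinate projections form the restriction
of the representation to the slice. -/
theorem nonempty_iso_sliceRep (hle : β l ≤ β j) (hlj : l ≠ j) (W : Rep ℂ β) :
    Nonempty (LinRep.Iso (blockRep (LinRep.ofRep W) (coordBlock (l := l) (j := j) W))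
      (LinRep.ofRep (sliceRep hle W))) := by
  have hinj : ∀ u : SliceVertex β l j, Function.Injective (sliceIdx hle u) := by
    intro u i k h
    have h1 := congrArg Fin.val h
    simp only [sliceIdx] at h1
    exact Fin.ext (by grind)
  have hbij : ∀ u : SliceVertex β l j, Function.Bijective
      (LinearMap.funLeft ℂ ℂ (sliceIdx hle u) ∘ₗ
        (LinearMap.range (coordBlock W u (fold l j u.1))).subtype) := by
    intro u
    constructor
    · rw [← LinearMap.ker_eq_bot, LinearMap.ker_eq_bot']
      rintro ⟨_, w, rfl⟩ h
      apply Subtype.ext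
      funext i
      by_cases hi : InBlock β l j u.1 i
      · obtain ⟨k, rfl⟩ := (inBlock_iff hle hlj u i).1 hi
        exact congrFun h k
      · exact coordBlock_apply_of_not W u _ hi
    · intro c
      obtain ⟨w, hw⟩ := (hinj u).surjective_comp_right c
      refine ⟨⟨coordBlock W u _ w, w, rfl⟩, ?_⟩
      rw [← hw]
      funext k
      exact coordBlock_apply_of W u w ((inBlock_iff hle hlj u _).2 ⟨k, rfl⟩)
  refine ⟨⟨fun u => LinearEquiv.ofBijective _ (hbij u), ?_⟩⟩
  rintro u v b ⟨_, w, rfl⟩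
  funext p
  refine (coordBlock_apply_of W v _ ((inBlock_iff hle hlj v _).2 ⟨p, rfl⟩)).trans ?_
  change ∑ i, W _ _ b (sliceIdx hle v p) i * coordBlock W u _ w i =
    ∑ q, W _ _ b (sliceIdx hle v p) (sliceIdx hle u q) * coordBlock W u _ w (sliceIdx hle u q)
  refine (Fintype.sum_of_injective _ (hinj u) _ _ (fun i hi => ?_) fun q => rfl).symm
  rw [coordBlock_apply_of_not W u w fun h => hi ((inBlock_iff hle hlj u i).1 h), mul_zero]

end CoordBlock

end QuiverSlice

namespace QuiverSlice

/-! ### The representation of the sliced quiver attached to V. -/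

section Extension

variable {Q : Type} [Fintype Q] [DecidableEq Q] [Quiver.{0} Q] [∀ x y : Q, Finite (x ⟶ y)]
  {l j : Q} {β : Q → ℕ} {D : Type} [AddCommGroup D] [Module ℂ D] [FiniteDimensional ℂ D]

/-- The direct sum of a representation `M` with copies of the projective representation at `j`. -/
@[reducible] def extRep (hQ : Acyclic Q) (j : Q) (D : Type) [AddCommGroup D] [Module ℂ D]
    [FiniteDimensional ℂ D] (M : LinRep Q) : LinRep Q where
  obj x := M.obj x × (Quiver.Path j x →₀ D)
  finiteDimensional x := by
    have := hQ.finite_path j x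
    infer_instance
  map a := (M.map a).prodMap (Finsupp.lmapDomain D ℂ fun p => p.cons a)

/-- The map `π`, viewed as a map to the paths of length zero. -/
def atNil {M : LinRep Q} (π : M.obj j →ₗ[ℂ] D) (x : Q) : M.obj x →ₗ[ℂ] (Quiver.Path j x →₀ D) :=
  if h : j = x then h ▸ (Finsupp.lsingle (Quiver.Path.nil : Quiver.Path j j) ∘ₗ π) else 0

theorem atNil_self {M : LinRep Q} (π : M.obj j →ₗ[ℂ] D) (m : M.obj j) :
    atNil π j m = Finsupp.single .nil (π m) := by
  rw [atNil, dif_pos rfl]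
  rfl

/-- The projection onto the graph of `-π`. -/
def graphProj {M : LinRep Q} (π : M.obj j →ₗ[ℂ] D) (x : Q) :
    M.obj x × (Quiver.Path j x →₀ D) →ₗ[ℂ] M.obj x × (Quiver.Path j x →₀ D) :=
  (LinearMap.id.prod (-atNil π x)) ∘ₗ LinearMap.fst ℂ _ _

/-- The projection onto the second factor along the graph of `-π`. -/
def coGraphProj {M : LinRep Q} (π : M.obj j →ₗ[ℂ] D) (x : Q) :
    M.obj x × (Quiver.Path j x →₀ D) →ₗ[ℂ] M.obj x × (Quiver.Path j x →₀ D) :=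
  LinearMap.inr ℂ _ _ ∘ₗ (LinearMap.snd ℂ _ _ + atNil π x ∘ₗ LinearMap.fst ℂ _ _)

theorem graphProj_apply {M : LinRep Q} (π : M.obj j →ₗ[ℂ] D) (x : Q) (m : M.obj x)
    (s : Quiver.Path j x →₀ D) : graphProj π x (m, s) = (m, -atNil π x m) := rfl

theorem coGraphProj_apply {M : LinRep Q} (π : M.obj j →ₗ[ℂ] D) (x : Q) (m : M.obj x)
    (s : Quiver.Path j x →₀ D) : coGraphProj π x (m, s) = (0, s + atNil π x m) := rfl

/-- The decomposition of `extRep` over the vertices of the sliced quiver. -/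
def extBlock {M : LinRep Q} (π : M.obj j →ₗ[ℂ] D) (A B : Q) (u : SliceVertex β l j) (x : Q) :
    M.obj x × (Quiver.Path j x →₀ D) →ₗ[ℂ] M.obj x × (Quiver.Path j x →₀ D) :=
  if u.1 = A then graphProj π x else if u.1 = B then coGraphProj π x else LinearMap.id

/-- At j the space M(j) ⊕ D splits as the graph of -π plus the second summand. One piece is assigned
to `A`, the other to `B`. -/
theorem isBlock_extBlock (hQ : Acyclic Q) (hlt : β l < β j) (hβ : ∀ x, β x ≠ 0) (hlj : l ≠ j)
    {M : LinRep Q} (π : M.obj j →ₗ[ℂ] D) {A B : Q} (hAB : (A = l ∧ B = j) ∨ (A = j ∧ B = l)) :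
    IsBlock (extRep hQ j D M) (extBlock (β := β) (l := l) π A B) := by
  have h1 : ∀ x m, graphProj π x (coGraphProj π x m) = 0 := by
    rintro x ⟨m, s⟩
    rw [coGraphProj_apply, graphProj_apply, map_zero, neg_zero]
    rfl
  have h2 : ∀ x m, coGraphProj π x (graphProj π x m) = 0 := by
    rintro x ⟨m, s⟩
    rw [graphProj_apply, coGraphProj_apply, neg_add_cancel]
    rfl
  have h3 : ∀ x m, graphProj π x m + coGraphProj π x m = m := by
    rintro x ⟨m, s⟩
    rw [graphProj_apply, coGraphProj_apply, Prod.mk_add_mk, add_zero]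
    congr 1
    abel
  have hA : A ≠ B := by
    rcases hAB with ⟨rfl, rfl⟩ | ⟨rfl, rfl⟩
    · exact hlj
    · exact hlj.symm
  constructor
  · intro u v x hu hv huv m
    have h4 : u.1 ≠ v.1 := fun h => huv (Subtype.ext h)
    have h5 : (u.1 = A ∧ v.1 = B) ∨ (u.1 = B ∧ v.1 = A) := by
      unfold fold at hu hv
      grind
    rcases h5 with ⟨h5, h6⟩ | ⟨h5, h6⟩
    · simp only [extBlock, h5, h6, if_true, if_neg hA.symm, h1]
    · simp only [extBlock, h5, h6, if_true, if_neg hA.symm, h2]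
  · intro x hx m
    let g : Q → M.obj x × (Quiver.Path j x →₀ D) := fun y =>
      (if y = A then graphProj π x else if y = B then coGraphProj π x else LinearMap.id) m
    refine (sum_fold hlt hβ hlj g hx).trans ?_
    by_cases hxj : x = j
    · rw [if_pos hxj]
      rcases hAB with ⟨rfl, rfl⟩ | ⟨rfl, rfl⟩
      · simp only [g, if_true, if_neg hlj.symm, h3]
      · simp only [g, if_true, if_neg hlj]
        rw [add_comm, h3]
    · rw [if_neg hxj]
      have h4 : x ≠ A ∧ x ≠ B := by grind
      simp only [g, if_neg h4.1, if_neg h4.2, LinearMap.id_apply]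

/-- The homomorphisms from `M` to `N` are the homomorphisms `φ` over the vertices other than `l`
together with a map `t` such that `p φ_j = t π`. -/
structure SliceCompat (l : Q) (M N : LinRep Q) (π : M.obj j →ₗ[ℂ] D)
    (p : N.obj j →ₗ[ℂ] N.obj j) : Prop where
  exists_of_hom : ∀ φ ∈ LinRep.hom M N, ∃ t : D →ₗ[ℂ] N.obj j, (∀ d, p (t d) = t d) ∧
    (∀ m, p (φ j m) = t (π m)) ∧ ((∀ x, x ≠ l → φ x = 0) → t = 0 → φ l = 0)
  exists_hom : ∀ φ : ∀ x, M.obj x →ₗ[ℂ] N.obj x,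
    (∀ {x y : Q} (b : x ⟶ y), x ≠ l → y ≠ l → ∀ m, φ y (M.map b m) = N.map b (φ x m)) →
    ∀ t : D →ₗ[ℂ] N.obj j, (∀ d, p (t d) = t d) → (∀ m, p (φ j m) = t (π m)) →
    ∃ φ' ∈ LinRep.hom M N, (∀ x, x ≠ l → φ' x = φ x) ∧ (φ' = 0 → t = 0)

theorem SlicePair.tail_ne (h : SlicePair l j) (hQ : Acyclic Q) {z y : Q}
    (p : Quiver.Path j z) (b : z ⟶ y) : z ≠ l := by
  intro hz
  rcases h.ends b (Or.inl hz) with ⟨-, rfl⟩ | ⟨h1, -⟩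
  · exact absurd (hQ _ (p.cons b)) (by simp)
  · exact h.ne hQ (hz.symm.trans h1)

/-- Away from l, a morphism from M ⊕ (P_j ⊗ D) to N is a pair (φ,t), the map t being its value on
the trivial path. It respects the graph decomposition at j exactly when `e' B` fixes the image of t
and e'_B φ_j = tπ. By `SliceCompat` these are the data of a morphism from M to N on the original
quiver. -/
theorem hom_eq_bot_iff_of_compat (hQ : Acyclic Q) (h : SlicePair l j) (hlt : β l < β j)
    (hβ : ∀ x, β x ≠ 0) {M N : LinRep Q} (π : M.obj j →ₗ[ℂ] D) {A B : SliceVertex β l j}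
    (hAB : (A.1 = l ∧ B.1 = j) ∨ (A.1 = j ∧ B.1 = l))
    {e' : SliceVertex β l j → ∀ x, N.obj x →ₗ[ℂ] N.obj x} (he' : IsBlock N e')
    (hid : ∀ u, u ≠ A → u ≠ B → ∀ x m, e' u x m = m)
    (hsum : ∀ m, e' A j m + e' B j m = m) (hc : SliceCompat l M N π (e' B j)) :
    LinRep.hom M N = ⊥ ↔
      LinRep.hom (blockRep (extRep hQ j D M) (extBlock π A.1 B.1)) (blockRep N e') = ⊥ := by
  have hlj := h.ne hQ
  have hne : A ≠ B := by
    intro h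
    rw [h] at hAB
    rcases hAB with ⟨h1, h2⟩ | ⟨h1, h2⟩
    · exact hlj (h1.symm.trans h2)
    · exact hlj (h2.symm.trans h1)
  have hfA : fold l j A.1 = j := by unfold fold; grind
  have hfB : fold l j B.1 = j := by unfold fold; grind
  have hbA : ∀ x, extBlock (β := β) (l := l) π A.1 B.1 A x = graphProj π x := fun x => if_pos rfl
  have hbB : ∀ x, extBlock (β := β) (l := l) π A.1 B.1 B x = coGraphProj π x := fun x => by
    rw [extBlock, if_neg fun h => hne (Subtype.ext h.symm), if_pos rfl]
  rw [hom_blockRep_eq_bot_iff hlj (isBlock_extBlock hQ hlt hβ hlj π hAB) he',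
    LinRep.hom_eq_bot_iff]
  constructor
  · intro h0 Φ hΦ hb x hx m
    have hb' : ∀ (u : SliceVertex β l j) (x : Q), fold l j u.1 = x → ∀ m,
        e' u x (Φ x m) = Φ x (extBlock π A.1 B.1 u x m) := by
      rintro u x rfl m
      exact hb u m
    let t : D →ₗ[ℂ] N.obj j := Φ j ∘ₗ LinearMap.inr ℂ _ _ ∘ₗ Finsupp.lsingle .nil
    obtain ⟨φ', hφ', h1, h2⟩ := hc.exists_hom (fun x => Φ x ∘ₗ LinearMap.inl ℂ _ _) (by
      intro x y b hx hy m
      have := hΦ b hx hy (m, 0)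
      simp only [LinearMap.comp_apply, LinearMap.inl_apply]
      rw [← this]
      change _ = Φ y (M.map b m, Finsupp.lmapDomain D ℂ
        (fun p : Quiver.Path j x => p.cons b) 0)
      rw [map_zero]) t (by
      intro d
      have := hb' B j hfB (0, Finsupp.single .nil d)
      rw [hbB, coGraphProj_apply, map_zero, add_zero] at this
      exact this) (by
      intro m
      have := hb' B j hfB (m, 0)
      rw [hbB, coGraphProj_apply, zero_add, atNil_self] at this
      exact this)
    have h3 : φ' = 0 := funext fun x => LinearMap.ext fun m => h0 φ' hφ' x m
    have ht := h2 h3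
    -- Maps out of the projective part are determined at the trivial path. A path from j that
    -- reaches l cannot continue, so the induction never leaves the vertices x ≠ l.
    have hp : ∀ {y : Q} (p : Quiver.Path j y), y ≠ l → ∀ d, Φ y (0, Finsupp.single p d) = 0 := by
      intro y p
      induction p with
      | nil => exact fun _ d => LinearMap.congr_fun ht d
      | cons p b ih =>
        intro hy d
        have hz := h.tail_ne hQ p b
        have h4 := hΦ b hz hy (0, Finsupp.single p d)
        rw [ih hz, map_zero] at h4
        rw [← h4]
        change _ = Φ _ (M.map b 0, Finsupp.mapDomain (fun p => p.cons b) (Finsupp.single p d))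
        rw [map_zero, Finsupp.mapDomain_single]
    obtain ⟨m, s⟩ := m
    have h5 : Φ x (m, 0) = 0 := by
      have := LinearMap.congr_fun (h1 x hx) m
      rw [h3] at this
      exact this.symm
    have h6 : Φ x ∘ₗ LinearMap.inr ℂ _ _ = 0 := by
      refine Finsupp.lhom_ext fun p d => ?_
      exact hp p hx d
    have h7 : Φ x (0, s) = 0 := LinearMap.congr_fun h6 s
    have h8 : ((m, s) : M.obj x × (Quiver.Path j x →₀ D)) = (m, 0) + (0, s) := by simp
    rw [h8, map_add, h5, h7, add_zero]
  · intro h0 φ hφ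
    obtain ⟨t, ht1, ht2, ht3⟩ := hc.exists_of_hom φ hφ
    let θ : ∀ x, (Quiver.Path j x →₀ D) →ₗ[ℂ] N.obj x := fun x =>
      Finsupp.lsum ℂ fun p => N.pathMap p ∘ₗ t
    have hθ : ∀ x p d, θ x (Finsupp.single p d) = N.pathMap p (t d) := fun x p d => by
      simp [θ]
    have hθj : ∀ s, e' B j (θ j s) = θ j s := by
      intro s
      have : e' B j ∘ₗ θ j = θ j := by
        refine Finsupp.lhom_ext fun p d => ?_
        rw [LinearMap.comp_apply, hθ, hQ.path_eq_nil p]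
        exact ht1 d
      exact LinearMap.congr_fun this s
    have hθA : ∀ s, e' A j (θ j s) = 0 := by
      intro s
      rw [← hθj]
      exact he'.1 A B j hfA hfB hne _
    have hκ : ∀ m, θ j (atNil π j m) = e' B j (φ j m) := by
      intro m
      rw [atNil_self, hθ, ht2]
      rfl
    let Φ : ∀ x, (extRep hQ j D M).obj x →ₗ[ℂ] N.obj x := fun x => (φ x).coprod (θ x)
    have hΦ : ∀ x m s, Φ x (m, s) = φ x m + θ x s := fun x m s => LinearMap.coprod_apply _ _ _
    have h1 := h0 Φ (by
      rintro x y b - - ⟨m, s⟩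
      change Φ y (M.map b m, Finsupp.lmapDomain D ℂ (fun p => p.cons b) s) = _
      rw [hΦ, hΦ, map_add, LinRep.mem_hom.1 hφ]
      congr 1
      have : θ y ∘ₗ Finsupp.lmapDomain D ℂ (fun p => p.cons b) = N.map b ∘ₗ θ x := by
        refine Finsupp.lhom_ext fun p d => ?_
        rw [LinearMap.comp_apply, LinearMap.comp_apply, hθ, Finsupp.lmapDomain_apply,
          Finsupp.mapDomain_single, hθ]
        rfl
      exact LinearMap.congr_fun this s) (by
      intro u m
      have hgen : ∀ x, fold l j u.1 = x → ∀ m, e' u x (Φ x m) =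
          Φ x (extBlock π A.1 B.1 u x m) := by
        rintro x hx ⟨m, s⟩
        by_cases huA : u = A
        · subst huA
          obtain rfl : j = x := hfA.symm.trans hx
          rw [hbA, graphProj_apply, hΦ, hΦ, map_add, hθA, add_zero, map_neg, hκ]
          exact eq_add_neg_of_add_eq (hsum (φ j m))
        by_cases huB : u = B
        · subst huB
          obtain rfl : j = x := hfB.symm.trans hx
          rw [hbB, coGraphProj_apply, hΦ, hΦ, map_add, hθj, map_add, hκ, map_zero, zero_add,
            add_comm]
        · rw [hid u huA huB, extBlock, if_neg fun h => huA (Subtype.ext h),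
            if_neg fun h => huB (Subtype.ext h), LinearMap.id_apply]
      exact hgen _ rfl m)
    have h2 : ∀ x, x ≠ l → φ x = 0 := by
      intro x hx
      refine LinearMap.ext fun m => ?_
      have := h1 x hx (m, 0)
      rw [hΦ, map_zero, add_zero] at this
      exact this
    have h3 : t = 0 := by
      refine LinearMap.ext fun d => ?_
      have := h1 j hlj.symm (0, Finsupp.single .nil d)
      rw [hΦ, map_zero, zero_add, hθ] at this
      exact this
    intro x m
    by_cases hx : x = l
    · subst hx
      rw [ht3 h2 h3]
      rfl
    · rw [h2 x hx]
      rfl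

end Extension

end QuiverSlice

namespace QuiverSlice

/-! ### Weight and Tits form of the new dimension vector. -/

section Numerics

variable {Q : Type} [Fintype Q] [DecidableEq Q] [Quiver.{0} Q] [∀ x y : Q, Finite (x ⟶ y)]
  {l j : Q} {β : Q → ℕ}

/-- Arrows between slice vertices depend only on the folded vertices, so their contribution to the
weight is computed on Q from the push-forward G of γ. -/
theorem leftWeight_sliceVertex (γ : SliceVertex β l j → ℤ) (G : Q → ℤ)
    (hG : ∀ x, G x = ∑ z : SliceVertex β l j, if fold l j z.1 = x then γ z else 0)
    (u : SliceVertex β l j) :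
    leftWeight γ u = γ u - G (fold l j u.1) + leftWeight G (fold l j u.1) := by
  rw [leftWeight_apply, leftWeight_apply]
  have h : ∑ x, (Nat.card (x ⟶ fold l j u.1) : ℤ) * G x =
      ∑ z : SliceVertex β l j, (Nat.card (fold l j z.1 ⟶ fold l j u.1) : ℤ) * γ z := by
    simp only [hG, Finset.mul_sum, mul_ite, mul_zero]
    rw [Finset.sum_comm]
    exact Finset.sum_congr rfl fun z _ => by simp
  rw [h]
  change _ - ∑ z : SliceVertex β l j, (Nat.card (fold l j z.1 ⟶ fold l j u.1) : ℤ) * γ z = _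
  ring

variable {A B : Q} {α : Q → ℤ} {d : ℤ}

theorem sum_fold_slice (hlt : β l < β j) (hβ : ∀ x, β x ≠ 0) (hlj : l ≠ j)
    (hAB : (A = l ∧ B = j) ∨ (A = j ∧ B = l)) {γ : SliceVertex β l j → ℤ}
    (hγ : ∀ u, γ u = (if u.1 = B then 0 else α (fold l j u.1)) +
      if u.1 = A then 0 else d * pathCount j (fold l j u.1)) (x : Q) :
    (α + d • pathCount j + Pi.single l (-(α l + d * pathCount j l)) : Q → ℤ) x =
      ∑ z : SliceVertex β l j, if fold l j z.1 = x then γ z else 0 := by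
  let g : Q → ℤ := fun y => (if y = B then 0 else α (fold l j y)) +
      if y = A then 0 else d * pathCount j (fold l j y)
  have h1 : ∀ u, γ u = g u.1 := hγ
  simp only [h1]
  by_cases hx : x = l
  · subst hx
    rw [Finset.sum_eq_zero fun z _ => if_neg (fold_ne hlj z.1)]
    simp
  · rw [sum_fold hlt hβ hlj g hx]
    have hs : (Pi.single l (-(α l + d * pathCount j l)) : Q → ℤ) x = 0 := Pi.single_eq_of_ne hx _
    simp only [Pi.add_apply, Pi.smul_apply, smul_eq_mul, hs, add_zero]
    split_ifs with hxj
    · subst hxj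
      rcases hAB with ⟨rfl, rfl⟩ | ⟨rfl, rfl⟩
      · simp [g, fold, hlj, hlj.symm]
      · simp [g, fold, hlj, hlj.symm, add_comm]
    · have h2 : x ≠ A ∧ x ≠ B := by grind
      simp [g, h2.1, h2.2, fold, hx]

/-- By `hw`, the Tits form is ⟨α,·⟩ applied to γ after replacing the basis vector at l by the sum of
those at l and j. That vector is α plus d copies of the projective at j and a multiple of the basis
vector at l, and ⟨α,P_j⟩ = -⟨P_j,ν⟩ = -ν_j. -/
theorem euler_sliceVertex (hlt : β l < β j) (hβ : ∀ x, β x ≠ 0) (hlj : l ≠ j) (hQ : Acyclic Q)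
    (hAB : (A = l ∧ B = j) ∨ (A = j ∧ B = l)) {γ : SliceVertex β l j → ℤ}
    (hγ : ∀ u, γ u = (if u.1 = B then 0 else α (fold l j u.1)) +
      if u.1 = A then 0 else d * pathCount j (fold l j u.1))
    (hw : ∀ u, leftWeight γ u = leftWeight α u.1 + if u.1 = l then leftWeight α j else 0)
    {ν : Q → ℤ} (hν : ∀ η, euler α η = -euler η ν) :
    euler γ γ = euler α α - d * ν j +
      ((if l = B then 0 else α j) + (if l = A then 0 else d) - α l - d * pathCount j l) *
        rightWeight ν l := by
  let g : Q → ℤ := fun y => (if y = B then 0 else α (fold l j y)) +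
      if y = A then 0 else d * pathCount j (fold l j y)
  have h1 : ∀ u, γ u = g u.1 := hγ
  have hσ := (leftWeight_eq_rightWeight_iff _ _).2 hν
  have hgl : g l = (if l = B then 0 else α j) + (if l = A then 0 else d) := by
    simp [g, fold, pathCount_self hQ]
  have h2 : euler γ γ = ∑ x, leftWeight α x * g x + leftWeight α j * g l := by
    rw [euler_eq_sum_leftWeight]
    have h3 : ∀ u : SliceVertex β l j, leftWeight γ u * γ u =
        (fun x => (leftWeight α x + if x = l then leftWeight α j else 0) * g x) u.1 := fun u => by
      rw [hw, h1]
    refine (Finset.sum_congr rfl fun u _ => h3 u).trans ((sum_sliceVertex hlt hβ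
      fun x => (leftWeight α x + if x = l then leftWeight α j else 0) * g x).trans ?_)
    simp [add_mul, Finset.sum_add_distrib]
  have h4 : g = α + d • pathCount j +
      (g l - α l - d * pathCount j l) • Pi.single l 1 - g l • Pi.single j 1 := by
    funext x
    simp only [Pi.add_apply, Pi.sub_apply, Pi.smul_apply, smul_eq_mul, Pi.single_apply, mul_ite,
      mul_one, mul_zero]
    by_cases hx : x = l
    · subst hx
      rw [if_pos rfl, if_neg hlj]
      ring
    · rw [if_neg hx]
      split_ifs with hxj
      · subst hxj
        rcases hAB with ⟨rfl, rfl⟩ | ⟨rfl, rfl⟩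
        · simp [g, fold, hlj, hlj.symm, pathCount_self hQ]
        · simp [g, fold, hlj, hlj.symm, pathCount_self hQ]
      · have h2 : x ≠ A ∧ x ≠ B := by grind
        simp [g, h2.1, h2.2, fold, hx]
  rw [h2, ← euler_eq_sum_leftWeight, ← hgl]
  rw [congrArg (euler α) h4, sub_eq_add_neg, ← neg_smul]
  simp only [euler_add_right, euler_smul_right, euler_single_right]
  rw [hν (pathCount j), euler_pathCount hQ, ← hσ]
  ring

theorem slice_numerics_of_source (hlt : β l < β j) (hβ : ∀ x, β x ≠ 0) (hQ : Acyclic Q)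
    (h : ∃ a : l ⟶ j, IsOneSource a) {γ : SliceVertex β l j → ℤ}
    (hγ : ∀ u, γ u = (if u.1 = j then 0 else α (fold l j u.1)) +
      if u.1 = l then 0 else (α j - α l) * pathCount j (fold l j u.1)) :
    (∀ u, leftWeight γ u = leftWeight α u.1 + if u.1 = l then leftWeight α j else 0) ∧
    ∀ {ν : Q → ℤ}, (∀ η, euler α η = -euler η ν) →
      euler γ γ = euler α α - (α j - α l) * ν l := by
  have hlj := SlicePair.ne (Or.inl h) hQ
  -- No path from j enters a source l; at a sink the only path from j to l is the arrow itself.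
  have hp : pathCount j l = 0 := by
    rw [pathCount_rec hQ, if_neg hlj.symm]
    simp [fun x => (card_hom_of_source hlj h x).1]
  have hw : ∀ u, leftWeight γ u = leftWeight α u.1 + if u.1 = l then leftWeight α j else 0 := by
    intro u
    rw [leftWeight_sliceVertex γ _ (sum_fold_slice hlt hβ hlj (Or.inl ⟨rfl, rfl⟩) hγ),
      leftWeight_add, leftWeight_add, leftWeight_single_of_source hlj h, hγ]
    have h1 : leftWeight ((α j - α l) • pathCount j) = (α j - α l) • Pi.single j 1 := by
      rw [← leftWeight_pathCount hQ]
      funext x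
      exact euler_smul_left _ _ _
    have h2 := leftWeight_of_source hlj h α
    have h3 := pathCount_self hQ j
    have h4 := fold_ne hlj u.1
    simp only [h1, Pi.add_apply, Pi.smul_apply, smul_eq_mul, hp, Pi.single_apply, if_neg h4]
    by_cases hul : u.1 = l
    · have h5 : fold l j u.1 = j := if_pos hul
      have h6 : u.1 ≠ j := fun h => hlj (hul.symm.trans h)
      simp only [h5, h3, if_neg h6, if_pos hul, if_true]
      rw [congrArg (leftWeight α) hul, h2]
      ring
    · have h5 : fold l j u.1 = u.1 := if_neg hul
      rw [h5]
      by_cases huj : u.1 = j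
      · simp only [if_pos huj, if_neg hul]
        rw [congrArg (leftWeight α) huj, congrArg α huj, congrArg (pathCount j) huj, h3]
        ring
      · simp only [if_neg huj, if_neg hul]
        ring
  refine ⟨hw, fun hν => ?_⟩
  rw [euler_sliceVertex hlt hβ hlj hQ (Or.inl ⟨rfl, rfl⟩) hγ hw hν, if_neg hlj, if_pos rfl, hp,
    rightWeight_of_source hlj h]
  ring

theorem slice_numerics_of_sink (hlt : β l < β j) (hβ : ∀ x, β x ≠ 0) (hQ : Acyclic Q)
    (h : ∃ a : j ⟶ l, IsOneSink a) {γ : SliceVertex β l j → ℤ}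
    (hγ : ∀ u, γ u = (if u.1 = l then 0 else α (fold l j u.1)) +
      if u.1 = j then 0 else α l * pathCount j (fold l j u.1)) :
    (∀ u, leftWeight γ u = leftWeight α u.1 + if u.1 = l then leftWeight α j else 0) ∧
    ∀ {ν : Q → ℤ}, (∀ η, euler α η = -euler η ν) →
      euler γ γ = euler α α - α l * (ν j - ν l) := by
  have hlj := SlicePair.ne (Or.inr h) hQ
  have hp : pathCount j l = 1 := by
    rw [pathCount_rec hQ, if_neg hlj.symm]
    simp [fun x => (card_hom_of_sink hlj h x).2, pathCount_self hQ]
  have hw : ∀ u, leftWeight γ u = leftWeight α u.1 + if u.1 = l then leftWeight α j else 0 := by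
    intro u
    rw [leftWeight_sliceVertex γ _ (sum_fold_slice hlt hβ hlj (Or.inr ⟨rfl, rfl⟩) hγ),
      leftWeight_add, leftWeight_add, hγ]
    have h1 : leftWeight (α l • pathCount j) = α l • Pi.single j 1 := by
      rw [← leftWeight_pathCount hQ]
      funext x
      exact euler_smul_left _ _ _
    have h2 := leftWeight_of_sink hlj h α
    have h3 := pathCount_self hQ j
    have h4 := fold_ne hlj u.1
    have h7 : ∀ m, leftWeight (Pi.single l m) (fold l j u.1) = 0 := by
      intro m
      rw [leftWeight_apply, Finset.sum_eq_single l, (card_hom_of_sink hlj h _).1]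
      · simp [h4]
      · intro y _ hy
        simp [hy]
      · simp
    simp only [h1, h7, Pi.add_apply, Pi.smul_apply, smul_eq_mul, hp, Pi.single_apply, if_neg h4]
    by_cases hul : u.1 = l
    · have h5 : fold l j u.1 = j := if_pos hul
      have h6 : u.1 ≠ j := fun h => hlj (hul.symm.trans h)
      simp only [h5, h3, if_neg h6, if_pos hul, if_true]
      rw [congrArg (leftWeight α) hul, h2]
      ring
    · have h5 : fold l j u.1 = u.1 := if_neg hul
      rw [h5]
      by_cases huj : u.1 = j
      · simp only [if_pos huj, if_neg hul]
        rw [congrArg (leftWeight α) huj, congrArg α huj, congrArg (pathCount j) huj, h3]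
        ring
      · simp only [if_neg huj, if_neg hul]
        ring
  refine ⟨hw, fun hν => ?_⟩
  rw [euler_sliceVertex hlt hβ hlj hQ (Or.inr ⟨rfl, rfl⟩) hγ hw hν, if_pos rfl, if_neg hlj, hp,
    rightWeight_of_sink hlj h]
  ring

end Numerics

/-! ### Dimensions of the pieces. -/

section Dimension

variable {Q : Type} [Fintype Q] [DecidableEq Q] [Quiver.{0} Q] [∀ x y : Q, Finite (x ⟶ y)]
  {l j : Q} {β : Q → ℕ} {D : Type} [AddCommGroup D] [Module ℂ D] [FiniteDimensional ℂ D]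
  {M : LinRep Q}

theorem finrank_range_graphProj (π : M.obj j →ₗ[ℂ] D) (x : Q) :
    Module.finrank ℂ (LinearMap.range (graphProj π x)) = M.dim x := by
  have h : LinearMap.range (graphProj π x) = LinearMap.range
      (LinearMap.id.prod (-atNil π x) : M.obj x →ₗ[ℂ] M.obj x × (Quiver.Path j x →₀ D)) :=
    LinearMap.range_comp_of_range_eq_top _ (LinearMap.range_eq_top.2 Prod.fst_surjective)
  rw [h]
  exact LinearMap.finrank_range_of_inj fun m n h => congrArg Prod.fst h

theorem finrank_path (hQ : Acyclic Q) (x : Q) :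
    (Module.finrank ℂ (Quiver.Path j x →₀ D) : ℤ) = Module.finrank ℂ D * pathCount j x := by
  have := hQ.finite_path j x
  have := Fintype.ofFinite (Quiver.Path j x)
  rw [(Finsupp.linearEquivFunOnFinite ℂ D (Quiver.Path j x)).finrank_eq,
    Module.finrank_pi_fintype]
  simp [pathCount, mul_comm]

theorem finrank_range_coGraphProj (π : M.obj j →ₗ[ℂ] D) (x : Q) :
    Module.finrank ℂ (LinearMap.range (coGraphProj π x)) =
      Module.finrank ℂ (Quiver.Path j x →₀ D) := by
  have h : LinearMap.range (coGraphProj π x) = LinearMap.range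
      (LinearMap.inr ℂ (M.obj x) (Quiver.Path j x →₀ D)) := by
    refine LinearMap.range_comp_of_range_eq_top _ (LinearMap.range_eq_top.2 fun s => ⟨(0, s), ?_⟩)
    simp
  rw [h]
  exact LinearMap.finrank_range_of_inj LinearMap.inr_injective

/-- The graph piece has the dimension of M, the other piece that of the projective part, and every
other vertex carries both. -/
theorem dim_blockRep_extBlock (hQ : Acyclic Q) (π : M.obj j →ₗ[ℂ] D) {A B : Q} (hAB : A ≠ B)
    (u : SliceVertex β l j) :
    toInt (blockRep (extRep hQ j D M) (extBlock π A B)).dim u =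
      (if u.1 = B then 0 else toInt M.dim (fold l j u.1)) +
        if u.1 = A then 0 else Module.finrank ℂ D * pathCount j (fold l j u.1) := by
  change ((Module.finrank ℂ (LinearMap.range (extBlock π A B u (fold l j u.1))) : ℕ) : ℤ) = _
  unfold extBlock
  have hf := hQ.finite_path j (fold l j u.1)
  by_cases hA : u.1 = A
  · have hB : u.1 ≠ B := fun h => hAB (hA.symm.trans h)
    rw [if_pos hA, if_pos hA, if_neg hB, finrank_range_graphProj, add_zero]
    rfl
  · by_cases hB : u.1 = B
    · rw [if_neg hA, if_neg hA, if_pos hB, if_pos hB, finrank_range_coGraphProj, finrank_path hQ,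
        zero_add]
    · rw [if_neg hA, if_neg hA, if_neg hB, if_neg hB, LinearMap.range_id, finrank_top,
        Module.finrank_prod]
      push_cast
      rw [finrank_path hQ]
      rfl

end Dimension

end QuiverSlice

namespace QuiverSlice

/-! ### Morphisms along a 1-source and a 1-sink. -/

section Compat

variable {Q : Type} [DecidableEq Q] [Quiver.{0} Q] {l j : Q}

/-- Vanishing of Ext prevents V from degenerating along the removed arrow, which is what makes the
correction to the Tits form non-negative. -/
theorem LinRep.injective_or_surjective {M N : LinRep Q} (h : Function.Surjective (LinRep.d M N))
    {x y : Q} (a : x ⟶ y) :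
    Function.Injective (M.map a) ∨ Function.Surjective (N.map a) := by
  classical
  by_contra hc
  rw [not_or, injective_iff_map_eq_zero] at hc
  obtain ⟨h1, h2⟩ := hc
  push Not at h1
  obtain ⟨m, hm, hm0⟩ := h1
  refine h2 fun ζ => ?_
  obtain ⟨ξ, hξ⟩ : ∃ ξ : Module.Dual ℂ (M.obj x), ξ m ≠ 0 := by
    by_contra hc
    push Not at hc
    exact hm0 ((Module.forall_dual_apply_eq_zero_iff ℂ m).1 hc)
  -- The target is supported on `a` and sends the kernel vector m to a non-zero multiple of ζ. At m
  -- the term φ_y M(a) vanishes, so N(a) attains ζ.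
  obtain ⟨φ, hφ⟩ := h (Function.update 0 x (Function.update 0 y
    (Function.update 0 a (ξ.smulRight ζ))))
  have h3 := LinearMap.congr_fun (congrFun (congrFun (congrFun hφ x) y) a) m
  rw [Function.update_self, Function.update_self, Function.update_self] at h3
  simp only [LinRep.d, LinearMap.coe_mk, AddHom.coe_mk, LinearMap.sub_apply,
    LinearMap.comp_apply, hm, map_zero, zero_sub, LinearMap.smulRight_apply] at h3
  refine ⟨-((ξ m)⁻¹ • φ x m), ?_⟩
  rw [map_neg, map_smul, ← smul_neg, h3, smul_smul, inv_mul_cancel₀ hξ, one_smul]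

/-- The component φ_l is forced by φ_j, since N(a) is injective, and exists exactly when φ_j M(a)
lands in the image of N(a), the kernel of p. Equivalently pφ_j factors through the cokernel of M(a),
and t is the factoring map. -/
theorem sliceCompat_of_source (hlj : l ≠ j) {M N : LinRep Q} (a : l ⟶ j) (ha : IsOneSource a)
    {p : N.obj j →ₗ[ℂ] N.obj j} (hp : ∀ n, p (p n) = p n) (hN : Function.Injective (N.map a))
    (hr : ∀ n, p n = 0 ↔ n ∈ LinearMap.range (N.map a)) :
    SliceCompat l M N (LinearMap.range (M.map a)).mkQ p where
  exists_of_hom φ hφ := by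
    have h1 : LinearMap.range (M.map a) ≤ LinearMap.ker (p ∘ₗ φ j) := by
      rintro _ ⟨m, rfl⟩
      exact (hr _).2 ⟨φ l m, (LinRep.mem_hom.1 hφ a m).symm⟩
    refine ⟨(LinearMap.range (M.map a)).liftQ (p ∘ₗ φ j) h1, fun d => ?_, fun m => ?_, ?_⟩
    · obtain ⟨m, rfl⟩ := Submodule.mkQ_surjective _ d
      exact hp _
    · rfl
    · intro h2 _
      refine LinearMap.ext fun m => hN ?_
      rw [← LinRep.mem_hom.1 hφ a m, h2 j hlj.symm]
      simp
  exists_hom φ hφ t ht1 ht2 := by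
    obtain ⟨r, hr'⟩ := LinearMap.exists_leftInverse_of_injective (N.map a)
      (LinearMap.ker_eq_bot.2 hN)
    refine ⟨Function.update φ l (r ∘ₗ φ j ∘ₗ M.map a), ?_,
      fun x hx => Function.update_of_ne hx _ _, ?_⟩
    · rw [LinRep.mem_hom]
      intro x y b m
      by_cases hb : x = l ∨ y = l
      · have h2 := ha x y b hb
        obtain rfl : x = l := congrArg Quiver.Total.left h2
        obtain rfl : y = j := congrArg Quiver.Total.right h2
        obtain rfl : b = a := by simpa using h2
        rw [Function.update_self, Function.update_of_ne hlj.symm]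
        have h3 : p (φ y (M.map b m)) = 0 := by
          rw [ht2, Submodule.mkQ_apply, (Submodule.Quotient.mk_eq_zero _).2
            (LinearMap.mem_range_self (M.map b) m), map_zero]
        obtain ⟨k, hk⟩ := (hr _).1 h3
        have h4 := LinearMap.congr_fun hr' k
        simp only [LinearMap.comp_apply, LinearMap.id_apply] at h4 ⊢
        rw [← hk, h4]
      · rw [not_or] at hb
        rw [Function.update_of_ne hb.1, Function.update_of_ne hb.2]
        exact hφ b hb.1 hb.2 m
    · intro h0
      have h1 : φ j = 0 := by
        rw [← Function.update_of_ne hlj.symm (r ∘ₗ φ j ∘ₗ M.map a) φ, h0]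
        rfl
      refine LinearMap.ext fun d => ?_
      obtain ⟨m, rfl⟩ := Submodule.mkQ_surjective _ d
      rw [← ht2, h1]
      simp

/-- Here t = ιφ_l, where ι is a section of N(a). Compatibility with the arrow becomes pφ_j = tM(a)
for the projection p = ιN(a). -/
theorem sliceCompat_of_sink (hlj : l ≠ j) {M N : LinRep Q} (a : j ⟶ l) (ha : IsOneSink a)
    {ι : N.obj l →ₗ[ℂ] N.obj j} (hι : ∀ k, N.map a (ι k) = k) :
    SliceCompat l M N (M.map a) (ι ∘ₗ N.map a) where
  exists_of_hom φ hφ := by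
    refine ⟨ι ∘ₗ φ l, fun d => congrArg ι (hι _),
      fun m => congrArg ι (LinRep.mem_hom.1 hφ a m).symm, ?_⟩
    intro _ h
    refine LinearMap.ext fun m => ?_
    rw [← hι (φ l m)]
    exact (congrArg (N.map a) (LinearMap.congr_fun h m)).trans (map_zero _)
  exists_hom φ hφ t ht1 ht2 := by
    refine ⟨Function.update φ l (N.map a ∘ₗ t), ?_,
      fun x hx => Function.update_of_ne hx _ _, ?_⟩
    · rw [LinRep.mem_hom]
      intro x y b m
      by_cases hb : x = l ∨ y = l
      · have h2 := ha x y b hb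
        obtain rfl : x = j := congrArg Quiver.Total.left h2
        obtain rfl : y = l := congrArg Quiver.Total.right h2
        obtain rfl : b = a := by simpa using h2
        rw [Function.update_self, Function.update_of_ne hlj.symm, LinearMap.comp_apply, ← ht2]
        exact hι _
      · rw [not_or] at hb
        rw [Function.update_of_ne hb.1, Function.update_of_ne hb.2]
        exact hφ b hb.1 hb.2 m
    · intro h0
      have h1 : N.map a ∘ₗ t = 0 := by
        rw [← Function.update_self l (N.map a ∘ₗ t) φ, h0]
        rfl
      refine LinearMap.ext fun d => ?_
      rw [← ht1]
      exact (congrArg ι (LinearMap.congr_fun h1 d)).trans (map_zero _)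

end Compat

/-! ### The normal form (δ_{pq}) meets these hypotheses. -/

section Delta

/-- The map with the matrix `(δ_{pq})`. -/
def deltaMap (m n : ℕ) : (Fin n → ℂ) →ₗ[ℂ] (Fin m → ℂ) :=
  Matrix.toLin' (Matrix.of fun p q => if (p : ℕ) = q then 1 else 0)

theorem deltaMap_apply (m n : ℕ) (k : Fin n → ℂ) (p : Fin m) :
    deltaMap m n k p = if h : (p : ℕ) < n then k ⟨p, h⟩ else 0 := by
  rw [deltaMap, Matrix.toLin'_apply, Matrix.mulVec, dotProduct]
  split_ifs with h
  · rw [Finset.sum_eq_single ⟨p, h⟩]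
    · simp
    · intro q _ hq
      have : (p : ℕ) ≠ q := fun h1 => hq (Fin.ext h1.symm)
      simp [this]
    · simp
  · refine Finset.sum_eq_zero fun q _ => ?_
    have : (p : ℕ) ≠ q := by
      have := q.2
      omega
    simp [this]

variable {Q : Type} [Fintype Q] [DecidableEq Q] [Quiver.{0} Q] [∀ x y : Q, Finite (x ⟶ y)]
  {l j : Q} {β : Q → ℕ} {M : LinRep Q}

theorem SlicePair.fill_map (h : SlicePair l j) (hle : β l ≤ β j) (W : Rep ℂ β) {u v : Q}
    (b : u ⟶ v) (hb : u = l ∨ v = l) :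
    (LinRep.ofRep (fill l j 1 W)).map b = deltaMap (β v) (β u) := by
  change Matrix.toLin' _ = Matrix.toLin' _
  congr 1
  ext p q
  exact h.fill_one_apply hle W b hb p q

theorem sliceCompat_fill_of_source (hlj : l ≠ j) (hle : β l ≤ β j) (a : l ⟶ j)
    (ha : IsOneSource a) (W : Rep ℂ β) (B : SliceVertex β l j) (hB : B.1 = j) :
    SliceCompat l M (LinRep.ofRep (fill l j 1 W)) (LinearMap.range (M.map a)).mkQ
      (coordBlock (fill l j 1 W) B j) := by
  have hm := SlicePair.fill_map (Or.inl ⟨a, ha⟩) hle W a (Or.inl rfl)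
  have hin : ∀ i : ℕ, InBlock β l j B.1 i ↔ β l ≤ i := by
    intro i
    unfold InBlock
    grind
  refine sliceCompat_of_source hlj a ha (fun n => ?_) (fun k k' hk => ?_) (fun n => ?_)
  · funext i
    by_cases hi : InBlock β l j B.1 i
    · exact coordBlock_apply_of _ B _ hi
    · exact (coordBlock_apply_of_not _ B _ hi).trans (coordBlock_apply_of_not _ B _ hi).symm
  · rw [hm] at hk
    funext i
    have h1 := congrFun hk (Fin.castLE hle i)
    rw [deltaMap_apply, deltaMap_apply] at h1
    exact (dif_pos (c := (i : ℕ) < β l) i.2).symm.trans (h1.trans (dif_pos i.2))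
  · rw [hm]
    constructor
    · intro h0
      refine ⟨fun i => n (Fin.castLE hle i), ?_⟩
      funext i
      rw [deltaMap_apply]
      split_ifs with hi
      · rfl
      · rw [← coordBlock_apply_of (fill l j 1 W) B n ((hin i).2 (not_lt.1 hi)), h0]
        rfl
    · rintro ⟨k, rfl⟩
      funext i
      by_cases hi : InBlock β l j B.1 i
      · refine (coordBlock_apply_of _ B _ hi).trans ?_
        rw [deltaMap_apply, dif_neg (not_lt.2 ((hin i).1 hi))]
        rfl
      · exact coordBlock_apply_of_not _ B _ hi

/-- The transposed normal form is a section of the arrow map, and composing gives the projection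
onto the first β_l coordinates. -/
theorem sliceCompat_fill_of_sink (hlj : l ≠ j) (hle : β l ≤ β j) (a : j ⟶ l)
    (ha : IsOneSink a) (W : Rep ℂ β) (B : SliceVertex β l j) (hB : B.1 = l) :
    SliceCompat l M (LinRep.ofRep (fill l j 1 W)) (M.map a)
      (coordBlock (fill l j 1 W) B j) := by
  have hm := SlicePair.fill_map (Or.inr ⟨a, ha⟩) hle W a (Or.inr rfl)
  have hin : ∀ i : ℕ, InBlock β l j B.1 i ↔ i < β l := by
    intro i
    unfold InBlock
    grind
  have h1 : coordBlock (fill l j 1 W) B j =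
      (deltaMap (β j) (β l)) ∘ₗ (LinRep.ofRep (fill l j 1 W)).map a := by
    rw [hm]
    refine LinearMap.ext fun n => funext fun i => ?_
    rw [LinearMap.comp_apply, deltaMap_apply]
    split_ifs with hi
    · refine (coordBlock_apply_of _ B _ ((hin i).2 hi)).trans ?_
      rw [deltaMap_apply, dif_pos i.2]
    · exact coordBlock_apply_of_not _ B _ fun h => hi ((hin i).1 h)
  rw [h1]
  refine sliceCompat_of_sink hlj a ha fun k => ?_
  rw [hm]
  funext i
  rw [deltaMap_apply, dif_pos (lt_of_lt_of_le i.2 hle), deltaMap_apply, dif_pos i.2]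

end Delta

/-! ### Slices with β_l < β_j. -/

section Strict

variable {Q : Type} [Fintype Q] [DecidableEq Q] [Quiver.{0} Q] [∀ x y : Q, Finite (x ⟶ y)]
  {l j : Q} {α β : Q → ℕ} {f : MvPolynomial (Coord β) ℂ} {V : Rep ℂ α} {hle : β l ≤ β j}
  {fa : MvPolynomial (Coord (sliceBeta β l j)) ℂ}

theorem sliceRep_fill (hlj : l ≠ j) (W : Rep ℂ β) :
    sliceRep hle (fill l j 1 W) = sliceRep (l := l) hle W := by
  funext u v b
  ext p q
  exact congrFun (congrFun (fill_apply_of_ne 1 W (u := fold l j u.1) (v := fold l j v.1) b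
    (not_or.2 ⟨fold_ne hlj _, fold_ne hlj _⟩)) _) _

theorem SlicePair.evalAt_ne_zero_iff (h : SlicePair l j) (hQ : Acyclic Q) (hβ : ∀ x, β x ≠ 0)
    (hlt : β l < β j) (hfa : IsInduced hle f fa) (hV : Represents f V)
    {D : Type} [AddCommGroup D] [Module ℂ D] [FiniteDimensional ℂ D]
    (π : (LinRep.ofRep V).obj j →ₗ[ℂ] D) {A B : SliceVertex β l j}
    (hAB : (A.1 = l ∧ B.1 = j) ∨ (A.1 = j ∧ B.1 = l))
    (hc : ∀ W : Rep ℂ β, SliceCompat l (LinRep.ofRep V) (LinRep.ofRep (fill l j 1 W)) π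
      (coordBlock (fill l j 1 W) B j)) (W' : Rep ℂ (sliceBeta β l j)) :
    evalAt fa W' ≠ 0 ↔ LinRep.hom (blockRep (extRep hQ j D (LinRep.ofRep V))
      (extBlock π A.1 B.1)) (LinRep.ofRep W') = ⊥ := by
  have hlj := h.ne hQ
  obtain ⟨W, rfl⟩ := sliceRep_surjective hlj hle W'
  obtain ⟨θ⟩ := nonempty_iso_sliceRep hle hlj (fill l j 1 W)
  rw [sliceRep_fill hlj] at θ
  rw [h.evalAt_sliceRep hfa, hV.ne_zero_iff, homSpace_eq_bot_iff,
    hom_eq_bot_iff_of_compat hQ h hlt hβ π hAB (isBlock_coordBlock hlt hβ hlj _) ?_ ?_ (hc W)]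
  · exact LinRep.hom_eq_bot_congr (LinRep.Iso.refl _) θ
  · intro u hA hB x m
    funext i
    refine coordBlock_apply_of _ u m ?_
    have h1 : u.1 ≠ A.1 := fun h => hA (Subtype.ext h)
    have h2 : u.1 ≠ B.1 := fun h => hB (Subtype.ext h)
    unfold InBlock
    grind
  · intro m
    funext i
    change coordBlock _ A j m i + coordBlock _ B j m i = m i
    have h0 : (InBlock β l j A.1 i ∧ ¬ InBlock β l j B.1 i) ∨
        (¬ InBlock β l j A.1 i ∧ InBlock β l j B.1 i) := by
      unfold InBlock
      grind
    rcases h0 with ⟨h1, h2⟩ | ⟨h1, h2⟩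
    · rw [coordBlock_apply_of _ A m h1, coordBlock_apply_of_not _ B m h2, add_zero]
    · rw [coordBlock_apply_of_not _ A m h1, coordBlock_apply_of _ B m h2, zero_add]

/-- The determinants of d on the two quivers are never compared: irreducibility of `fa`, its weight
and its zeros already identify it. -/
theorem SlicePair.exists_represents (h : SlicePair l j) (hQ : Acyclic Q) (hβ : ∀ x, β x ≠ 0)
    (hfa : IsInduced hle f fa) (hf : Irreducible f) (hu : ¬IsUnit fa) (hV : Represents f V)
    (M : LinRep (SliceVertex β l j))
    (hM : ∀ W', evalAt fa W' ≠ 0 ↔ LinRep.hom M (LinRep.ofRep W') = ⊥)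
    (hw : ∀ u, leftWeight (toInt M.dim) u =
      leftWeight (toInt α) u.1 + if u.1 = l then leftWeight (toInt α) j else 0) :
    Irreducible fa ∧ ∃ V' : Rep ℂ M.dim, Represents fa V' := by
  have hlj := h.ne hQ
  have hirr := h.irreducible hlj hfa hV.isSemiInvariant hf hu
  obtain ⟨V', ⟨θ⟩⟩ := M.exists_iso_ofRep
  refine ⟨hirr, V', represents_of_ne_zero_iff (hQ.of_prefunctor (sliceFold β l j))
    sliceBeta_ne_zero hirr ?_ fun W' => ?_⟩
  · have h1 := h.scalarWeight hlj (hβ l) hfa hV.isSemiInvariant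
    rwa [← funext hw] at h1
  · rw [hM, homSpace_eq_bot_iff]
    exact LinRep.hom_eq_bot_congr θ (LinRep.Iso.refl _)

theorem exists_represents_of_source (hQ : Acyclic Q) (hβ : ∀ x, β x ≠ 0)
    (h : ∃ a : l ⟶ j, IsOneSource a) (hlt : β l < β j) (hfa : IsInduced hle f fa)
    (hf : Irreducible f) (hu : ¬IsUnit fa) (hV : Represents f V) :
    α l ≤ α j ∧ Irreducible fa ∧ ∃ (α' : SliceVertex β l j → ℕ) (V' : Rep ℂ α'),
      Represents fa V' ∧ ∀ {ν : Q → ℤ}, (∀ η, euler (toInt α) η = -euler η ν) →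
        euler (toInt α') (toInt α') =
          euler (toInt α) (toInt α) - (toInt α j - toInt α l) * ν l := by
  have hlj := SlicePair.ne (Or.inl h) hQ
  obtain ⟨a, ha⟩ := h
  obtain ⟨W, hW⟩ := exists_evalAt_ne_zero hf.ne_zero
  rw [hV.ne_zero_iff, homSpace_eq_bot_iff, LinRep.hom_eq_bot_iff_surjective (by
    rw [LinRep.dim_ofRep, LinRep.dim_ofRep]
    exact hV.euler_eq_zero)] at hW
  -- A map from ℂ^{β_l} to the larger space ℂ^{β_j} is not onto, so Ext(V,W) = 0 leaves only
  -- injectivity of V(a). Its cokernel thus has dimension α_j - α_l.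
  have hinj : Function.Injective ((LinRep.ofRep V).map a) := by
    refine (LinRep.injective_or_surjective hW a).resolve_right fun hs => ?_
    have h1 := LinearMap.finrank_le_finrank_of_surjective hs
    rw [Module.finrank_fin_fun, Module.finrank_fin_fun] at h1
    omega
  have hα : α l ≤ α j := by
    have h1 := LinearMap.finrank_le_finrank_of_injective hinj
    rwa [Module.finrank_fin_fun, Module.finrank_fin_fun] at h1
  let A : SliceVertex β l j := ⟨l, sliceDim_ne_zero hlt hβ l⟩
  let B : SliceVertex β l j := ⟨j, sliceDim_ne_zero hlt hβ j⟩
  let π := (LinearMap.range ((LinRep.ofRep V).map a)).mkQ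
  have hd : (Module.finrank ℂ ((LinRep.ofRep V).obj j ⧸
      LinearMap.range ((LinRep.ofRep V).map a)) : ℤ) = toInt α j - toInt α l := by
    have h1 := Submodule.finrank_quotient_add_finrank (LinearMap.range ((LinRep.ofRep V).map a))
    rw [LinearMap.finrank_range_of_inj hinj, Module.finrank_fin_fun, Module.finrank_fin_fun] at h1
    unfold toInt
    omega
  obtain ⟨hw, hq⟩ := slice_numerics_of_source (α := toInt α)
    (γ := toInt (blockRep (extRep hQ j _ (LinRep.ofRep V)) (extBlock (β := β) π l j)).dim) hlt hβ hQ ⟨a, ha⟩ fun u => by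
    have h1 := dim_blockRep_extBlock (M := LinRep.ofRep V) (β := β) hQ π hlj u
    rw [LinRep.dim_ofRep, hd] at h1
    exact h1
  obtain ⟨hirr, V', hV'⟩ := SlicePair.exists_represents (Or.inl ⟨a, ha⟩) hQ hβ hfa hf hu hV _
    (SlicePair.evalAt_ne_zero_iff (Or.inl ⟨a, ha⟩) hQ hβ hlt hfa hV π (A := A) (B := B)
      (Or.inl ⟨rfl, rfl⟩) fun W => sliceCompat_fill_of_source hlj hle a ha W B rfl) hw
  exact ⟨hα, hirr, _, V', hV', hq⟩

theorem exists_represents_of_sink (hQ : Acyclic Q) (hβ : ∀ x, β x ≠ 0)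
    (h : ∃ a : j ⟶ l, IsOneSink a) (hlt : β l < β j) (hfa : IsInduced hle f fa)
    (hf : Irreducible f) (hu : ¬IsUnit fa) (hV : Represents f V) :
    Irreducible fa ∧ ∃ (α' : SliceVertex β l j → ℕ) (V' : Rep ℂ α'),
      Represents fa V' ∧ ∀ {ν : Q → ℤ}, (∀ η, euler (toInt α) η = -euler η ν) →
        euler (toInt α') (toInt α') =
          euler (toInt α) (toInt α) - toInt α l * (ν j - ν l) := by
  have hlj := SlicePair.ne (Or.inr h) hQ
  obtain ⟨a, ha⟩ := h
  let A : SliceVertex β l j := ⟨j, sliceDim_ne_zero hlt hβ j⟩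
  let B : SliceVertex β l j := ⟨l, sliceDim_ne_zero hlt hβ l⟩
  obtain ⟨hw, hq⟩ := slice_numerics_of_sink (α := toInt α)
    (γ := toInt (blockRep (extRep hQ j _ (LinRep.ofRep V))
      (extBlock (β := β) ((LinRep.ofRep V).map a) j l)).dim) hlt hβ hQ ⟨a, ha⟩ fun u => by
    have h1 := dim_blockRep_extBlock (M := LinRep.ofRep V) (β := β) hQ
      ((LinRep.ofRep V).map a) hlj.symm u
    rw [LinRep.dim_ofRep, Module.finrank_fin_fun] at h1
    exact h1
  obtain ⟨hirr, V', hV'⟩ := SlicePair.exists_represents (Or.inr ⟨a, ha⟩) hQ hβ hfa hf hu hV _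
    (SlicePair.evalAt_ne_zero_iff (Or.inr ⟨a, ha⟩) hQ hβ hlt hfa hV ((LinRep.ofRep V).map a)
      (A := A) (B := B)
      (Or.inr ⟨rfl, rfl⟩) fun W => sliceCompat_fill_of_sink hlj hle a ha W B rfl) hw
  exact ⟨hirr, _, V', hV', hq⟩

/-- A map from ℂ^{β_j} to a smaller space is not injective, so Ext(W,N) = 0 forces N(a) to be
surjective. -/
theorem CoRepresents.le_of_sink {ν : Q → ℕ} {N : Rep ℂ ν} (hN : CoRepresents f N)
    (hf : f ≠ 0) (a : j ⟶ l) (hlt : β l < β j) : ν l ≤ ν j := by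
  obtain ⟨W, hW⟩ := exists_evalAt_ne_zero hf
  rw [hN.ne_zero_iff, homSpace_eq_bot_iff, LinRep.hom_eq_bot_iff_surjective (by
    rw [LinRep.dim_ofRep, LinRep.dim_ofRep]
    exact hN.euler_eq_zero)] at hW
  have hs : Function.Surjective ((LinRep.ofRep N).map a) := by
    refine (LinRep.injective_or_surjective hW a).resolve_left fun hs => ?_
    have h1 := LinearMap.finrank_le_finrank_of_injective hs
    rw [Module.finrank_fin_fun, Module.finrank_fin_fun] at h1
    omega
  have h1 := LinearMap.finrank_le_finrank_of_surjective hs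
  rwa [Module.finrank_fin_fun, Module.finrank_fin_fun] at h1

end Strict

end QuiverSlice

namespace QuiverSlice

/-! ### The Tits form along slices, and the conclusion. -/

section SliceStep

variable {Q : Type} [Fintype Q] [DecidableEq Q] [Quiver.{0} Q] [∀ x y : Q, Finite (x ⟶ y)]
  {l j : Q} {α β : Q → ℕ} {f : MvPolynomial (Coord β) ℂ} {V : Rep ℂ α} {hle : β l ≤ β j}
  {fa : MvPolynomial (Coord (sliceBeta β l j)) ℂ}

theorem notMem_vars_restrictAt (f : MvPolynomial (Coord β) ℂ) {c : Coord β}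
    (hc : c.1 = l ∨ c.2.1 = l) : c ∉ (restrictAt l f).vars := by
  classical
  intro h
  obtain ⟨c', -, hc'⟩ := Finset.mem_biUnion.1 (vars_bind₁ _ f h)
  split_ifs at hc' with h1 h2
  · rw [vars_C] at hc'
    exact absurd hc' (Finset.notMem_empty _)
  · rw [vars_C] at hc'
    exact absurd hc' (Finset.notMem_empty _)
  · rw [vars_X, Finset.mem_singleton] at hc'
    exact h1 (hc' ▸ hc)

/-- The correction is a product of two non-negative factors: α_j - α_l and ν_l at a source, α_l and
ν_j - ν_l at a sink. For β_l = β_j there is no correction. -/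
theorem exists_isSchofield_of_slicePair (h : SlicePair l j) (hQ : Acyclic Q) (hβ : ∀ x, β x ≠ 0)
    (hfa : IsInduced hle f fa) (hf : Irreducible f) (hu : ¬IsUnit fa) (hV : Represents f V) :
    ∃ k ≤ euler (toInt α) (toInt α), IsSchofield ⟨SliceVertex β l j, sliceBeta β l j, fa⟩ k := by
  have hQ' := hQ.of_prefunctor (sliceFold β l j)
  obtain ⟨ν, N, hN, hν, -⟩ := hV.exists_coRepresents hQ hβ hf
  rcases hle.eq_or_lt with heq | hlt
  · obtain ⟨-, hirr, α', V', hV', hk⟩ := h.exists_represents_of_eq hQ hβ heq hfa hf hu hV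
    exact ⟨_, le_rfl, hQ', sliceBeta_ne_zero, hirr, α', V', hV', hk⟩
  · rcases h with h | h
    · obtain ⟨hle', hirr, α', V', hV', hk⟩ :=
        exists_represents_of_source hQ hβ h hlt hfa hf hu hV
      refine ⟨_, ?_, hQ', sliceBeta_ne_zero, hirr, α', V', hV', rfl⟩
      rw [hk hν]
      exact sub_le_self _ (mul_nonneg (sub_nonneg.2 (Int.ofNat_le.2 hle')) (Int.natCast_nonneg _))
    · obtain ⟨hirr, α', V', hV', hk⟩ := exists_represents_of_sink hQ hβ h hlt hfa hf hu hV
      refine ⟨_, ?_, hQ', sliceBeta_ne_zero, hirr, α', V', hV', rfl⟩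
      rw [hk hν]
      obtain ⟨a, -⟩ := h
      have hle' := hN.le_of_sink hf.ne_zero a hlt
      exact sub_le_self _ (mul_nonneg (Int.natCast_nonneg _) (sub_nonneg.2 (Int.ofNat_le.2 hle')))

theorem IsSchofield.sliceStep {S T : QuiverFunction} {k : ℤ} (hS : IsSchofield S k)
    (h : SliceStep S T) : (IsUnit T.poly ∧ 0 < k) ∨ ∃ k' ≤ k, IsSchofield T k' := by
  obtain ⟨hQ, hβ, hf, α, V, hV, rfl⟩ := hS
  cases h with
  | source β f a ha hle fa hfa =>
    by_cases hu : IsUnit fa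
    · exact Or.inl ⟨hu, hV.euler_pos_of_isUnit hQ hβ hf (Or.inl ⟨a, ha⟩) hfa hu⟩
    · exact Or.inr (exists_isSchofield_of_slicePair (Or.inl ⟨a, ha⟩) hQ hβ hfa hf hu hV)
  | sink β f a ha hle fa hfa =>
    by_cases hu : IsUnit fa
    · exact Or.inl ⟨hu, hV.euler_pos_of_isUnit hQ hβ hf (Or.inr ⟨a, ha⟩) hfa hu⟩
    · exact Or.inr (exists_isSchofield_of_slicePair (Or.inr ⟨a, ha⟩) hQ hβ hfa hf hu hV)

/-- Follow the steps from S. The Tits form does not grow until a slice becomes constant, where it is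
positive. Such a slice must occur, because an irreducible polynomial is not constant. -/
theorem IsSchofield.pos_of_sliceable {S : QuiverFunction} (hS : Sliceable S) {k : ℤ}
    (h : IsSchofield S k) : 0 < k := by
  obtain ⟨T, hST, c, hc, hT⟩ := hS
  have hunit : IsUnit T.poly := isUnit_iff_exists_C.2 ⟨c, hc, hT⟩
  induction hST using Relation.ReflTransGen.head_induction_on generalizing k with
  | refl => exact absurd hunit h.2.2.1.not_isUnit
  | head hstep hrest ih =>
    rcases hstep with hstep | hstep
    · rcases h.sliceStep hstep with ⟨-, hk⟩ | ⟨k', hk', h'⟩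
      · exact hk
      · exact (ih h').trans_le hk'
    · exact ih (h.simplifyStep hstep)

theorem IsSchofield.eq_one_of_sliceable {S : QuiverFunction} (hS : Sliceable S) {k : ℤ}
    (h : IsSchofield S k) : k = 1 :=
  le_antisymm h.le_one (h.pos_of_sliceable hS)

/-- The vector α* is the dimension vector of the translate, which is exceptional when V is. -/
theorem isRealSchurRoot_of_dual (hQ : Acyclic Q) (hβ : ∀ x, β x ≠ 0) (hf : Irreducible f)
    (hV : Represents f V) (hq : euler (toInt α) (toInt α) = 1) {αs : Q → ℤ}
    (hαs : ∀ γ, euler (toInt α) γ = -euler γ αs) : IsRealSchurRoot αs := by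
  obtain ⟨ν, N, -, hν, hN⟩ := hV.exists_coRepresents hQ hβ hf
  have h1 : αs = toInt ν := rightWeight_injective hQ
    (((leftWeight_eq_rightWeight_iff _ _).2 hαs).symm.trans
      ((leftWeight_eq_rightWeight_iff _ _).2 hν))
  rw [h1]
  exact isRealSchurRoot_translate hν hN (hV.finrank_end hQ hβ hf) hq

/-- The Tits form of a non-constant slice of a function which depends on the removed arrow. -/
theorem exists_isSchofield_sub (h : SlicePair l j) (hQ : Acyclic Q) (hβ : ∀ x, β x ≠ 0)
    (hfa : IsInduced hle f fa) (hf : Irreducible f) (hu : ¬IsUnit fa) (hV : Represents f V)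
    (hdep : f ≠ restrictAt l f) {αs : Q → ℤ} (hαs : ∀ γ, euler (toInt α) γ = -euler γ αs) :
    ∃ m, IsSchofield ⟨SliceVertex β l j, sliceBeta β l j, fa⟩ (euler (toInt α) (toInt α) - m) ∧
      (m = 0 ↔
        ((∃ a : l ⟶ j, IsOneSource a) ∧ (toInt α l = toInt α j ∨ αs l = 0)) ∨
          ((∃ a : j ⟶ l, IsOneSink a) ∧ (toInt α l = 0 ∨ αs l = αs j))) := by
  have hQ' := hQ.of_prefunctor (sliceFold β l j)
  have hlt : β l < β j := hle.lt_of_ne fun heq =>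
    hdep (h.exists_represents_of_eq hQ hβ heq hfa hf hu hV).1
  -- By acyclicity l cannot be both a source towards j and a sink from j, so in each case one
  -- disjunct of the criterion is void.
  have hexcl : ¬((∃ a : l ⟶ j, IsOneSource a) ∧ ∃ a : j ⟶ l, IsOneSink a) := by
    rintro ⟨⟨a, -⟩, b, -⟩
    simpa using hQ l (a.toPath.cons b)
  rcases h with h | h
  · obtain ⟨-, hirr, α', V', hV', hk⟩ := exists_represents_of_source hQ hβ h hlt hfa hf hu hV
    refine ⟨_, ⟨hQ', sliceBeta_ne_zero, hirr, α', V', hV', hk hαs⟩, ?_⟩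
    rw [mul_eq_zero, sub_eq_zero, eq_comm (a := toInt α j)]
    exact ⟨fun h1 => Or.inl ⟨h, h1⟩, fun h1 => h1.elim (fun h2 => h2.2)
      fun h2 => absurd ⟨h, h2.1⟩ hexcl⟩
  · obtain ⟨hirr, α', V', hV', hk⟩ := exists_represents_of_sink hQ hβ h hlt hfa hf hu hV
    refine ⟨_, ⟨hQ', sliceBeta_ne_zero, hirr, α', V', hV', hk hαs⟩, ?_⟩
    rw [mul_eq_zero, sub_eq_zero, eq_comm (a := αs j)]
    exact ⟨fun h1 => Or.inr ⟨h, h1⟩, fun h1 => h1.elim (fun h2 => absurd ⟨h2.1, h⟩ hexcl)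
      fun h2 => h2.2⟩

end SliceStep

end QuiverSlice

end

open QuiverSlice in
theorem mainTheorem10 {Q : Type} [Fintype Q] [DecidableEq Q] [Quiver.{0} Q]
    [∀ x y : Q, Finite (x ⟶ y)] (hQ : Acyclic Q)
    (α β : Q → ℕ) (hβ : ∀ x, β x ≠ 0)
    (V : Rep ℂ α) (e : DomIdx α β ≃ CodIdx α β)
    (hirr : Irreducible (schofield V e))
    (hdep : ∀ (x y : Q) (a : x ⟶ y), ∃ p : Fin (β y) × Fin (β x),
      (⟨x, y, a, p⟩ : Coord β) ∈ (schofield V e).vars)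
    (αs : Q → ℤ) (hαs : ∀ γ : Q → ℤ, euler (toInt α) γ = -euler γ αs) :
    (¬ IsRealSchurRoot (toInt α) → ¬ Sliceable ⟨Q, β, schofield V e⟩) ∧
    (¬ IsRealSchurRoot αs → ¬ Sliceable ⟨Q, β, schofield V e⟩) ∧
    (IsRealSchurRoot (toInt α) →
      ∀ (l j : Q),
        ((∃ a : l ⟶ j, IsOneSource a) ∨ (∃ a : j ⟶ l, IsOneSink a)) →
      ∀ (hle : β l ≤ β j) (fa : MvPolynomial (Coord (sliceBeta β l j)) ℂ),
        IsInduced hle (schofield V e) fa → (∀ c : ℂ, fa ≠ MvPolynomial.C c) →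
      ∀ αa : SliceVertex β l j → ℤ, IsSemiInvariant fa (leftWeight αa) →
      ∀ T : QuiverFunction, Simplifies ⟨SliceVertex β l j, sliceBeta β l j, fa⟩ T →
      ∀ αa' : T.Vertex → ℤ, IsSemiInvariant T.poly (leftWeight αa') →
        List.TFAE
          [IsRealSchurRoot αa,
           IsRealSchurRoot αa',
           ((∃ a : l ⟶ j, IsOneSource a) ∧ (toInt α l = toInt α j ∨ αs l = 0)) ∨
             ((∃ a : j ⟶ l, IsOneSink a) ∧ (toInt α l = 0 ∨ αs l = αs j))]) := by
  have hV : Represents (schofield V e) V := schofield_represents V e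
  have hS : IsSchofield ⟨Q, β, schofield V e⟩ (euler (toInt α) (toInt α)) :=
    ⟨hQ, hβ, hirr, α, V, hV, rfl⟩
  refine ⟨fun h hs => h ?_, fun h hs => h ?_, ?_⟩
  · exact isRealSchurRoot_of_brick V (hV.finrank_end hQ hβ hirr) (hS.eq_one_of_sliceable hs)
  · exact isRealSchurRoot_of_dual hQ hβ hirr hV (hS.eq_one_of_sliceable hs) hαs
  · intro hα l j h hle fa hfa hc αa hαa T hT αa' hαa'
    have hu : ¬IsUnit fa := fun hu => by
      obtain ⟨c, -, h1⟩ := isUnit_iff_exists_C.1 hu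
      exact hc c h1
    -- Dependence on the removed arrow excludes β_l = β_j, because a non-constant slice there would
    -- make `f` independent of that arrow.
    have hdep' : schofield V e ≠ restrictAt l (schofield V e) := by
      intro h1
      obtain ⟨x, y, a, ha⟩ : ∃ (x y : Q) (_ : x ⟶ y), x = l ∨ y = l := by
        rcases h with ⟨a, -⟩ | ⟨a, -⟩
        · exact ⟨_, _, a, Or.inl rfl⟩
        · exact ⟨_, _, a, Or.inr rfl⟩
      obtain ⟨p, hp⟩ := hdep x y a
      rw [h1] at hp
      exact notMem_vars_restrictAt _ ha hp
    obtain ⟨m, hm, hm0⟩ := exists_isSchofield_sub h hQ hβ hfa hirr hu hV hdep' hαs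
    rw [hα.euler_self] at hm
    -- The slice and all its simplifications have Tits form 1 - m, so all three conditions say m =
    -- 0.
    have h1 := hm.isRealSchurRoot_iff hαa
    have h2 := (hm.simplifies hT).isRealSchurRoot_iff hαa'
    have h3 : (1 - m = 1) ↔ m = 0 := by omega
    tfae_have 1 ↔ 2 := h1.trans h2.symm
    tfae_have 1 ↔ 3 := h1.trans (h3.trans hm0)
    tfae_finish
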